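/- Let $d\in\{1,2,3\}$, let $\Omega\subset\mathbb R^d$ be a bounded Lipschitz domain, $T>0$, $Q=\Omega\times(0,T)$, $\omega=2\pi/T$, and let $\|\cdot\|$ be the norm of $L^2(Q)$ (or $[L^2(Q)]^d$), with value $+\infty$ outside that space. Let $\sigma,\nu$ be measurable on $\Omega$ with $0<\underline\sigma\le\sigma\le\overline\sigma$ and $0<\underline\nu\le\nu\le\overline\nu$ a.e., let $\lambda>0$ and $g_d\in[L^2(Q)]^d$. All derivatives are weak; $\nabla$ and $\nabla\cdot$ act in $x$. *Spaces.* $H^{1,0}_0(Q)$ is the space of $u\in L^2(Q)$ with $\nabla u\in[L^2(Q)]^d$ and $u=0$ on $\partial\Omega\times(0,T)$ (the closure in the norm $(\|u\|^2+\|\nabla u\|^2)^{1/2}$ of smooth functions vanishing near the lateral boundary). $H^{1,1}_{0,per}(Q)$ is the space of $u\in H^{1,0}_0(Q)$ with $\partial_tu\in L^2(Q)$ and $u(0)=u(T)$. $H(\mathrm{div},Q)$ is the space of $\tau\in[L^2(Q)]^d$ with $\nabla\cdot\tau(\cdot,t)\in L^2(\Omega)$ for a.e. $t\in(0,T)$.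 With the Fourier coefficients $u_k^c=\frac2T\int_0^Tu\cos(k\omega t)\,dt$ and $u_k^s=\frac2T\int_0^Tu\sin(k\omega t)\,dt$, $k\ge1$, let $H^{1,1/2}_{0,per}(Q)$ be the space of $u\in H^{1,0}_0(Q)$ with $\sum_{k\ge1}k\omega\,(\|u_k^c\|_{L^2(\Omega)}^2+\|u_k^s\|_{L^2(\Omega)}^2)<\infty$, and for $y,q$ in it put $$s(y,q)=\frac T2\sum_{k\ge1}k\omega\int_\Omega\sigma\,(y_k^sq_k^c-y_k^cq_k^s)\,dx ,$$ the extension of $\langle\sigma\,\partial_ty,q\rangle_{L^2(Q)}$. *State and cost.* For $v\in L^2(Q)$, the state $y(v)\in H^{1,1/2}_{0,per}(Q)$ is the weak solution of $\sigma\partial_ty-\nabla\cdot(\nu\nabla y)=v$ in $Q$, $y=0$ on $\partial\Omega\times(0,T)$, $y(0)=y(T)$, that is, $$\int_Q\nu\nabla y\cdot\nabla q\,dx\,dt+s(y,q)=\int_Qv\,q\,dx\,dt\qquad\forall q\in H^{1,1/2}_{0,per}(Q).$$ The cost is $\tilde{\mathcal J}(y,u)=\frac12\|\nabla y-g_d\|^2+\frac\lambda2\|u\|^2$.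 A control $u\in L^2(Q)$ is called optimal if $\tilde{\mathcal J}(y(u),u)\le\tilde{\mathcal J}(y(v),v)$ for all $v\in L^2(Q)$. *Majorant.* Let $C_F>0$ be a constant with $\|u\|\le C_F\|\nabla u\|$ for all $u\in H^{1,0}_0(Q)$ (Friedrichs' inequality), and set $\underline{\mu_1}=\frac1{\sqrt2}\min\{\underline\nu,\underline\sigma\}$, $\mathcal R_1(\eta,\tau,v)=\sigma\partial_t\eta-\nabla\cdot\tau-v$, $\mathcal R_2(\eta,\tau)=\tau-\nu\nabla\eta$, and $$\tilde{\mathcal J}^\oplus(\alpha,\beta;\eta,\tau,v)=\frac{1+\alpha}2\|\nabla\eta-g_d\|^2+\gamma\Big(\|\mathcal R_2(\eta,\tau)\|^2+\frac{C_F^2}{\beta}\|\mathcal R_1(\eta,\tau,v)\|^2\Big)+\frac\lambda2\|v\|^2,\qquad \gamma=\frac{(1+\alpha)(1+\beta)}{2\alpha\,\underline{\mu_1}^2}.$$ **Theorem.** A constant $C_F$ as above exists. Every $v\in L^2(Q)$ has exactly one state $y(v)$ (up to equality a.e.). There is an optimal control; moreover, whenever $y,p\in H^{1,1/2}_{0,per}(Q)$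 solve the optimality system $$\int_Q(\nabla y\cdot\nabla z-\nu\nabla p\cdot\nabla z)\,dx\,dt+s(p,z)=\int_Qg_d\cdot\nabla z\,dx\,dt,\qquad \int_Q(\nu\nabla y\cdot\nabla q+\lambda^{-1}p\,q)\,dx\,dt+s(y,q)=0$$ for all $z,q\in H^{1,1/2}_{0,per}(Q)$, the control $-\lambda^{-1}p$ is optimal with state $y$. For every such constant $C_F$: 1. $\tilde{\mathcal J}(y(v),v)\le\tilde{\mathcal J}^\oplus(\alpha,\beta;\eta,\tau,v)$ for all $v\in L^2(Q)$, $\eta\in H^{1,1}_{0,per}(Q)$, $\tau\in H(\mathrm{div},Q)$ and $\alpha,\beta>0$. 2. If $u$ is an optimal control, then $$\inf_{\eta\in H^{1,1}_{0,per}(Q),\ \tau\in H(\mathrm{div},Q),\ v\in L^2(Q),\ \alpha,\beta>0}\tilde{\mathcal J}^\oplus(\alpha,\beta;\eta,\tau,v)=\tilde{\mathcal J}(y(u),u);$$ in particular $\tilde{\mathcal J}(y(u),u)\le\tilde{\mathcal J}^\oplus(\alpha,\beta;\eta,\tau,v)$ for all such $\alpha,\beta,\eta,\tau,v$. The infimum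 is approached at $v=u$, $\eta=y(u)$, $\tau=\nu\nabla y(u)$ as $\alpha\to0^+$: one has $y(u)\in H^{1,1}_{0,per}(Q)$, $\nu\nabla y(u)\in H(\mathrm{div},Q)$, and $\tilde{\mathcal J}^\oplus(\alpha,\beta;y(u),\nu\nabla y(u),u)\to\tilde{\mathcal J}(y(u),u)$ as $\alpha\to0^+$ for every $\beta>0$. -/

import Mathlib

open MeasureTheory Set Filter Topology
open scoped ENNReal NNReal ContDiff

noncomputable section

namespace TPOC

/-- The space `ℝ^d` with its Euclidean norm. -/
abbrev Sp (d : ℕ) : Type := EuclideanSpace ℝ (Fin d)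

/-- Bounded Lipschitz domain: a bounded connected (nonempty) open set which, near every boundary
point, is the part above the graph of a Lipschitz function in a suitable direction `e`. -/
structure IsBoundedLipschitzDomain {d : ℕ} (Ω : Set (Sp d)) : Prop where
  isOpen : IsOpen Ω
  isConnected : IsConnected Ω
  isBounded : Bornology.IsBounded Ω
  lipschitz_boundary : ∀ x₀ ∈ frontier Ω, ∃ r : ℝ, 0 < r ∧ ∃ e : Sp d, ‖e‖ = 1 ∧
    ∃ (K : ℝ≥0) (ψ : (Submodule.span ℝ {e})ᗮ → ℝ), LipschitzWith K ψ ∧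
      ∀ x ∈ Metric.ball x₀ r,
        (x ∈ Ω ↔ ψ ((Submodule.span ℝ {e})ᗮ.orthogonalProjectionOnto x) < inner ℝ e x)

/-- Smooth compactly supported functions on the open set `U`. -/
def testFunctions {X : Type*} [NormedAddCommGroup X] [NormedSpace ℝ X] (U : Set X) :
    Set (X → ℝ) :=
  {φ | ContDiff ℝ ∞ φ ∧ HasCompactSupport φ ∧ tsupport φ ⊆ U}

variable {d : ℕ}

/-- The space-time cylinder `Q = Ω × (0,T)`. -/
def cyl (Ω : Set (Sp d)) (T : ℝ) : Set (Sp d × ℝ) := Ω ×ˢ Ioo 0 T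

/-- Lebesgue measure on `Q`. -/
def volQ (Ω : Set (Sp d)) (T : ℝ) : Measure (Sp d × ℝ) := volume.restrict (cyl Ω T)

/-- The `L²(Q)` norm, with value `∞` outside `L²(Q)`. -/
def nrm {F : Type*} [NormedAddCommGroup F] (Ω : Set (Sp d)) (T : ℝ) (f : Sp d × ℝ → F) : ℝ≥0∞ :=
  eLpNorm f 2 (volQ Ω T)

/-- Classical spatial gradient of a smooth function of `(x,t)`. -/
def spaceGrad (φ : Sp d × ℝ → ℝ) (z : Sp d × ℝ) : Sp d := gradient (fun x => φ (x, z.2)) z.1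

/-- Classical time derivative of a smooth function of `(x,t)`. -/
def timeDeriv (φ : Sp d × ℝ → ℝ) (z : Sp d × ℝ) : ℝ := deriv (fun t => φ (z.1, t)) z.2

/-- `g ∈ L²(Q)^d` is the weak spatial gradient of `u` on `Q`. -/
def HasWeakGrad (Ω : Set (Sp d)) (T : ℝ) (u : Sp d × ℝ → ℝ) (g : Sp d × ℝ → Sp d) : Prop :=
  MemLp g 2 (volQ Ω T) ∧ ∀ φ ∈ testFunctions (cyl Ω T),
    ∫ z, u z • spaceGrad φ z ∂(volQ Ω T) = -∫ z, φ z • g z ∂(volQ Ω T)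

/-- `w ∈ L²(Q)` is the weak time derivative of `u` on `Q`. -/
def HasWeakTimeDeriv (Ω : Set (Sp d)) (T : ℝ) (u w : Sp d × ℝ → ℝ) : Prop :=
  MemLp w 2 (volQ Ω T) ∧ ∀ φ ∈ testFunctions (cyl Ω T),
    ∫ z, u z * timeDeriv φ z ∂(volQ Ω T) = -∫ z, w z * φ z ∂(volQ Ω T)

/-- `h` is the spatial divergence of `τ`: for a.e. `t` the slice `h(·,t)` lies in `L²(Ω)` and is
the weak divergence of `τ(·,t)` in `Ω`. -/
def HasWeakDiv (Ω : Set (Sp d)) (T : ℝ) (τ : Sp d × ℝ → Sp d) (h : Sp d × ℝ → ℝ) : Prop :=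
  AEStronglyMeasurable h (volQ Ω T) ∧ ∀ᵐ t ∂(volume.restrict (Ioo (0 : ℝ) T)),
    MemLp (fun x => h (x, t)) 2 (volume.restrict Ω) ∧ ∀ φ ∈ testFunctions Ω,
      ∫ x in Ω, h (x, t) * φ x = -∫ x in Ω, inner ℝ (τ (x, t)) (gradient φ x)

/-- The weak gradient `∇u` (unique almost everywhere where it exists). -/
def wGrad (Ω : Set (Sp d)) (T : ℝ) (u : Sp d × ℝ → ℝ) : Sp d × ℝ → Sp d :=
  Classical.epsilon (HasWeakGrad Ω T u)

/-- The weak time derivative `∂ₜu` (unique almost everywhere where it exists). -/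
def wDt (Ω : Set (Sp d)) (T : ℝ) (u : Sp d × ℝ → ℝ) : Sp d × ℝ → ℝ :=
  Classical.epsilon (HasWeakTimeDeriv Ω T u)

/-- The weak spatial divergence `∇·τ` (unique almost everywhere where it exists). -/
def wDiv (Ω : Set (Sp d)) (T : ℝ) (τ : Sp d × ℝ → Sp d) : Sp d × ℝ → ℝ :=
  Classical.epsilon (HasWeakDiv Ω T τ)

/-- `L²(Q)`, as a set of functions. -/
def L2Q (Ω : Set (Sp d)) (T : ℝ) : Set (Sp d × ℝ → ℝ) := {u | MemLp u 2 (volQ Ω T)}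

/-- `H^{1,0}(Q)`. -/
def H10 (Ω : Set (Sp d)) (T : ℝ) : Set (Sp d × ℝ → ℝ) :=
  {u | u ∈ L2Q Ω T ∧ ∃ g, HasWeakGrad Ω T u g}

/-- `H^{1,0}_0(Q)`: zero boundary values on `∂Ω × (0,T)`, i.e. the closure in `H^{1,0}(Q)` of the
smooth functions that vanish near the lateral boundary. -/
def H10Zero (Ω : Set (Sp d)) (T : ℝ) : Set (Sp d × ℝ → ℝ) :=
  {u | u ∈ H10 Ω T ∧ ∃ φ : ℕ → Sp d × ℝ → ℝ,
    (∀ n, φ n ∈ testFunctions (Ω ×ˢ (univ : Set ℝ))) ∧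
    Tendsto (fun n => nrm Ω T (fun z => u z - φ n z)) atTop (𝓝 0) ∧
    Tendsto (fun n => nrm Ω T (fun z => wGrad Ω T u z - spaceGrad (φ n) z)) atTop (𝓝 0)}

/-- `H^{0,1}(Q)`. -/
def H01 (Ω : Set (Sp d)) (T : ℝ) : Set (Sp d × ℝ → ℝ) :=
  {u | u ∈ L2Q Ω T ∧ ∃ w, HasWeakTimeDeriv Ω T u w}

/-- `H^{0,1}_per(Q)`: the representative of `u` in `C([0,T]; L²(Ω))` satisfies `u(0) = u(T)`. -/
def H01per (Ω : Set (Sp d)) (T : ℝ) : Set (Sp d × ℝ → ℝ) :=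
  {u | u ∈ H01 Ω T ∧ ∃ U : ℝ → Lp ℝ 2 (volume.restrict Ω),
    ContinuousOn U (Icc 0 T) ∧
    (∀ᵐ t ∂(volume.restrict (Ioo (0 : ℝ) T)),
      (U t : Sp d → ℝ) =ᵐ[volume.restrict Ω] fun x => u (x, t)) ∧
    U 0 = U T}

/-- `H^{1,1}_{0,per}(Q)`. -/
def H11ZeroPer (Ω : Set (Sp d)) (T : ℝ) : Set (Sp d × ℝ → ℝ) := H10Zero Ω T ∩ H01per Ω T

/-- `H(div,Q)`: `τ ∈ L²(Q)^d` with `∇·τ(·,t) ∈ L²(Ω)` for a.e. `t ∈ (0,T)`. -/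
def Hdiv (Ω : Set (Sp d)) (T : ℝ) : Set (Sp d × ℝ → Sp d) :=
  {τ | MemLp τ 2 (volQ Ω T) ∧ ∃ h, HasWeakDiv Ω T τ h}

/-- Frequency `ω = 2π/T`. -/
def freq (T : ℝ) : ℝ := 2 * Real.pi / T

/-- Fourier cosine coefficient `u_k^c(x)`, for `k ≥ 1`. -/
def cosCoeff (T : ℝ) (k : ℕ) (u : Sp d × ℝ → ℝ) (x : Sp d) : ℝ :=
  2 / T * ∫ t in (0 : ℝ)..T, u (x, t) * Real.cos (k * freq T * t)

/-- Fourier sine coefficient `u_k^s(x)`, for `k ≥ 1`. -/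
def sinCoeff (T : ℝ) (k : ℕ) (u : Sp d × ℝ → ℝ) (x : Sp d) : ℝ :=
  2 / T * ∫ t in (0 : ℝ)..T, u (x, t) * Real.sin (k * freq T * t)

/-- `‖∂ₜ^{1/2} u‖² = (T/2) ∑_{k ≥ 1} k ω (‖u_k^c‖²_Ω + ‖u_k^s‖²_Ω)`; the summation index below is
`k - 1`. -/
def halfSq (Ω : Set (Sp d)) (T : ℝ) (u : Sp d × ℝ → ℝ) : ℝ≥0∞ :=
  ENNReal.ofReal (T / 2) * ∑' j : ℕ, ENNReal.ofReal (((j + 1 : ℕ) : ℝ) * freq T) *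
    (eLpNorm (cosCoeff T (j + 1) u) 2 (volume.restrict Ω) ^ 2 +
      eLpNorm (sinCoeff T (j + 1) u) 2 (volume.restrict Ω) ^ 2)

/-- `H^{1,1/2}_{0,per}(Q)`. -/
def H1halfZeroPer (Ω : Set (Sp d)) (T : ℝ) : Set (Sp d × ℝ → ℝ) :=
  {u | u ∈ H10Zero Ω T ∧ halfSq Ω T u < ⊤}

/-- The extension `(T/2) ∑_{k ≥ 1} k ω ∫_Ω σ (y_k^s q_k^c - y_k^c q_k^s) dx` of
`⟨σ ∂ₜy, q⟩` to `y, q ∈ H^{1,1/2}_{0,per}(Q)`, i.e. with the `k`-th term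
`k ω ⟨σ y_k, q_k^⊥⟩`, where `q_k^⊥ = (-q_k^s, q_k^c)`. -/
def timeForm (Ω : Set (Sp d)) (T : ℝ) (σ : Sp d → ℝ) (y q : Sp d × ℝ → ℝ) : ℝ :=
  T / 2 * ∑' j : ℕ, ((j + 1 : ℕ) : ℝ) * freq T *
    ∫ x in Ω, σ x * (sinCoeff T (j + 1) y x * cosCoeff T (j + 1) q x
      - cosCoeff T (j + 1) y x * sinCoeff T (j + 1) q x)

/-- `y = y(v)` is the state belonging to the control `v`: the weak solution in
`H^{1,1/2}_{0,per}(Q)` of `σ ∂ₜy - ∇·(ν∇y) = v`, `y = 0` on `∂Ω × (0,T)`, `y(0) = y(T)`. -/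
def IsState (Ω : Set (Sp d)) (T : ℝ) (σ ν : Sp d → ℝ) (v y : Sp d × ℝ → ℝ) : Prop :=
  y ∈ H1halfZeroPer Ω T ∧ ∀ q ∈ H1halfZeroPer Ω T,
    (∫ z, ν z.1 * inner ℝ (wGrad Ω T y z) (wGrad Ω T q z) ∂(volQ Ω T)) + timeForm Ω T σ y q
      = ∫ z, v z * q z ∂(volQ Ω T)

/-- The cost `½‖∇y - g_d‖² + (lam/2)‖u‖²`. -/
def cost (Ω : Set (Sp d)) (T lam : ℝ) (gd : Sp d × ℝ → Sp d) (y u : Sp d × ℝ → ℝ) : ℝ≥0∞ :=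
  ENNReal.ofReal (1 / 2) * nrm Ω T (fun z => wGrad Ω T y z - gd z) ^ 2
    + ENNReal.ofReal (lam / 2) * nrm Ω T u ^ 2

/-- `u ∈ L²(Q)` with state `y` minimizes the cost among all controls in `L²(Q)`. -/
def IsOptimal (Ω : Set (Sp d)) (T : ℝ) (σ ν : Sp d → ℝ) (lam : ℝ) (gd : Sp d × ℝ → Sp d)
    (u y : Sp d × ℝ → ℝ) : Prop :=
  u ∈ L2Q Ω T ∧ IsState Ω T σ ν u y ∧ ∀ v ∈ L2Q Ω T, ∀ y', IsState Ω T σ ν v y' →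
    cost Ω T lam gd y u ≤ cost Ω T lam gd y' v

/-- The weak optimality system for the state `y` and the adjoint state `p`. -/
def IsOptimalitySystemSolution (Ω : Set (Sp d)) (T : ℝ) (σ ν : Sp d → ℝ) (lam : ℝ)
    (gd : Sp d × ℝ → Sp d) (y p : Sp d × ℝ → ℝ) : Prop :=
  y ∈ H1halfZeroPer Ω T ∧ p ∈ H1halfZeroPer Ω T ∧
  (∀ z ∈ H1halfZeroPer Ω T,
    (∫ a, (inner ℝ (wGrad Ω T y a) (wGrad Ω T z a) - ν a.1 * inner ℝ (wGrad Ω T p a) (wGrad Ω T z a))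
        ∂(volQ Ω T)) + timeForm Ω T σ p z
      = ∫ a, inner ℝ (gd a) (wGrad Ω T z a) ∂(volQ Ω T)) ∧
  (∀ q ∈ H1halfZeroPer Ω T,
    (∫ a, (ν a.1 * inner ℝ (wGrad Ω T y a) (wGrad Ω T q a) + lam⁻¹ * (p a * q a)) ∂(volQ Ω T))
      + timeForm Ω T σ y q = 0)

/-- `C` is a constant in Friedrichs' inequality `‖u‖ ≤ C ‖∇u‖` on `H^{1,0}_0(Q)`. -/
def IsFriedrichsConstant (Ω : Set (Sp d)) (T C : ℝ) : Prop :=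
  0 < C ∧ ∀ u ∈ H10Zero Ω T, nrm Ω T u ≤ ENNReal.ofReal C * nrm Ω T (wGrad Ω T u)

/-- `R₁(η,τ,v) = σ ∂ₜη - ∇·τ - v`. -/
def R1 (Ω : Set (Sp d)) (T : ℝ) (σ : Sp d → ℝ) (η : Sp d × ℝ → ℝ) (τ : Sp d × ℝ → Sp d)
    (v : Sp d × ℝ → ℝ) (z : Sp d × ℝ) : ℝ :=
  σ z.1 * wDt Ω T η z - wDiv Ω T τ z - v z

/-- `R₂(η,τ) = τ - ν ∇η`. -/
def R2 (Ω : Set (Sp d)) (T : ℝ) (ν : Sp d → ℝ) (η : Sp d × ℝ → ℝ) (τ : Sp d × ℝ → Sp d)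
    (z : Sp d × ℝ) : Sp d :=
  τ z - ν z.1 • wGrad Ω T η z

/-- `μ₁ = min{ν₀, σ₀}/√2` for the lower bounds `ν₀`, `σ₀` of the coefficients. -/
def mu1 (ν₀ σ₀ : ℝ) : ℝ := 1 / Real.sqrt 2 * min ν₀ σ₀

/-- `γ = (1+α)(1+β) / (2 α μ₁²)`. -/
def gam (α β μ : ℝ) : ℝ := (1 + α) * (1 + β) / (2 * α * μ ^ 2)

/-- The majorant `(1+α)/2 ‖∇η - g_d‖² + γ (‖R₂‖² + (C_F²/β) ‖R₁‖²) + (lam/2) ‖v‖²`, with values in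
`[0,∞]` (it is `∞` exactly when `∇·τ` is not in `L²(Q)`). -/
def majorant (Ω : Set (Sp d)) (T : ℝ) (σ ν : Sp d → ℝ) (σ₀ ν₀ CF lam : ℝ)
    (gd : Sp d × ℝ → Sp d) (α β : ℝ) (η : Sp d × ℝ → ℝ) (τ : Sp d × ℝ → Sp d)
    (v : Sp d × ℝ → ℝ) : ℝ≥0∞ :=
  ENNReal.ofReal ((1 + α) / 2) * nrm Ω T (fun z => wGrad Ω T η z - gd z) ^ 2
    + ENNReal.ofReal (gam α β (mu1 ν₀ σ₀)) *
        (nrm Ω T (R2 Ω T ν η τ) ^ 2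
          + ENNReal.ofReal (CF ^ 2 / β) * nrm Ω T (R1 Ω T σ η τ v) ^ 2)
    + ENNReal.ofReal (lam / 2) * nrm Ω T v ^ 2

end TPOC

end

open MeasureTheory Set Filter Topology
open scoped ENNReal NNReal ContDiff

noncomputable section

/-! The analytic core is that a state has more regularity than its space `H1halfZeroPer` records:
its time derivative lies in `L²(Q)`. Since `σ` and `ν` do not depend on `t`, the space-time equation
can be tested with `q + ∂ₜq` for smooth `T`-periodic `q` vanishing near the lateral boundary. The
cross terms `ν ∇q · ∇∂ₜq` and `σ q ∂ₜq` are time derivatives up to a factor in `x` and integrate to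
zero over a period, which leaves `∫ ν |∇q|² + ∫ σ |∂ₜq|²`. Lions' projection lemma (`exists_lions`)
then yields a limit of smooth periodic functions in the norm of `(∇q, ∂ₜq)`
(`exists_solution_limit`). A trace inequality makes the time slices converge uniformly, so the limit
is periodic in the sense of `H01per` (`mem_H01per_of_tendsto`).

That limit satisfies the equation only against `ψ + ∂ₜψ`. With `ψ = φ(x) χ(t)` and trigonometric
`χ`, the operator `1 + d/dt` is invertible on each frequency, so all Fourier coefficients in time of
the spatial weak form vanish. The equation therefore holds on almost every time slice, first for
each `φ`, then by separability for all `φ` at once. This gives the divergence of the flux and, by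
density and Parseval's identity (`timeForm_eq_integral`), the weak formulation
(`exists_regular_state`). Uniqueness follows from the antisymmetry of the time form, Friedrichs'
inequality and the positivity of `ν`, so every state is regular (`IsState.regular`).

For the majorant, put `e = y - η`. Antisymmetry allows `timeForm y e` to be replaced by `∫ σ ∂ₜη e`,
and integrating `τ` by parts gives `∫ ν |∇e|² = ∫ R₂ · ∇e - ∫ R₁ e`. Hence `ν₀ ‖∇e‖ ≤ C_F ‖R₁‖ +
‖R₂‖` (`l2_grad_error_le`). The triangle inequality and Young's inequality with `α` and then `β`
produce the majorant (`sq_le_of_two_young`, `cost_le_majorant`). At `η = y`, `τ = ν ∇y` both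
residuals vanish, so the majorant tends to the cost as `α → 0`; this is where the regularity of the
state is indispensable.

Optimal controls exist because the map from the control to the gradient of its state is bounded and
linear, so the cost is a Tikhonov functional on `L²(Q)`. Solutions of the optimality system are
optimal by convexity. -/

namespace TPOC

/-! ### Square integrable functions: norms, limits and pairings. -/

section L2norm

variable {X : Type*} [MeasurableSpace X] {μ : Measure X} {E : Type*} [NormedAddCommGroup E]

/-- The real-valued `L²` norm. -/
def l2 (μ : Measure X) (f : X → E) : ℝ := (eLpNorm f 2 μ).toReal

lemma l2_nonneg (f : X → E) : 0 ≤ l2 μ f := ENNReal.toReal_nonneg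

lemma ofReal_l2 {f : X → E} (hf : MemLp f 2 μ) : ENNReal.ofReal (l2 μ f) = eLpNorm f 2 μ :=
  ENNReal.ofReal_toReal hf.2.ne

lemma l2_congr {f g : X → E} (h : f =ᵐ[μ] g) : l2 μ f = l2 μ g := by
  simp only [l2, eLpNorm_congr_ae h]

lemma norm_toLp_eq_l2 {f : X → E} (hf : MemLp f 2 μ) : ‖hf.toLp f‖ = l2 μ f := Lp.norm_toLp f hf

lemma l2_add_le {f g : X → E} (hf : MemLp f 2 μ) (hg : MemLp g 2 μ) :
    l2 μ (fun x => f x + g x) ≤ l2 μ f + l2 μ g := by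
  have := norm_add_le (hf.toLp f) (hg.toLp g)
  rw [← MemLp.toLp_add, norm_toLp_eq_l2, norm_toLp_eq_l2, norm_toLp_eq_l2] at this
  exact this

lemma l2_le_of_eLpNorm_le {F : Type*} [NormedAddCommGroup F] {f : X → E} {g : X → F} {C : ℝ}
    (hC : 0 ≤ C) (hg : MemLp g 2 μ)
    (h : eLpNorm f 2 μ ≤ ENNReal.ofReal C * eLpNorm g 2 μ) : l2 μ f ≤ C * l2 μ g := by
  have := ENNReal.toReal_mono (ENNReal.mul_ne_top ENNReal.ofReal_ne_top hg.2.ne) h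
  rwa [ENNReal.toReal_mul, ENNReal.toReal_ofReal hC] at this

lemma tendsto_eLpNorm_zero_iff {f : ℕ → X → E} (hf : ∀ n, MemLp (f n) 2 μ) :
    Tendsto (fun n => eLpNorm (f n) 2 μ) atTop (𝓝 0) ↔ Tendsto (fun n => l2 μ (f n)) atTop (𝓝 0) := by
  rw [← ENNReal.tendsto_toReal_iff (fun n => (hf n).2.ne) ENNReal.zero_ne_top]
  rfl

/-- Completeness of `L²` for sequences of functions. -/
lemma exists_l2_limit [CompleteSpace E] {f : ℕ → X → E} (hf : ∀ n, MemLp (f n) 2 μ)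
    (hc : CauchySeq fun n => (hf n).toLp (f n)) :
    ∃ g, MemLp g 2 μ ∧ Tendsto (fun n => l2 μ (fun x => g x - f n x)) atTop (𝓝 0) := by
  obtain ⟨G, hG⟩ := cauchySeq_tendsto_of_complete hc
  refine ⟨G, Lp.memLp G, ?_⟩
  have h := (tendsto_const_nhds (x := G)).sub hG
  rw [sub_self] at h
  refine (h.norm.congr fun n => ?_).trans (by simp)
  rw [Lp.norm_def]
  refine congrArg _ (eLpNorm_congr_ae ?_)
  filter_upwards [Lp.coeFn_sub G ((hf n).toLp (f n)), (hf n).coeFn_toLp] with x h1 h2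
  rw [h1, Pi.sub_apply, h2]

lemma l2_sub_comm (f g : X → E) : l2 μ (fun x => f x - g x) = l2 μ (fun x => g x - f x) := by
  unfold l2
  rw [← eLpNorm_neg]
  congr 2
  ext x; simp

lemma tendsto_toLp {f : ℕ → X → E} (hf : ∀ n, MemLp (f n) 2 μ) {g : X → E} (hg : MemLp g 2 μ)
    (h : Tendsto (fun n => l2 μ (fun x => g x - f n x)) atTop (𝓝 0)) :
    Tendsto (fun n => (hf n).toLp (f n)) atTop (𝓝 (hg.toLp g)) := by
  rw [tendsto_iff_norm_sub_tendsto_zero]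
  refine h.congr fun n => ?_
  rw [← MemLp.toLp_sub, norm_toLp_eq_l2, l2_sub_comm]
  rfl

lemma tendsto_l2 {f : ℕ → X → E} (hf : ∀ n, MemLp (f n) 2 μ) {g : X → E} (hg : MemLp g 2 μ)
    (h : Tendsto (fun n => l2 μ (fun x => g x - f n x)) atTop (𝓝 0)) :
    Tendsto (fun n => l2 μ (f n)) atTop (𝓝 (l2 μ g)) := by
  have := (tendsto_toLp hf hg h).norm
  simpa only [norm_toLp_eq_l2] using this

lemma eq_zero_of_l2_eq_zero {f : X → E} (hf : MemLp f 2 μ) (h : l2 μ f = 0) : f =ᵐ[μ] 0 := by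
  rw [← eLpNorm_eq_zero_iff hf.1 two_ne_zero, ← ofReal_l2 hf, h, ENNReal.ofReal_zero]

variable [InnerProductSpace ℝ E]

lemma inner_toLp {f g : X → E} (hf : MemLp f 2 μ) (hg : MemLp g 2 μ) :
    inner ℝ (hf.toLp f) (hg.toLp g) = ∫ x, inner ℝ (f x) (g x) ∂μ := by
  rw [L2.inner_def]
  refine integral_congr_ae ?_
  filter_upwards [hf.coeFn_toLp, hg.coeFn_toLp] with x h1 h2
  rw [h1, h2]

lemma integrable_inner {f g : X → E} (hf : MemLp f 2 μ) (hg : MemLp g 2 μ) :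
    Integrable (fun x => inner ℝ (f x) (g x)) μ := by
  refine (L2.integrable_inner (𝕜 := ℝ) (hf.toLp f) (hg.toLp g)).congr ?_
  filter_upwards [hf.coeFn_toLp, hg.coeFn_toLp] with x h1 h2
  rw [h1, h2]

lemma abs_integral_inner_le {f g : X → E} (hf : MemLp f 2 μ) (hg : MemLp g 2 μ) :
    |∫ x, inner ℝ (f x) (g x) ∂μ| ≤ l2 μ f * l2 μ g := by
  rw [← inner_toLp hf hg, ← norm_toLp_eq_l2 hf, ← norm_toLp_eq_l2 hg]
  exact abs_real_inner_le_norm _ _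

lemma sq_l2 {f : X → E} (hf : MemLp f 2 μ) : l2 μ f ^ 2 = ∫ x, inner ℝ (f x) (f x) ∂μ := by
  rw [← inner_toLp hf hf, real_inner_self_eq_norm_sq, norm_toLp_eq_l2]

lemma tendsto_integral_inner {f : ℕ → X → E} (hf : ∀ n, MemLp (f n) 2 μ) {f₀ g : X → E}
    (hf₀ : MemLp f₀ 2 μ) (h : Tendsto (fun n => l2 μ (fun x => f₀ x - f n x)) atTop (𝓝 0))
    (hg : MemLp g 2 μ) :
    Tendsto (fun n => ∫ x, inner ℝ (g x) (f n x) ∂μ) atTop (𝓝 (∫ x, inner ℝ (g x) (f₀ x) ∂μ)) := by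
  have := (tendsto_const_nhds (x := hg.toLp g)).inner (𝕜 := ℝ) (tendsto_toLp hf hf₀ h)
  simpa only [inner_toLp] using this

lemma integrable_mul_l2 {f g : X → ℝ} (hf : MemLp f 2 μ) (hg : MemLp g 2 μ) :
    Integrable (fun x => f x * g x) μ := by
  simpa [mul_comm] using integrable_inner hf hg

lemma abs_integral_mul_le {f g : X → ℝ} (hf : MemLp f 2 μ) (hg : MemLp g 2 μ) :
    |∫ x, f x * g x ∂μ| ≤ l2 μ f * l2 μ g := by
  simpa [mul_comm] using abs_integral_inner_le hf hg

lemma sq_l2' {f : X → ℝ} (hf : MemLp f 2 μ) : l2 μ f ^ 2 = ∫ x, f x ^ 2 ∂μ := by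
  simpa [pow_two] using sq_l2 hf

lemma tendsto_integral_mul {f : ℕ → X → ℝ} (hf : ∀ n, MemLp (f n) 2 μ) {f₀ g : X → ℝ}
    (hf₀ : MemLp f₀ 2 μ) (h : Tendsto (fun n => l2 μ (fun x => f₀ x - f n x)) atTop (𝓝 0))
    (hg : MemLp g 2 μ) :
    Tendsto (fun n => ∫ x, g x * f n x ∂μ) atTop (𝓝 (∫ x, g x * f₀ x ∂μ)) := by
  simpa [mul_comm] using tendsto_integral_inner hf hf₀ h hg

/-- Multiplication of an `L²` function by an essentially bounded coefficient. -/
lemma memLp_smul_bdd {a : X → ℝ} {C : ℝ} (ha : AEStronglyMeasurable a μ) (hC : ∀ᵐ x ∂μ, |a x| ≤ C)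
    {f : X → E} (hf : MemLp f 2 μ) : MemLp (fun x => a x • f x) 2 μ := by
  refine (hf.const_smul C).mono (ha.smul hf.1) ?_
  filter_upwards [hC] with x hx
  rw [norm_smul, Pi.smul_apply, norm_smul, Real.norm_eq_abs, Real.norm_eq_abs]
  exact mul_le_mul_of_nonneg_right (hx.trans (le_abs_self C)) (norm_nonneg _)

lemma memLp_mul_bdd {a : X → ℝ} {C : ℝ} (ha : AEStronglyMeasurable a μ) (hC : ∀ᵐ x ∂μ, |a x| ≤ C)
    {f : X → ℝ} (hf : MemLp f 2 μ) : MemLp (fun x => a x * f x) 2 μ :=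
  memLp_smul_bdd ha hC hf

end L2norm

/-! ### Smooth functions on the cylinder and integration by parts. -/

section Smooth

variable {d : ℕ}

/-- The Riesz representative of the spatial part of a functional on space-time. -/
def spaceRiesz (d : ℕ) : (Sp d × ℝ →L[ℝ] ℝ) →L[ℝ] Sp d :=
  ∑ i : Fin d, (ContinuousLinearMap.apply ℝ ℝ ((EuclideanSpace.single i 1 : Sp d), (0 : ℝ))).smulRight
    (EuclideanSpace.single i 1)

lemma inner_spaceRiesz (l : Sp d × ℝ →L[ℝ] ℝ) (a : Sp d) :
    inner ℝ (spaceRiesz d l) a = l (a, 0) := by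
  have h : l (a, 0) = (l.comp (ContinuousLinearMap.inl ℝ (Sp d) ℝ)) a := by simp
  rw [h]
  conv_rhs => rw [← (EuclideanSpace.basisFun (Fin d) ℝ).sum_repr a, map_sum]
  rw [spaceRiesz, sum_apply, sum_inner]
  refine Finset.sum_congr rfl fun i _ => ?_
  simp [real_inner_smul_left, mul_comm, EuclideanSpace.inner_single_left]

lemma spaceGrad_eq {φ : Sp d × ℝ → ℝ} {z : Sp d × ℝ} (h : DifferentiableAt ℝ φ z) :
    spaceGrad φ z = spaceRiesz d (fderiv ℝ φ z) := by
  refine ext_inner_right ℝ fun a => ?_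
  have h1 : HasFDerivAt (fun x : Sp d => φ (x, z.2))
      ((fderiv ℝ φ z).comp (ContinuousLinearMap.inl ℝ (Sp d) ℝ)) z.1 := by
    have h2 : HasFDerivAt (fun x : Sp d => (x, z.2)) (ContinuousLinearMap.inl ℝ (Sp d) ℝ) z.1 :=
      hasFDerivAt_prodMk_left z.1 z.2
    exact HasFDerivAt.comp z.1 (f := fun x : Sp d => (x, z.2)) h.hasFDerivAt h2
  rw [inner_spaceRiesz, spaceGrad, gradient, h1.fderiv]
  simp

lemma timeDeriv_eq {φ : Sp d × ℝ → ℝ} {z : Sp d × ℝ} (h : DifferentiableAt ℝ φ z) :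
    timeDeriv φ z = fderiv ℝ φ z (0, 1) := by
  have h2 : HasDerivAt (fun t : ℝ => (z.1, t)) ((0 : Sp d), (1 : ℝ)) z.2 :=
    (hasDerivAt_const _ _).prodMk (hasDerivAt_id _)
  exact (HasFDerivAt.comp_hasDerivAt z.2 (f := fun t : ℝ => (z.1, t)) h.hasFDerivAt h2).deriv

lemma hasDerivAt_timeDeriv {φ : Sp d × ℝ → ℝ} (h : Differentiable ℝ φ) (x : Sp d) (t : ℝ) :
    HasDerivAt (fun s => φ (x, s)) (timeDeriv φ (x, t)) t := by
  rw [timeDeriv_eq (h _)]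
  have h2 : HasDerivAt (fun t : ℝ => (x, t)) ((0 : Sp d), (1 : ℝ)) t :=
    (hasDerivAt_const _ _).prodMk (hasDerivAt_id _)
  exact HasFDerivAt.comp_hasDerivAt t (f := fun t : ℝ => (x, t)) (h _).hasFDerivAt h2

variable {φ ψ : Sp d × ℝ → ℝ}

lemma contDiff_fderiv (h : ContDiff ℝ ∞ φ) : ContDiff ℝ ∞ (fderiv ℝ φ) :=
  h.fderiv_right (m := ∞) (by simp)

lemma contDiff_differentiable (h : ContDiff ℝ ∞ φ) : Differentiable ℝ φ :=
  h.differentiable (by simp)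

lemma spaceGrad_fun_eq (h : ContDiff ℝ ∞ φ) :
    spaceGrad φ = fun z => spaceRiesz d (fderiv ℝ φ z) :=
  funext fun z => spaceGrad_eq (contDiff_differentiable h z)

lemma timeDeriv_fun_eq (h : ContDiff ℝ ∞ φ) : timeDeriv φ = fun z => fderiv ℝ φ z (0, 1) :=
  funext fun z => timeDeriv_eq (contDiff_differentiable h z)

lemma continuous_spaceGrad (h : ContDiff ℝ ∞ φ) : Continuous (spaceGrad φ) := by
  rw [spaceGrad_fun_eq h]
  exact (spaceRiesz d).continuous.comp (contDiff_fderiv h).continuous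

lemma contDiff_timeDeriv (h : ContDiff ℝ ∞ φ) : ContDiff ℝ ∞ (timeDeriv φ) := by
  rw [timeDeriv_fun_eq h]
  exact (contDiff_fderiv h).clm_apply contDiff_const

lemma spaceGrad_add (h : ContDiff ℝ ∞ φ) (h' : ContDiff ℝ ∞ ψ) (z : Sp d × ℝ) :
    spaceGrad (φ + ψ) z = spaceGrad φ z + spaceGrad ψ z := by
  have h1 := contDiff_differentiable h
  have h2 := contDiff_differentiable h'
  rw [spaceGrad_eq (h1 z), spaceGrad_eq (h2 z), spaceGrad_eq ((h1.add h2) z),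
    fderiv_add (h1 z) (h2 z), map_add]

lemma spaceGrad_smul (h : ContDiff ℝ ∞ φ) (c : ℝ) (z : Sp d × ℝ) :
    spaceGrad (c • φ) z = c • spaceGrad φ z := by
  have h1 := contDiff_differentiable h
  rw [spaceGrad_eq (h1 z), spaceGrad_eq ((h1.const_smul c) z), fderiv_const_smul (h1 z), map_smul]

lemma timeDeriv_add (h : ContDiff ℝ ∞ φ) (h' : ContDiff ℝ ∞ ψ) (z : Sp d × ℝ) :
    timeDeriv (φ + ψ) z = timeDeriv φ z + timeDeriv ψ z := by
  have h1 := contDiff_differentiable h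
  have h2 := contDiff_differentiable h'
  rw [timeDeriv_eq (h1 z), timeDeriv_eq (h2 z), timeDeriv_eq ((h1.add h2) z),
    fderiv_add (h1 z) (h2 z)]
  rfl

lemma timeDeriv_smul (h : ContDiff ℝ ∞ φ) (c : ℝ) (z : Sp d × ℝ) :
    timeDeriv (c • φ) z = c * timeDeriv φ z := by
  have h1 := contDiff_differentiable h
  rw [timeDeriv_eq (h1 z), timeDeriv_eq ((h1.const_smul c) z), fderiv_const_smul (h1 z)]
  rfl

lemma spaceGrad_mul_time {χ : ℝ → ℝ} (h : ContDiff ℝ ∞ φ) (z : Sp d × ℝ) :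
    spaceGrad (fun z => φ z * χ z.2) z = χ z.2 • spaceGrad φ z := by
  have h1 : DifferentiableAt ℝ (fun x => φ (x, z.2)) z.1 :=
    ((contDiff_differentiable h).comp
      (differentiable_id.prodMk (differentiable_const _))).differentiableAt
  have h2 : fderiv ℝ (fun x => φ (x, z.2) * χ z.2) z.1
      = χ z.2 • fderiv ℝ (fun x => φ (x, z.2)) z.1 := fderiv_mul_const h1 _
  simp only [spaceGrad, gradient]
  rw [h2, map_smul]

/-- Time derivative and spatial gradient commute. -/
lemma hasDerivAt_spaceGrad (h : ContDiff ℝ ∞ φ) (x : Sp d) (t : ℝ) :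
    HasDerivAt (fun s => spaceGrad φ (x, s)) (spaceGrad (timeDeriv φ) (x, t)) t := by
  have h2 : HasDerivAt (fun t : ℝ => (x, t)) ((0 : Sp d), (1 : ℝ)) t :=
    (hasDerivAt_const _ _).prodMk (hasDerivAt_id _)
  have hd : DifferentiableAt ℝ (fderiv ℝ φ) (x, t) :=
    (contDiff_fderiv h).differentiable (by simp) _
  have h3 := (spaceRiesz d).hasFDerivAt.comp_hasDerivAt t
    (HasFDerivAt.comp_hasDerivAt t (f := fun t : ℝ => (x, t)) hd.hasFDerivAt h2)
  have h4 : spaceGrad (timeDeriv φ) (x, t)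
      = spaceRiesz d (fderiv ℝ (fderiv ℝ φ) (x, t) (0, 1)) := by
    refine ext_inner_right ℝ fun a => ?_
    rw [spaceGrad_eq (contDiff_differentiable (contDiff_timeDeriv h) _), inner_spaceRiesz,
      inner_spaceRiesz, timeDeriv_fun_eq h, fderiv_clm_apply hd (differentiableAt_const _)]
    -- Symmetry of the second derivative exchanges the spatial direction `(a, 0)` with the time
    -- direction `(0, 1)`.
    have hs : IsSymmSndFDerivAt ℝ φ (x, t) := h.contDiffAt.isSymmSndFDerivAt (by simp; exact WithTop.coe_le_coe.2 le_top)
    simpa using hs.eq (a, 0) (0, 1)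
  rw [h4, spaceGrad_fun_eq h]
  exact h3

/-- Smooth functions of `(x,t)` whose support in `x` lies in a fixed compact subset of `Ω`. -/
def smoothLat (Ω : Set (Sp d)) : Submodule ℝ (Sp d × ℝ → ℝ) where
  carrier := {φ | ContDiff ℝ ∞ φ ∧ ∃ K ⊆ Ω, IsCompact K ∧ ∀ x ∉ K, ∀ t, φ (x, t) = 0}
  add_mem' := by
    rintro φ ψ ⟨h1, K, hK, hKc, h⟩ ⟨h1', K', hK', hKc', h'⟩
    refine ⟨h1.add h1', K ∪ K', union_subset hK hK', hKc.union hKc', fun x hx t => ?_⟩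
    simp only [mem_union, not_or] at hx
    simp [h x hx.1, h' x hx.2]
  zero_mem' := ⟨contDiff_const, ∅, empty_subset _, isCompact_empty, by simp⟩
  smul_mem' := by
    rintro c φ ⟨h1, K, hK, hKc, h⟩
    exact ⟨h1.const_smul c, K, hK, hKc, fun x hx t => by simp [h x hx]⟩

variable {Ω : Set (Sp d)} {T : ℝ}

lemma mul_time_mem_smoothLat (h : φ ∈ smoothLat Ω) {χ : ℝ → ℝ} (hχ : ContDiff ℝ ∞ χ) :
    (fun z => φ z * χ z.2) ∈ smoothLat Ω := by
  obtain ⟨h1, K, hK, hKc, h⟩ := h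
  exact ⟨h1.mul (hχ.comp contDiff_snd), K, hK, hKc, fun x hx t => by simp [h x hx]⟩

lemma testFunctions_lat_subset {I : Set ℝ} (h : φ ∈ testFunctions (Ω ×ˢ I)) : φ ∈ smoothLat Ω := by
  obtain ⟨h1, h2, h3⟩ := h
  refine ⟨h1, Prod.fst '' tsupport φ, ?_, h2.image continuous_fst, fun x hx t => ?_⟩
  · rintro _ ⟨z, hz, rfl⟩
    exact (h3 hz).1
  · by_contra h0
    exact hx ⟨(x, t), subset_tsupport _ h0, rfl⟩

lemma space_mem_smoothLat {f : Sp d → ℝ} (hf : f ∈ testFunctions Ω) :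
    (fun z : Sp d × ℝ => f z.1) ∈ smoothLat Ω := by
  obtain ⟨h1, h2, h3⟩ := hf
  refine ⟨h1.comp contDiff_fst, tsupport f, h3, h2, fun x hx t => image_eq_zero_of_notMem_tsupport hx⟩

lemma slice_mem_testFunctions (h : φ ∈ smoothLat Ω) (t : ℝ) :
    (fun x => φ (x, t)) ∈ testFunctions Ω := by
  obtain ⟨h1, K, hK, hKc, h⟩ := h
  have hs : tsupport (fun x => φ (x, t)) ⊆ K :=
    closure_minimal (fun x hx => by by_contra hxK; exact hx (h x hxK t)) hKc.isClosed
  exact ⟨h1.comp (contDiff_id.prodMk contDiff_const), hKc.of_isClosed_subset isClosed_closure hs,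
    hs.trans hK⟩

lemma volQ_eq_prod : volQ Ω T = (volume.restrict Ω).prod (volume.restrict (Ioo 0 T)) := by
  rw [volQ, cyl, Measure.prod_restrict]; rfl

lemma isFiniteMeasure_restrict (hb : Bornology.IsBounded Ω) :
    IsFiniteMeasure (volume.restrict Ω) := ⟨by
  rw [Measure.restrict_apply_univ]; exact hb.measure_lt_top⟩

lemma isFiniteMeasure_volQ (hb : Bornology.IsBounded Ω) : IsFiniteMeasure (volQ Ω T) := by
  have := isFiniteMeasure_restrict hb
  rw [volQ_eq_prod]; infer_instance

lemma Continuous.memLp_restrict {F : Type*} [NormedAddCommGroup F]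
    (hb : Bornology.IsBounded Ω) {f : Sp d → F} (hf : Continuous f) :
    MemLp f 2 (volume.restrict Ω) := by
  have := isFiniteMeasure_restrict hb
  obtain ⟨C, hC⟩ := hb.isCompact_closure.exists_bound_of_continuousOn hf.continuousOn
  refine MemLp.of_bound hf.aestronglyMeasurable C ?_
  have h1 : ∀ᵐ x ∂(volume.restrict (closure Ω)), ‖f x‖ ≤ C :=
    (ae_restrict_iff' isClosed_closure.measurableSet).2 (ae_of_all _ hC)
  exact ae_mono (Measure.restrict_mono subset_closure le_rfl) h1

lemma Continuous.memLp_volQ {F : Type*} [NormedAddCommGroup F]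
    (hb : Bornology.IsBounded Ω) {f : Sp d × ℝ → F} (hf : Continuous f) :
    MemLp f 2 (volQ Ω T) := by
  have := isFiniteMeasure_volQ (T := T) hb
  obtain ⟨C, hC⟩ := (hb.isCompact_closure.prod (isCompact_Icc (a := (0 : ℝ)) (b := T))).exists_bound_of_continuousOn
    hf.continuousOn
  refine MemLp.of_bound hf.aestronglyMeasurable C ?_
  have h1 : ∀ᵐ x ∂(volume.restrict (closure Ω ×ˢ Icc 0 T)), ‖f x‖ ≤ C :=
    (ae_restrict_iff' (isClosed_closure.prod isClosed_Icc).measurableSet).2 (ae_of_all _ hC)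
  exact ae_mono (Measure.restrict_mono (Set.prod_mono subset_closure Ioo_subset_Icc_self) le_rfl) h1

lemma Continuous.integrable_volQ {F : Type*} [NormedAddCommGroup F]
    (hb : Bornology.IsBounded Ω) {f : Sp d × ℝ → F}
    (hf : Continuous f) : Integrable f (volQ Ω T) := by
  have := isFiniteMeasure_volQ (T := T) hb
  exact (Continuous.memLp_volQ hb hf).integrable (by norm_num)

variable {F : Type*} [NormedAddCommGroup F] [NormedSpace ℝ F]

lemma integral_volQ_space_time {f : Sp d × ℝ → F} (hf : Integrable f (volQ Ω T)) :
    ∫ z, f z ∂(volQ Ω T) = ∫ x in Ω, ∫ t in Ioo 0 T, f (x, t) := by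
  rw [volQ_eq_prod] at *
  exact integral_prod f hf

lemma integral_volQ_time_space {f : Sp d × ℝ → F} (hf : Integrable f (volQ Ω T)) :
    ∫ z, f z ∂(volQ Ω T) = ∫ t in Ioo 0 T, ∫ x in Ω, f (x, t) := by
  rw [volQ_eq_prod] at *
  exact integral_prod_symm f hf

/-- The factor `g` and its derivative vanish outside `Ω`, so both integrals may be taken over the
whole space, where no boundary term arises. Hence `f` needs no boundary condition and `∂Ω` no
regularity. -/
lemma integral_smul_gradient (hb : Bornology.IsBounded Ω) {f g : Sp d → ℝ} (hf : ContDiff ℝ ∞ f)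
    (hg : g ∈ testFunctions Ω) :
    ∫ x in Ω, f x • gradient g x = -∫ x in Ω, g x • gradient f x := by
  have hcg : ∀ {h : Sp d → ℝ}, ContDiff ℝ ∞ h → Continuous (gradient h) := fun {h} hh =>
    (InnerProductSpace.toDual ℝ (Sp d)).symm.continuous.comp (hh.continuous_fderiv (by simp))
  have hfin := isFiniteMeasure_restrict hb
  have i1 : Integrable (fun x => f x • gradient g x) (volume.restrict Ω) :=
    (Continuous.memLp_restrict hb (hf.continuous.smul (hcg hg.1))).integrable (by norm_num)
  have i2 : Integrable (fun x => g x • gradient f x) (volume.restrict Ω) :=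
    (Continuous.memLp_restrict hb (hg.1.continuous.smul (hcg hf))).integrable (by norm_num)
  have hz : ∀ x ∉ Ω, g x = 0 := fun x hx => image_eq_zero_of_notMem_tsupport fun h => hx (hg.2.2 h)
  have hz' : ∀ x ∉ Ω, fderiv ℝ g x = 0 := fun x hx =>
    image_eq_zero_of_notMem_tsupport fun h => hx (hg.2.2 (tsupport_fderiv_subset ℝ h))
  refine ext_inner_left ℝ fun a => ?_
  rw [inner_neg_right, ← integral_inner i1, ← integral_inner i2]
  have e1 : ∀ (h k : Sp d → ℝ) x, inner ℝ a (h x • gradient k x) = h x * fderiv ℝ k x a := by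
    intro h k x
    rw [real_inner_smul_right, real_inner_comm, gradient, InnerProductSpace.toDual_symm_apply]
  simp only [e1]
  rw [setIntegral_eq_integral_of_forall_compl_eq_zero (fun x hx => by simp [hz' x hx]),
    setIntegral_eq_integral_of_forall_compl_eq_zero (fun x hx => by simp [hz x hx])]
  have hcs : HasCompactSupport fun x => fderiv ℝ g x a := hg.2.1.fderiv_apply ℝ a
  have c1 : Continuous fun x => fderiv ℝ g x a :=
    (hg.1.continuous_fderiv (by simp)).clm_apply continuous_const
  have c2 : Continuous fun x => fderiv ℝ f x a :=
    (hf.continuous_fderiv (by simp)).clm_apply continuous_const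
  rw [integral_mul_fderiv_eq_neg_fderiv_mul_of_integrable]
  · simp only [mul_comm]
  · exact (c2.mul hg.1.continuous).integrable_of_hasCompactSupport hg.2.1.mul_left
  · exact (hf.continuous.mul c1).integrable_of_hasCompactSupport hcs.mul_left
  · exact (hf.continuous.mul hg.1.continuous).integrable_of_hasCompactSupport hg.2.1.mul_left
  · exact fun x _ => hf.differentiable (by simp) x
  · exact fun x _ => hg.1.differentiable (by simp) x

lemma integral_smul_spaceGrad (hb : Bornology.IsBounded Ω) (hφ : ContDiff ℝ ∞ φ)
    (hψ : ψ ∈ smoothLat Ω) :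
    ∫ z, φ z • spaceGrad ψ z ∂(volQ Ω T) = -∫ z, ψ z • spaceGrad φ z ∂(volQ Ω T) := by
  have i1 : Integrable (fun z => φ z • spaceGrad ψ z) (volQ Ω T) :=
    Continuous.integrable_volQ hb (hφ.continuous.smul (continuous_spaceGrad hψ.1))
  have i2 : Integrable (fun z => ψ z • spaceGrad φ z) (volQ Ω T) :=
    Continuous.integrable_volQ hb (hψ.1.continuous.smul (continuous_spaceGrad hφ))
  rw [integral_volQ_time_space i1, integral_volQ_time_space i2, ← integral_neg]
  refine integral_congr_ae (ae_of_all _ fun t => ?_)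
  exact integral_smul_gradient hb (hφ.comp (contDiff_id.prodMk contDiff_const))
    (slice_mem_testFunctions hψ t)

/-- Only the boundary products at `0` and `T` have to agree; for a test function on the cylinder
both are zero, whatever `φ` does there. -/
lemma integral_mul_timeDeriv (hb : Bornology.IsBounded Ω) (hT : 0 < T) (hφ : ContDiff ℝ ∞ φ)
    (hψ : ContDiff ℝ ∞ ψ) (hper : ∀ x, φ (x, T) * ψ (x, T) = φ (x, 0) * ψ (x, 0)) :
    ∫ z, φ z * timeDeriv ψ z ∂(volQ Ω T) = -∫ z, timeDeriv φ z * ψ z ∂(volQ Ω T) := by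
  have cφ := (contDiff_timeDeriv hφ).continuous
  have cψ := (contDiff_timeDeriv hψ).continuous
  have i1 : Integrable (fun z => φ z * timeDeriv ψ z) (volQ Ω T) :=
    Continuous.integrable_volQ hb (hφ.continuous.mul cψ)
  have i2 : Integrable (fun z => timeDeriv φ z * ψ z) (volQ Ω T) :=
    Continuous.integrable_volQ hb (cφ.mul hψ.continuous)
  rw [integral_volQ_space_time i1, integral_volQ_space_time i2, ← integral_neg]
  refine integral_congr_ae (ae_of_all _ fun x => ?_)
  simp only
  have hx : Continuous fun t : ℝ => (x, t) := by fun_prop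
  rw [← integral_Ioc_eq_integral_Ioo, ← integral_Ioc_eq_integral_Ioo,
    ← intervalIntegral.integral_of_le hT.le, ← intervalIntegral.integral_of_le hT.le,
    intervalIntegral.integral_mul_deriv_eq_deriv_mul (u := fun t => φ (x, t))
      (fun t _ => hasDerivAt_timeDeriv (contDiff_differentiable hφ) x t)
      (fun t _ => hasDerivAt_timeDeriv (contDiff_differentiable hψ) x t)
      (cφ.comp hx).continuousOn.intervalIntegrable (cψ.comp hx).continuousOn.intervalIntegrable,
    hper x, sub_self, zero_sub]

lemma hasWeakTimeDeriv_of_smooth (hb : Bornology.IsBounded Ω) (hT : 0 < T) (hφ : ContDiff ℝ ∞ φ) :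
    HasWeakTimeDeriv Ω T φ (timeDeriv φ) := by
  refine ⟨Continuous.memLp_volQ hb (contDiff_timeDeriv hφ).continuous, fun ψ hψ =>
    integral_mul_timeDeriv hb hT hφ hψ.1 fun x => ?_⟩
  have h0 : ∀ t ∉ Ioo 0 T, ψ (x, t) = 0 := fun t ht =>
    image_eq_zero_of_notMem_tsupport fun h => ht (hψ.2.2 h).2
  rw [h0 T (by simp), h0 0 (by simp), mul_zero, mul_zero]

/-- Friedrichs' inequality for smooth functions vanishing near the lateral boundary. -/
lemma friedrichs_smooth (hd : 0 < d) (hb : Bornology.IsBounded Ω) {R : ℝ}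
    (hR : ∀ x ∈ Ω, ‖x‖ ≤ R) (hΩ : MeasurableSet Ω) (hR0 : 0 ≤ R) (hφ : φ ∈ smoothLat Ω) :
    l2 (volQ Ω T) φ ≤ 2 * R * l2 (volQ Ω T) (spaceGrad φ) := by
  let e : Sp d := EuclideanSpace.single ⟨0, hd⟩ 1
  have he : ‖e‖ = 1 := by simp [e]
  have hf : ContDiff ℝ ∞ fun x : Sp d => inner ℝ e x := contDiff_const.inner ℝ contDiff_id
  have hcf : Continuous fun z : Sp d × ℝ => inner ℝ e z.1 := by fun_prop
  have hm : MemLp φ 2 (volQ Ω T) := Continuous.memLp_volQ hb hφ.1.continuous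
  have hmg : MemLp (spaceGrad φ) 2 (volQ Ω T) := Continuous.memLp_volQ hb (continuous_spaceGrad hφ.1)
  have hcF : Continuous fun z : Sp d × ℝ => (inner ℝ e z.1 * φ z) • e :=
    (hcf.mul hφ.1.continuous).smul continuous_const
  have hmF : MemLp (fun z : Sp d × ℝ => (inner ℝ e z.1 * φ z) • e) 2 (volQ Ω T) :=
    Continuous.memLp_volQ hb hcF
  -- Integrate `φ²` by parts against the linear function `⟨e, x⟩`, whose gradient is the unit vector
  -- `e`: the result is `‖φ‖² = -2 ∫ ⟨e, x⟩ φ ∂ₑφ`, and `|⟨e, x⟩| ≤ R` on `Ω` explains the constant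
  -- `2R`.
  have key : l2 (volQ Ω T) φ ^ 2
      = -(2 * ∫ z, inner ℝ (spaceGrad φ z) ((inner ℝ e z.1 * φ z) • e) ∂(volQ Ω T)) := by
    have hφ2 : (fun z => φ z * φ z) ∈ smoothLat Ω := by
      obtain ⟨h1, K, hK, hKc, h⟩ := hφ
      exact ⟨h1.mul h1, K, hK, hKc, fun x hx t => by simp [h x hx]⟩
    have h1 := integral_smul_spaceGrad (T := T) hb (hf.comp contDiff_fst) hφ2
    have g1 : ∀ z : Sp d × ℝ, spaceGrad ((fun x : Sp d => inner ℝ e x) ∘ Prod.fst) z = e := by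
      intro z
      refine ext_inner_right ℝ fun a => ?_
      have : HasFDerivAt (fun x : Sp d => inner ℝ e x) (innerSL ℝ e) z.1 := (innerSL ℝ e).hasFDerivAt
      change inner ℝ ((InnerProductSpace.toDual ℝ (Sp d)).symm
        (fderiv ℝ (fun x : Sp d => inner ℝ e x) z.1)) a = _
      rw [this.fderiv]; simp
    have g2 : ∀ z : Sp d × ℝ, spaceGrad (fun z => φ z * φ z) z = (2 * φ z) • spaceGrad φ z := by
      intro z
      have hdz := contDiff_differentiable hφ.1 z
      rw [spaceGrad_eq hdz, spaceGrad_eq (φ := fun z => φ z * φ z) (hdz.mul hdz), fderiv_fun_mul hdz hdz, map_add, map_smul,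
        ← add_smul, two_mul]
    simp only [g1, g2] at h1
    have h2 := congrArg (fun v => inner ℝ e v) h1
    simp only [inner_neg_right] at h2
    rw [← integral_inner, ← integral_inner] at h2
    · rw [sq_l2' hm, ← integral_const_mul, ← neg_eq_iff_eq_neg, ← integral_neg]
      rw [← integral_neg] at h2
      refine Eq.trans (integral_congr_ae (ae_of_all _ fun z => ?_))
        (h2.symm.trans (integral_congr_ae (ae_of_all _ fun z => ?_)))
      · simp only [real_inner_smul_right, real_inner_self_eq_norm_sq, he]; ring
      · simp only [real_inner_smul_right, Function.comp]
        rw [real_inner_comm e (spaceGrad φ z)]; ring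
    · exact Continuous.integrable_volQ hb ((hφ.1.continuous.mul hφ.1.continuous).smul continuous_const)
    · exact Continuous.integrable_volQ hb (hcf.smul ((continuous_const.mul hφ.1.continuous).smul
        (continuous_spaceGrad hφ.1)))
  have hle : l2 (volQ Ω T) (fun z : Sp d × ℝ => (inner ℝ e z.1 * φ z) • e) ≤ R * l2 (volQ Ω T) φ := by
    refine l2_le_of_eLpNorm_le hR0 hm (eLpNorm_le_mul_eLpNorm_of_ae_le_mul ?_ 2)
    have : ∀ᵐ z ∂(volQ Ω T), z ∈ cyl Ω T := ae_restrict_mem (hΩ.prod measurableSet_Ioo)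
    filter_upwards [this] with z hz
    rw [norm_smul, he, mul_one, norm_mul]
    refine mul_le_mul_of_nonneg_right ?_ (norm_nonneg _)
    refine (norm_inner_le_norm _ _).trans ?_
    rw [he, one_mul]; exact hR _ hz.1
  have h3 := abs_integral_inner_le hmg hmF
  have h4 : l2 (volQ Ω T) φ ^ 2 ≤ 2 * (l2 (volQ Ω T) (spaceGrad φ) * (R * l2 (volQ Ω T) φ)) := by
    rw [key, ← mul_neg]
    refine mul_le_mul_of_nonneg_left ?_ two_pos.le
    exact (neg_le_abs _).trans (h3.trans (mul_le_mul_of_nonneg_left hle (l2_nonneg _)))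
  rcases (l2_nonneg (μ := volQ Ω T) φ).eq_or_lt with h0 | h0
  · rw [← h0]; have := l2_nonneg (μ := volQ Ω T) (spaceGrad φ); positivity
  · refine le_of_mul_le_mul_right ?_ h0
    nlinarith

end Smooth

/-! ### Weak derivatives, the closure of smooth functions, and Friedrichs' inequality. -/

section Weak

variable {d : ℕ} {Ω : Set (Sp d)} {T : ℝ}

lemma MemLp.integrable_volQ {F : Type*} [NormedAddCommGroup F] (hb : Bornology.IsBounded Ω)
    {f : Sp d × ℝ → F} (hf : MemLp f 2 (volQ Ω T)) : Integrable f (volQ Ω T) := by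
  have := isFiniteMeasure_volQ (T := T) hb
  exact hf.integrable (by norm_num)

/-- The fundamental lemma of the calculus of variations. It makes weak derivatives unique almost
everywhere, so that the choices behind `wGrad`, `wDt` and `wDiv` do not matter. -/
lemma ae_eq_zero_of_forall_testFunctions {X F : Type*} [NormedAddCommGroup X] [NormedSpace ℝ X]
    [MeasurableSpace X] [BorelSpace X] [FiniteDimensional ℝ X] {μ : Measure X}
    [NormedAddCommGroup F] [NormedSpace ℝ F] [CompleteSpace F] {U : Set X} (hU : IsOpen U) {f : X → F}
    (hf : Integrable f (μ.restrict U))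
    (h : ∀ φ ∈ testFunctions U, ∫ x in U, φ x • f x ∂μ = 0) : f =ᵐ[μ.restrict U] 0 := by
  refine (ae_restrict_iff' hU.measurableSet).2 ?_
  refine hU.ae_eq_zero_of_integral_contDiff_smul_eq_zero
    (IntegrableOn.locallyIntegrableOn hf) fun φ h1 h2 h3 => ?_
  rw [← h φ ⟨h1, h2, h3⟩, setIntegral_eq_integral_of_forall_compl_eq_zero]
  intro x hx
  rw [image_eq_zero_of_notMem_tsupport fun h => hx (h3 h), zero_smul]

lemma isOpen_cyl (hΩ : IsOpen Ω) : IsOpen (cyl Ω T) := hΩ.prod isOpen_Ioo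

variable {u u' : Sp d × ℝ → ℝ} {g g' : Sp d × ℝ → Sp d} {w w' : Sp d × ℝ → ℝ}

lemma memLp_test (hb : Bornology.IsBounded Ω) {φ : Sp d × ℝ → ℝ} (hφ : ContDiff ℝ ∞ φ) :
    MemLp φ 2 (volQ Ω T) := Continuous.memLp_volQ hb hφ.continuous

lemma memLp_spaceGrad (hb : Bornology.IsBounded Ω) {φ : Sp d × ℝ → ℝ} (hφ : ContDiff ℝ ∞ φ) :
    MemLp (spaceGrad φ) 2 (volQ Ω T) := Continuous.memLp_volQ hb (continuous_spaceGrad hφ)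

lemma memLp_timeDeriv (hb : Bornology.IsBounded Ω) {φ : Sp d × ℝ → ℝ} (hφ : ContDiff ℝ ∞ φ) :
    MemLp (timeDeriv φ) 2 (volQ Ω T) := Continuous.memLp_volQ hb (contDiff_timeDeriv hφ).continuous

/-- Products of an `L²` function with a continuous function are integrable. -/
lemma integrable_smul_continuous {F : Type*} [NormedAddCommGroup F] [NormedSpace ℝ F]
    (hb : Bornology.IsBounded Ω) {f : Sp d × ℝ → F} (hf : MemLp f 2 (volQ Ω T))
    {a : Sp d × ℝ → ℝ} (ha : Continuous a) : Integrable (fun z => a z • f z) (volQ Ω T) :=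
  memLp_one_iff_integrable.1 (hf.smul (Continuous.memLp_volQ hb ha))

lemma integrable_continuous_smul {F : Type*} [NormedAddCommGroup F] [NormedSpace ℝ F]
    (hb : Bornology.IsBounded Ω) {f : Sp d × ℝ → ℝ} (hf : MemLp f 2 (volQ Ω T))
    {a : Sp d × ℝ → F} (ha : Continuous a) : Integrable (fun z => f z • a z) (volQ Ω T) :=
  memLp_one_iff_integrable.1 ((Continuous.memLp_volQ hb ha).smul hf)

lemma HasWeakGrad.ae_eq (hΩ : IsOpen Ω) (hb : Bornology.IsBounded Ω)
    (h : HasWeakGrad Ω T u g) (h' : HasWeakGrad Ω T u g') : g =ᵐ[volQ Ω T] g' := by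
  have := ae_eq_zero_of_forall_testFunctions (μ := volume) (isOpen_cyl (T := T) hΩ)
    (MemLp.integrable_volQ hb (h.1.sub h'.1)) (fun φ hφ => ?_)
  · filter_upwards [this] with z hz
    exact sub_eq_zero.1 hz
  · change ∫ z, φ z • (g - g') z ∂(volQ Ω T) = 0
    simp only [Pi.sub_apply, smul_sub]
    rw [integral_sub (integrable_smul_continuous hb h.1 hφ.1.continuous)
      (integrable_smul_continuous hb h'.1 hφ.1.continuous), ← neg_inj, neg_sub', ← h.2 φ hφ, sub_neg_eq_add,
      ← neg_neg (∫ z, φ z • g' z ∂(volQ Ω T)), ← h'.2 φ hφ]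
    simp

lemma HasWeakGrad.wGrad (h : HasWeakGrad Ω T u g) : HasWeakGrad Ω T u (wGrad Ω T u) :=
  Classical.epsilon_spec (p := HasWeakGrad Ω T u) ⟨g, h⟩

lemma HasWeakGrad.wGrad_ae_eq (hΩ : IsOpen Ω) (hb : Bornology.IsBounded Ω)
    (h : HasWeakGrad Ω T u g) : TPOC.wGrad Ω T u =ᵐ[volQ Ω T] g := h.wGrad.ae_eq hΩ hb h

lemma HasWeakGrad.congr (h : HasWeakGrad Ω T u g) (hu : u =ᵐ[volQ Ω T] u') :
    HasWeakGrad Ω T u' g := by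
  refine ⟨h.1, fun φ hφ => ?_⟩
  rw [← h.2 φ hφ]
  refine integral_congr_ae ?_
  filter_upwards [hu] with z hz
  rw [hz]

lemma hasWeakGrad_congr (hu : u =ᵐ[volQ Ω T] u') : HasWeakGrad Ω T u = HasWeakGrad Ω T u' :=
  funext fun _ => propext ⟨fun h => h.congr hu, fun h => h.congr hu.symm⟩

/-- Equality holds everywhere: the predicates passed to `Classical.epsilon` coincide, hence so do
the choices. -/
lemma wGrad_congr (hu : u =ᵐ[volQ Ω T] u') : wGrad Ω T u = wGrad Ω T u' := by
  rw [TPOC.wGrad, hasWeakGrad_congr hu, TPOC.wGrad]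

lemma HasWeakTimeDeriv.ae_eq (hΩ : IsOpen Ω) (hb : Bornology.IsBounded Ω)
    (h : HasWeakTimeDeriv Ω T u w) (h' : HasWeakTimeDeriv Ω T u w') : w =ᵐ[volQ Ω T] w' := by
  have := ae_eq_zero_of_forall_testFunctions (μ := volume) (isOpen_cyl (T := T) hΩ)
    (MemLp.integrable_volQ hb (h.1.sub h'.1)) (fun φ hφ => ?_)
  · filter_upwards [this] with z hz
    exact sub_eq_zero.1 hz
  · change ∫ z, φ z • (w - w') z ∂(volQ Ω T) = 0
    have e1 := h.2 φ hφ
    have e2 := h'.2 φ hφ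
    simp only [Pi.sub_apply, smul_sub]
    rw [integral_sub (integrable_smul_continuous hb h.1 hφ.1.continuous)
      (integrable_smul_continuous hb h'.1 hφ.1.continuous)]
    simp only [smul_eq_mul, mul_comm (φ _)]
    linarith

lemma HasWeakTimeDeriv.wDt (h : HasWeakTimeDeriv Ω T u w) :
    HasWeakTimeDeriv Ω T u (wDt Ω T u) :=
  Classical.epsilon_spec (p := HasWeakTimeDeriv Ω T u) ⟨w, h⟩

lemma HasWeakTimeDeriv.wDt_ae_eq (hΩ : IsOpen Ω) (hb : Bornology.IsBounded Ω)
    (h : HasWeakTimeDeriv Ω T u w) : TPOC.wDt Ω T u =ᵐ[volQ Ω T] w := h.wDt.ae_eq hΩ hb h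

lemma HasWeakTimeDeriv.congr (h : HasWeakTimeDeriv Ω T u w) (hu : u =ᵐ[volQ Ω T] u') :
    HasWeakTimeDeriv Ω T u' w := by
  refine ⟨h.1, fun φ hφ => ?_⟩
  rw [← h.2 φ hφ]
  refine integral_congr_ae ?_
  filter_upwards [hu] with z hz
  rw [hz]

/-- Weak time derivatives pass to `L²` limits. -/
lemma hasWeakTimeDeriv_of_tendsto (hb : Bornology.IsBounded Ω) {un wn : ℕ → Sp d × ℝ → ℝ}
    (hn : ∀ n, HasWeakTimeDeriv Ω T (un n) (wn n)) (hun : ∀ n, MemLp (un n) 2 (volQ Ω T))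
    (hu : MemLp u 2 (volQ Ω T)) (hw : MemLp w 2 (volQ Ω T))
    (h1 : Tendsto (fun n => l2 (volQ Ω T) (fun z => u z - un n z)) atTop (𝓝 0))
    (h2 : Tendsto (fun n => l2 (volQ Ω T) (fun z => w z - wn n z)) atTop (𝓝 0)) :
    HasWeakTimeDeriv Ω T u w := by
  refine ⟨hw, fun φ hφ => ?_⟩
  have l1 := tendsto_integral_mul hun hu h1 (memLp_timeDeriv (T := T) hb hφ.1)
  have l2 := (tendsto_integral_mul (fun n => (hn n).1) hw h2 (memLp_test (T := T) hb hφ.1)).neg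
  simp only [mul_comm (timeDeriv φ _)] at l1
  simp only [mul_comm (φ _)] at l2
  exact tendsto_nhds_unique l1 (l2.congr fun n => ((hn n).2 φ hφ).symm)

/-- `u` lies in `H^{1,0}_0(Q)` with weak spatial gradient `g`. -/
def IsH10Pair (Ω : Set (Sp d)) (T : ℝ) (u : Sp d × ℝ → ℝ) (g : Sp d × ℝ → Sp d) : Prop :=
  MemLp u 2 (volQ Ω T) ∧ MemLp g 2 (volQ Ω T) ∧ ∃ φ : ℕ → Sp d × ℝ → ℝ,
    (∀ n, φ n ∈ testFunctions (Ω ×ˢ (univ : Set ℝ))) ∧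
    Tendsto (fun n => l2 (volQ Ω T) (fun z => u z - φ n z)) atTop (𝓝 0) ∧
    Tendsto (fun n => l2 (volQ Ω T) (fun z => g z - spaceGrad (φ n) z)) atTop (𝓝 0)

/-- Continuous linear identities on smooth functions extend to `H^{1,0}_0(Q)`. -/
lemma IsH10Pair.integral_eq_zero (hb : Bornology.IsBounded Ω) (h : IsH10Pair Ω T u g)
    {G : Sp d × ℝ → Sp d} {f : Sp d × ℝ → ℝ} (hG : MemLp G 2 (volQ Ω T))
    (hf : MemLp f 2 (volQ Ω T))
    (H : ∀ φ ∈ testFunctions (Ω ×ˢ (univ : Set ℝ)),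
      (∫ z, inner ℝ (G z) (spaceGrad φ z) ∂(volQ Ω T)) + ∫ z, f z * φ z ∂(volQ Ω T) = 0) :
    (∫ z, inner ℝ (G z) (g z) ∂(volQ Ω T)) + ∫ z, f z * u z ∂(volQ Ω T) = 0 := by
  obtain ⟨hu, hg, φ, hφ, h1, h2⟩ := h
  have l1 := tendsto_integral_inner (fun n => memLp_spaceGrad hb (hφ n).1) hg h2 hG
  have l2 := tendsto_integral_mul (fun n => memLp_test hb (hφ n).1) hu h1 hf
  refine tendsto_nhds_unique (l1.add l2) ?_
  simp only [H _ (hφ _), tendsto_const_nhds]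

/-- The smooth approximations satisfy the integration by parts identity, which is linear and
continuous in the pair. Pairing with a fixed vector `a` makes it scalar, so that
`IsH10Pair.integral_eq_zero` applies. -/
lemma IsH10Pair.hasWeakGrad (hb : Bornology.IsBounded Ω) (h : IsH10Pair Ω T u g) :
    HasWeakGrad Ω T u g := by
  refine ⟨h.2.1, fun φ hφ => ?_⟩
  refine ext_inner_left ℝ fun a => ?_
  have hca : Continuous fun z => φ z • a := hφ.1.continuous.smul continuous_const
  have hcb : Continuous fun z => inner ℝ a (spaceGrad φ z) :=
    continuous_const.inner (continuous_spaceGrad hφ.1)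
  have key := h.integral_eq_zero hb (Continuous.memLp_volQ (T := T) hb hca)
    (Continuous.memLp_volQ (T := T) hb hcb) fun ψ hψ => by
      have := congrArg (fun v => inner ℝ a v)
        (integral_smul_spaceGrad (T := T) hb hψ.1 (testFunctions_lat_subset hφ))
      simp only [inner_neg_right] at this
      rw [← integral_inner, ← integral_inner] at this
      · simp only [real_inner_smul_left]
        simp only [real_inner_smul_right, mul_comm (ψ _)] at this
        linarith
      · exact integrable_smul_continuous hb (memLp_spaceGrad hb hψ.1) hφ.1.continuous
      · exact integrable_smul_continuous hb (memLp_spaceGrad hb hφ.1) hψ.1.continuous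
  rw [inner_neg_right, ← integral_inner, ← integral_inner]
  · simp only [real_inner_smul_right]
    simp only [real_inner_smul_left, mul_comm _ (u _)] at key
    linarith
  · exact integrable_smul_continuous hb h.2.1 hφ.1.continuous
  · exact integrable_continuous_smul hb h.1 (continuous_spaceGrad hφ.1)

lemma isH10Pair_wGrad (hb : Bornology.IsBounded Ω) (hu : u ∈ H10Zero Ω T) :
    IsH10Pair Ω T u (wGrad Ω T u) := by
  obtain ⟨⟨h1, g, hg⟩, φ, hφ, h2, h3⟩ := hu
  have hw := hg.wGrad
  refine ⟨h1, hw.1, φ, hφ, ?_, ?_⟩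
  · exact (tendsto_eLpNorm_zero_iff fun n => MemLp.sub h1 (memLp_test hb (hφ n).1)).1 h2
  · exact (tendsto_eLpNorm_zero_iff fun n => hw.1.sub (memLp_spaceGrad hb (hφ n).1)).1 h3

lemma IsH10Pair.wGrad_ae_eq (hΩ : IsOpen Ω) (hb : Bornology.IsBounded Ω)
    (h : IsH10Pair Ω T u g) : wGrad Ω T u =ᵐ[volQ Ω T] g :=
  (h.hasWeakGrad hb).wGrad_ae_eq hΩ hb

lemma IsH10Pair.mem_H10Zero (hΩ : IsOpen Ω) (hb : Bornology.IsBounded Ω)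
    (h : IsH10Pair Ω T u g) : u ∈ H10Zero Ω T := by
  have hae := h.wGrad_ae_eq hΩ hb
  have hw := h.hasWeakGrad hb
  obtain ⟨h1, h2, φ, hφ, h3, h4⟩ := h
  refine ⟨⟨h1, g, hw⟩, φ, hφ, ?_, ?_⟩
  · exact (tendsto_eLpNorm_zero_iff fun n => h1.sub (memLp_test hb (hφ n).1)).2 h3
  · refine (tendsto_eLpNorm_zero_iff fun n => hw.wGrad.1.sub (memLp_spaceGrad hb (hφ n).1)).2
      (h4.congr fun n => l2_congr ?_)
    filter_upwards [hae] with z hz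
    rw [Pi.sub_apply, hz]

lemma IsH10Pair.congr (h : IsH10Pair Ω T u g) (hu : u =ᵐ[volQ Ω T] u')
    (hg : g =ᵐ[volQ Ω T] g') : IsH10Pair Ω T u' g' := by
  obtain ⟨h1, h2, φ, hφ, h3, h4⟩ := h
  refine ⟨h1.ae_eq hu, h2.ae_eq hg, φ, hφ, h3.congr fun n => l2_congr ?_,
    h4.congr fun n => l2_congr ?_⟩
  · filter_upwards [hu] with z hz
    rw [hz]
  · filter_upwards [hg] with z hz
    rw [hz]

lemma tendsto_l2_add {μ : Measure (Sp d × ℝ)} {F : Type*} [NormedAddCommGroup F]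
    {a b : Sp d × ℝ → F} {an bn : ℕ → Sp d × ℝ → F} (ha : MemLp a 2 μ) (hb : MemLp b 2 μ)
    (han : ∀ n, MemLp (an n) 2 μ) (hbn : ∀ n, MemLp (bn n) 2 μ)
    (h1 : Tendsto (fun n => l2 μ (fun z => a z - an n z)) atTop (𝓝 0))
    (h2 : Tendsto (fun n => l2 μ (fun z => b z - bn n z)) atTop (𝓝 0)) :
    Tendsto (fun n => l2 μ (fun z => (a z + b z) - (an n z + bn n z))) atTop (𝓝 0) := by
  have h3 := h1.add h2
  rw [add_zero] at h3
  refine squeeze_zero (fun n => l2_nonneg _) (fun n => ?_) h3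
  refine le_trans (le_of_eq ?_) (l2_add_le (ha.sub (han n)) (hb.sub (hbn n)))
  congr 1; ext z
  abel

lemma l2_smul {X F : Type*} [MeasurableSpace X] {μ : Measure X} [NormedAddCommGroup F]
    [NormedSpace ℝ F] (c : ℝ) (f : X → F) : l2 μ (fun z => c • f z) = |c| * l2 μ f := by
  have : (fun z => c • f z) = c • f := rfl
  rw [l2, this, eLpNorm_const_smul, ENNReal.toReal_mul]
  simp [l2]

lemma IsH10Pair.add (hb : Bornology.IsBounded Ω) (h : IsH10Pair Ω T u g) (h' : IsH10Pair Ω T u' g') :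
    IsH10Pair Ω T (fun z => u z + u' z) (fun z => g z + g' z) := by
  obtain ⟨h1, h2, φ, hφ, h3, h4⟩ := h
  obtain ⟨h1', h2', φ', hφ', h3', h4'⟩ := h'
  refine ⟨h1.add h1', h2.add h2', fun n => φ n + φ' n, fun n => ⟨(hφ n).1.add (hφ' n).1,
    (hφ n).2.1.add (hφ' n).2.1,
    (tsupport_add _ _).trans (union_subset (hφ n).2.2 (hφ' n).2.2)⟩, ?_, ?_⟩
  · exact tendsto_l2_add h1 h1' (fun n => memLp_test hb (hφ n).1)
      (fun n => memLp_test hb (hφ' n).1) h3 h3'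
  · simp only [spaceGrad_add (hφ _).1 (hφ' _).1]
    exact tendsto_l2_add h2 h2' (fun n => memLp_spaceGrad hb (hφ n).1)
      (fun n => memLp_spaceGrad hb (hφ' n).1) h4 h4'

lemma IsH10Pair.smul (h : IsH10Pair Ω T u g) (c : ℝ) :
    IsH10Pair Ω T (fun z => c * u z) (fun z => c • g z) := by
  obtain ⟨h1, h2, φ, hφ, h3, h4⟩ := h
  refine ⟨h1.const_mul c, h2.const_smul c, fun n => c • φ n, fun n => ⟨(hφ n).1.const_smul c,
    (hφ n).2.1.smul_left (f := fun _ => c),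
    (tsupport_smul_subset_right (fun _ => c) _).trans (hφ n).2.2⟩, ?_, ?_⟩
  · have := h3.const_mul |c|
    rw [mul_zero] at this
    refine this.congr fun n => ?_
    rw [← l2_smul]
    simp [mul_sub]
  · have := h4.const_mul |c|
    rw [mul_zero] at this
    refine this.congr fun n => ?_
    rw [← l2_smul]
    simp only [spaceGrad_smul (hφ _).1, smul_sub]

/-- `H^{1,0}_0(Q)` is complete. -/
lemma isH10Pair_of_tendsto (hb : Bornology.IsBounded Ω) {un : ℕ → Sp d × ℝ → ℝ}
    {gn : ℕ → Sp d × ℝ → Sp d} (hn : ∀ n, IsH10Pair Ω T (un n) (gn n))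
    (hu : MemLp u 2 (volQ Ω T)) (hg : MemLp g 2 (volQ Ω T))
    (h1 : Tendsto (fun n => l2 (volQ Ω T) (fun z => u z - un n z)) atTop (𝓝 0))
    (h2 : Tendsto (fun n => l2 (volQ Ω T) (fun z => g z - gn n z)) atTop (𝓝 0)) :
    IsH10Pair Ω T u g := by
  -- A diagonal choice: approximate the `n`-th pair by one test function within `1/(n+1)`, both in
  -- value and in gradient.
  have hex : ∀ n : ℕ, ∃ φ ∈ testFunctions (Ω ×ˢ (univ : Set ℝ)),
      l2 (volQ Ω T) (fun z => un n z - φ z) < 1 / ((n : ℝ) + 1) ∧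
      l2 (volQ Ω T) (fun z => gn n z - spaceGrad φ z) < 1 / ((n : ℝ) + 1) := by
    intro n
    obtain ⟨-, -, φ, hφ, h3, h4⟩ := hn n
    have hp : (0 : ℝ) < 1 / ((n : ℝ) + 1) := by positivity
    obtain ⟨m, hm⟩ := ((h3.eventually_lt_const hp).and (h4.eventually_lt_const hp)).exists
    exact ⟨φ m, hφ m, hm⟩
  choose φ hφ hφ1 hφ2 using hex
  have h0 := tendsto_one_div_add_atTop_nhds_zero_nat (𝕜 := ℝ)
  refine ⟨hu, hg, φ, hφ, ?_, ?_⟩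
  · have h3 := h1.add h0
    rw [add_zero] at h3
    refine squeeze_zero (fun n => l2_nonneg _) (fun n => ?_) h3
    refine le_trans ?_ (add_le_add_right (hφ1 n).le _)
    refine le_trans (le_of_eq ?_) (l2_add_le (hu.sub (hn n).1) ((hn n).1.sub (memLp_test hb (hφ n).1)))
    congr 1; ext z; simp
  · have h3 := h2.add h0
    rw [add_zero] at h3
    refine squeeze_zero (fun n => l2_nonneg _) (fun n => ?_) h3
    refine le_trans ?_ (add_le_add_right (hφ2 n).le _)
    refine le_trans (le_of_eq ?_) (l2_add_le (hg.sub (hn n).2.1)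
      ((hn n).2.1.sub (memLp_spaceGrad hb (hφ n).1)))
    congr 1; ext z; simp

/-- Such a function need not have compact support in time. A bump in `t` equal to `1` on `[-T, T]`
provides it without changing anything on the cylinder, so a constant approximating sequence
suffices. -/
lemma isH10Pair_of_smoothLat (hΩ : IsOpen Ω) (hb : Bornology.IsBounded Ω) (hT : 0 < T)
    {φ : Sp d × ℝ → ℝ} (hφ : φ ∈ smoothLat Ω) : IsH10Pair Ω T φ (spaceGrad φ) := by
  let χ : ContDiffBump (0 : ℝ) := ⟨T, T + 1, hT, by linarith⟩
  have hχ : ∀ᵐ z ∂(volQ Ω T), χ z.2 = 1 := by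
    have : ∀ᵐ z ∂(volQ Ω T), z ∈ cyl Ω T :=
      ae_restrict_mem (hΩ.measurableSet.prod measurableSet_Ioo)
    filter_upwards [this] with z hz
    refine χ.one_of_mem_closedBall ?_
    rw [mem_closedBall_zero_iff, Real.norm_eq_abs, abs_of_pos hz.2.1]
    exact hz.2.2.le
  have hm : (fun z => φ z * χ z.2) ∈ testFunctions (Ω ×ˢ (univ : Set ℝ)) := by
    obtain ⟨h1, K, hK, hKc, h⟩ := hφ
    have hs : tsupport (fun z : Sp d × ℝ => φ z * χ z.2) ⊆ K ×ˢ Metric.closedBall (0 : ℝ) (T + 1) := by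
      refine closure_minimal (fun z hz => ?_) (hKc.isClosed.prod Metric.isClosed_closedBall)
      refine ⟨by_contra fun hx => hz (by simp [h z.1 hx z.2]), by_contra fun hx => hz ?_⟩
      change φ z * χ z.2 = 0
      rw [show χ z.2 = 0 from χ.zero_of_le_dist (not_le.1 hx).le, mul_zero]
    exact ⟨h1.mul (χ.contDiff.comp contDiff_snd),
      (hKc.prod (isCompact_closedBall _ _)).of_isClosed_subset isClosed_closure hs,
      hs.trans (Set.prod_mono hK (subset_univ _))⟩
  have z1 : l2 (volQ Ω T) (fun z => φ z - φ z * χ z.2) = 0 := by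
    rw [l2_congr (g := fun _ => (0 : ℝ)) (by filter_upwards [hχ] with z hz; simp [hz])]
    simp [l2]
  have z2 : l2 (volQ Ω T) (fun z => spaceGrad φ z - spaceGrad (fun z => φ z * χ z.2) z) = 0 := by
    rw [l2_congr (g := fun _ => (0 : Sp d)) (by
      filter_upwards [hχ] with z hz; simp [spaceGrad_mul_time hφ.1, hz])]
    simp [l2]
  refine ⟨memLp_test hb hφ.1, memLp_spaceGrad hb hφ.1, fun _ z => φ z * χ z.2, fun _ => hm, ?_, ?_⟩
  · simp only [z1, tendsto_const_nhds]
  · simp only [z2, tendsto_const_nhds]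

/-- Both sides of the smooth inequality are continuous in the norms of the pair, so it passes to the
closure. The radius is enlarged to `|R| + 1` to make the constant positive. -/
lemma exists_friedrichs (hd : 0 < d) (hΩ : IsOpen Ω) (hb : Bornology.IsBounded Ω) (T : ℝ) :
    ∃ C, 0 < C ∧ (∀ φ ∈ smoothLat Ω, l2 (volQ Ω T) φ ≤ C * l2 (volQ Ω T) (spaceGrad φ)) ∧
      ∀ u g, IsH10Pair Ω T u g → l2 (volQ Ω T) u ≤ C * l2 (volQ Ω T) g := by
  obtain ⟨R, hR⟩ := hb.subset_closedBall (0 : Sp d)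
  have hR' : ∀ x ∈ Ω, ‖x‖ ≤ |R| + 1 := fun x hx => by
    have := mem_closedBall_zero_iff.1 (hR hx)
    linarith [le_abs_self R]
  have hs : ∀ φ ∈ smoothLat Ω, l2 (volQ Ω T) φ ≤ 2 * (|R| + 1) * l2 (volQ Ω T) (spaceGrad φ) :=
    fun φ hφ => friedrichs_smooth hd hb hR' hΩ.measurableSet (by positivity) hφ
  refine ⟨2 * (|R| + 1), by positivity, hs, ?_⟩
  rintro u g ⟨h1, h2, φ, hφ, h3, h4⟩
  have l1 := tendsto_l2 (fun n => memLp_test hb (hφ n).1) h1 h3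
  have l2 := (tendsto_l2 (fun n => memLp_spaceGrad hb (hφ n).1) h2 h4).const_mul (2 * (|R| + 1))
  exact le_of_tendsto_of_tendsto' l1 l2 fun n => hs _ (testFunctions_lat_subset (hφ n))

lemma IsFriedrichsConstant.l2_le (hΩ : IsOpen Ω) (hb : Bornology.IsBounded Ω) {C : ℝ}
    (hC : IsFriedrichsConstant Ω T C) (h : IsH10Pair Ω T u g) :
    l2 (volQ Ω T) u ≤ C * l2 (volQ Ω T) g := by
  refine l2_le_of_eLpNorm_le hC.1.le h.2.1 ?_
  rw [← eLpNorm_congr_ae (h.wGrad_ae_eq hΩ hb)]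
  exact hC.2 u (h.mem_H10Zero hΩ hb)

lemma exists_isFriedrichsConstant (hd : 0 < d) (hΩ : IsOpen Ω) (hb : Bornology.IsBounded Ω)
    (T : ℝ) : ∃ C, IsFriedrichsConstant Ω T C := by
  obtain ⟨C, hC, -, h⟩ := exists_friedrichs hd hΩ hb T
  refine ⟨C, hC, fun u hu => ?_⟩
  have hp := isH10Pair_wGrad hb hu
  rw [nrm, nrm, ← ofReal_l2 hp.1, ← ofReal_l2 hp.2.1, ← ENNReal.ofReal_mul hC.le]
  exact ENNReal.ofReal_le_ofReal (h _ _ hp)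

end Weak

/-! ### Real Fourier series on `(0,T)`. -/

section Fourier

/-- Cosine coefficient of a function of time. -/
def fc (T : ℝ) (k : ℕ) (f : ℝ → ℝ) : ℝ := 2 / T * ∫ t in (0 : ℝ)..T, f t * Real.cos (k * freq T * t)

/-- Sine coefficient of a function of time. -/
def fs (T : ℝ) (k : ℕ) (f : ℝ → ℝ) : ℝ := 2 / T * ∫ t in (0 : ℝ)..T, f t * Real.sin (k * freq T * t)

variable {T : ℝ} {f g : ℝ → ℝ}

lemma intervalIntegral_eq_Ioo {E : Type*} [NormedAddCommGroup E] [NormedSpace ℝ E] (hT : 0 < T)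
    (f : ℝ → E) : ∫ t in (0 : ℝ)..T, f t = ∫ t in Ioo 0 T, f t := by
  rw [intervalIntegral.integral_of_le hT.le, integral_Ioc_eq_integral_Ioo]

lemma integrable_of_memLp_Ioo (hf : MemLp f 2 (volume.restrict (Ioo 0 T))) :
    Integrable f (volume.restrict (Ioo 0 T)) := hf.integrable (by norm_num)

lemma intervalIntegrable_of_Ioo (hT : 0 < T) (hf : Integrable f (volume.restrict (Ioo 0 T))) :
    IntervalIntegrable f volume 0 T := by
  rwa [intervalIntegrable_iff_integrableOn_Ioc_of_le hT.le, integrableOn_Ioc_iff_integrableOn_Ioo]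

lemma integrable_mul_bounded_Ioo (hf : Integrable f (volume.restrict (Ioo 0 T))) {e : ℝ → ℝ}
    (he : Continuous e) (hb : ∀ t, |e t| ≤ 1) :
    Integrable (fun t => f t * e t) (volume.restrict (Ioo 0 T)) :=
  hf.mul_bdd (c := 1) he.aestronglyMeasurable (ae_of_all _ hb)

lemma intervalIntegrable_mul_cos (hT : 0 < T) (hf : MemLp f 2 (volume.restrict (Ioo 0 T))) (c : ℝ) :
    IntervalIntegrable (fun t => f t * Real.cos (c * t)) volume 0 T :=
  intervalIntegrable_of_Ioo hT (integrable_mul_bounded_Ioo (integrable_of_memLp_Ioo hf)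
    (by fun_prop) fun t => Real.abs_cos_le_one _)

lemma intervalIntegrable_mul_sin (hT : 0 < T) (hf : MemLp f 2 (volume.restrict (Ioo 0 T))) (c : ℝ) :
    IntervalIntegrable (fun t => f t * Real.sin (c * t)) volume 0 T :=
  intervalIntegrable_of_Ioo hT (integrable_mul_bounded_Ioo (integrable_of_memLp_Ioo hf)
    (by fun_prop) fun t => Real.abs_sin_le_one _)

lemma fc_add (hT : 0 < T) (hf : MemLp f 2 (volume.restrict (Ioo 0 T)))
    (hg : MemLp g 2 (volume.restrict (Ioo 0 T))) (k : ℕ) :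
    fc T k (fun t => f t + g t) = fc T k f + fc T k g := by
  simp only [fc, add_mul]
  rw [intervalIntegral.integral_add (intervalIntegrable_mul_cos hT hf _)
    (intervalIntegrable_mul_cos hT hg _), mul_add]

lemma fs_add (hT : 0 < T) (hf : MemLp f 2 (volume.restrict (Ioo 0 T)))
    (hg : MemLp g 2 (volume.restrict (Ioo 0 T))) (k : ℕ) :
    fs T k (fun t => f t + g t) = fs T k f + fs T k g := by
  simp only [fs, add_mul]
  rw [intervalIntegral.integral_add (intervalIntegrable_mul_sin hT hf _)
    (intervalIntegrable_mul_sin hT hg _), mul_add]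

lemma fc_const_mul (c : ℝ) (f : ℝ → ℝ) (k : ℕ) : fc T k (fun t => c * f t) = c * fc T k f := by
  simp only [fc, mul_assoc, intervalIntegral.integral_const_mul]
  ring

lemma fs_const_mul (c : ℝ) (f : ℝ → ℝ) (k : ℕ) : fs T k (fun t => c * f t) = c * fs T k f := by
  simp only [fs, mul_assoc, intervalIntegral.integral_const_mul]
  ring

/-- The complex coefficient is `(a - i b)/2` with `a`, `b` the real cosine and sine coefficients,
and passing from `n` to `-n` only changes the sign of `b`. -/
lemma norm_sq_fourierCoeffOn (hT : 0 < T) (hf : MemLp f 2 (volume.restrict (Ioo 0 T))) (n : ℤ) :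
    ‖fourierCoeffOn hT (fun t => (f t : ℂ)) n‖ ^ 2
      = (fc T n.natAbs f ^ 2 + fs T n.natAbs f ^ 2) / 4 := by
  have h1 : ∀ n : ℤ, fourierCoeffOn hT (fun t => (f t : ℂ)) n
      = ((1 / T * ∫ t in (0 : ℝ)..T, f t * Real.cos (n * freq T * t) : ℝ) : ℂ)
        - ((1 / T * ∫ t in (0 : ℝ)..T, f t * Real.sin (n * freq T * t) : ℝ) : ℂ) * Complex.I := by
    intro n
    rw [fourierCoeffOn_eq_integral]
    have e : ∀ t : ℝ, (fourier (-n) (t : AddCircle (T - 0)) : ℂ) • (f t : ℂ)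
        = ((f t * Real.cos (n * freq T * t) : ℝ) : ℂ)
          - ((f t * Real.sin (n * freq T * t) : ℝ) : ℂ) * Complex.I := by
      intro t
      rw [fourier_coe_apply]
      have : (2 * Real.pi * Complex.I * ((-n : ℤ) : ℂ) * (t : ℂ) / ((T - 0 : ℝ) : ℂ))
          = ((-(n * freq T * t) : ℝ) : ℂ) * Complex.I := by
        simp only [freq]; push_cast; rw [sub_zero]; ring
      rw [this, Complex.exp_mul_I, ← Complex.ofReal_cos, ← Complex.ofReal_sin, Real.cos_neg,
        Real.sin_neg]
      push_cast
      rw [smul_eq_mul]; ring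
    simp only [e]
    rw [intervalIntegral.integral_sub, intervalIntegral.integral_mul_const,
      intervalIntegral.integral_ofReal, intervalIntegral.integral_ofReal]
    · rw [sub_zero, Complex.real_smul]
      push_cast; ring
    · exact ⟨(intervalIntegrable_mul_cos hT hf _).1.ofReal, (intervalIntegrable_mul_cos hT hf _).2.ofReal⟩
    · exact IntervalIntegrable.mul_const ⟨(intervalIntegrable_mul_sin hT hf _).1.ofReal,
        (intervalIntegrable_mul_sin hT hf _).2.ofReal⟩ _
  have h2 : ∀ a b : ℝ, ‖((a : ℂ) - (b : ℂ) * Complex.I)‖ ^ 2 = a ^ 2 + b ^ 2 := by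
    intro a b
    rw [← Complex.normSq_eq_norm_sq, Complex.normSq_apply]; simp; ring
  rw [h1, h2, fc, fs]
  rcases Int.natAbs_eq n with h | h
  · have : ((n.natAbs : ℕ) : ℝ) = (n : ℝ) := by
      have : ((n.natAbs : ℤ) : ℝ) = (n : ℝ) := congrArg _ h.symm
      rwa [Int.cast_natCast] at this
    rw [this]; ring
  · have : ((n.natAbs : ℕ) : ℝ) = -(n : ℝ) := by
      have : ((n.natAbs : ℤ) : ℝ) = ((-n : ℤ) : ℝ) := congrArg _ (by omega)
      rwa [Int.cast_natCast, Int.cast_neg] at this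
    rw [this]
    simp only [neg_mul, Real.cos_neg, Real.sin_neg, mul_neg, intervalIntegral.integral_neg]
    ring

/-- Parseval's identity on `(0,T)` in real form. -/
lemma hasSum_parseval_sq (hT : 0 < T) (hf : MemLp f 2 (volume.restrict (Ioo 0 T))) :
    HasSum (fun j : ℕ => T / 2 * (fc T (j + 1) f ^ 2 + fs T (j + 1) f ^ 2))
      ((∫ t in Ioo 0 T, f t ^ 2) - (∫ t in Ioo 0 T, f t) ^ 2 / T) := by
  have hf' : MemLp (fun t => (f t : ℂ)) 2 (volume.restrict (Ioc 0 T)) := by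
    rw [← restrict_Ioo_eq_restrict_Ioc]
    exact hf.ofReal
  -- Pairing `n` with `-n` counts the zero mode twice. Splitting off the index `0` therefore leaves
  -- the full sum minus one copy of the squared mean.
  have h := (hasSum_sq_fourierCoeffOn hT hf').nat_add_neg
  simp only [norm_sq_fourierCoeffOn hT hf, Int.natAbs_neg, Int.natAbs_natCast, Int.natAbs_zero] at h
  rw [← hasSum_nat_add_iff' 1] at h
  have h' := h.mul_left T
  have e0 : fc T 0 f = 2 / T * ∫ t in Ioo 0 T, f t := by
    simp [fc, intervalIntegral_eq_Ioo hT]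
  have e1 : fs T 0 f = 0 := by simp [fs]
  refine Eq.mp (congrArg₂ (fun a b => HasSum a b) (funext fun j => ?_) ?_) h'
  · ring
  · simp only [Finset.sum_range_one, e0, e1, sub_zero, smul_eq_mul]
    rw [intervalIntegral_eq_Ioo hT]
    simp only [Complex.norm_real, Real.norm_eq_abs, sq_abs]
    field_simp
    ring

/-- Polarization: a quarter of the difference of the identities for `f + g` and `f - g`. -/
lemma hasSum_parseval (hT : 0 < T) (hf : MemLp f 2 (volume.restrict (Ioo 0 T)))
    (hg : MemLp g 2 (volume.restrict (Ioo 0 T))) :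
    HasSum (fun j : ℕ => T / 2 * (fc T (j + 1) f * fc T (j + 1) g + fs T (j + 1) f * fs T (j + 1) g))
      ((∫ t in Ioo 0 T, f t * g t) - (∫ t in Ioo 0 T, f t) * (∫ t in Ioo 0 T, g t) / T) := by
  have hng : MemLp (fun t => (-1) * g t) 2 (volume.restrict (Ioo 0 T)) := hg.const_mul _
  have h1 := hasSum_parseval_sq hT (hf.add hg)
  have h2 := hasSum_parseval_sq hT (hf.add hng)
  have h := (h1.sub h2).mul_left (1 / 4)
  have hfi := integrable_of_memLp_Ioo hf
  have hgi := integrable_of_memLp_Ioo hg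
  refine Eq.mp (congrArg₂ (fun a b => HasSum a b) (funext fun j => ?_) ?_) h
  · symm
    have a1 := fc_add hT hf hg (j + 1)
    have a2 := fs_add hT hf hg (j + 1)
    have a3 := fc_add hT hf hng (j + 1)
    have a4 := fs_add hT hf hng (j + 1)
    rw [fc_const_mul] at a3
    rw [fs_const_mul] at a4
    change _ = 1 / 4 * (T / 2 * (fc T (j + 1) (fun t => f t + g t) ^ 2
      + fs T (j + 1) (fun t => f t + g t) ^ 2) - T / 2 * (fc T (j + 1) (fun t => f t + -1 * g t) ^ 2
      + fs T (j + 1) (fun t => f t + -1 * g t) ^ 2))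
    rw [a1, a2, a3, a4]; ring
  · have b1 : ∫ t in Ioo 0 T, (f + g) t = (∫ t in Ioo 0 T, f t) + ∫ t in Ioo 0 T, g t :=
      integral_add hfi hgi
    have b2 : ∫ t in Ioo 0 T, (f + fun t => -1 * g t) t
        = (∫ t in Ioo 0 T, f t) + -1 * ∫ t in Ioo 0 T, g t := by
      rw [← integral_const_mul]
      exact integral_add hfi (hgi.const_mul _)
    have b3 : ∫ t in Ioo 0 T, f t * g t = 1 / 4 * ((∫ t in Ioo 0 T, (f + g) t ^ 2)
        - ∫ t in Ioo 0 T, (f + fun t => -1 * g t) t ^ 2) := by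
      rw [← integral_sub (hf.add hg).integrable_sq (hf.add hng).integrable_sq, ← integral_const_mul]
      refine integral_congr_ae (ae_of_all _ fun t => ?_)
      simp only [Pi.add_apply]; ring
    rw [b3, b1, b2]
    ring

/-- The cosine condition with `k = 0` removes the mean as well, so Parseval's identity leaves norm
zero. -/
lemma ae_eq_zero_of_fourier (hT : 0 < T) (hf : MemLp f 2 (volume.restrict (Ioo 0 T)))
    (hc : ∀ k : ℕ, ∫ t in Ioo 0 T, f t * Real.cos (k * freq T * t) = 0)
    (hs : ∀ k : ℕ, ∫ t in Ioo 0 T, f t * Real.sin (k * freq T * t) = 0) :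
    f =ᵐ[volume.restrict (Ioo 0 T)] 0 := by
  have h := hasSum_parseval_sq hT hf
  simp only [fc, fs, intervalIntegral_eq_Ioo hT, hc, hs] at h
  have h0 := hc 0
  simp only [Nat.cast_zero, zero_mul, Real.cos_zero, mul_one] at h0
  have h1 := h.tsum_eq
  rw [h0] at h1
  refine eq_zero_of_l2_eq_zero hf ?_
  rw [← sq_eq_zero_iff, sq_l2' hf]
  simpa using h1.symm

end Fourier

/-! ### Weak derivatives on an interval and integration by parts over a period. -/

section OneDim

variable {T : ℝ}

/-- A primitive of a smooth function with support in `(0,T)` and mean zero is a test function. -/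
lemma exists_primitive_testFunction (hT : 0 < T) {κ : ℝ → ℝ} (hκ : κ ∈ testFunctions (Ioo 0 T))
    (h0 : ∫ t in Ioo 0 T, κ t = 0) :
    ∃ χ ∈ testFunctions (Ioo 0 T), deriv χ = κ := by
  obtain ⟨h1, h2, h3⟩ := hκ
  have hc := h1.continuous
  have hder : ∀ t, HasDerivAt (fun t => ∫ s in (0 : ℝ)..t, κ s) (κ t) t := fun t =>
    intervalIntegral.integral_hasDerivAt_right (hc.intervalIntegrable _ _)
      (hc.stronglyMeasurableAtFilter _ _) hc.continuousAt
  have hderiv : deriv (fun t => ∫ s in (0 : ℝ)..t, κ s) = κ := funext fun t => (hder t).deriv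
  have hsm : ContDiff ℝ ∞ fun t => ∫ s in (0 : ℝ)..t, κ s :=
    contDiff_infty_iff_deriv.2 ⟨fun t => (hder t).differentiableAt, by rwa [hderiv]⟩
  -- A compact support keeps its distance from both end points. If it is empty, the reversed bounds
  -- `a = T`, `b = 0` serve.
  have hsub : ∃ a b, 0 < a ∧ b < T ∧ tsupport κ ⊆ Icc a b := by
    rcases (tsupport κ).eq_empty_or_nonempty with h | h
    · exact ⟨T, 0, hT, hT, by simp [h]⟩
    · exact ⟨sInf (tsupport κ), sSup (tsupport κ), (h3 (h2.isCompact.sInf_mem h)).1,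
        (h3 (h2.isCompact.sSup_mem h)).2, fun x hx =>
        ⟨csInf_le h2.isCompact.bddBelow hx, le_csSup h2.isCompact.bddAbove hx⟩⟩
  obtain ⟨a, b, ha, hb, hab⟩ := hsub
  have hz : ∀ t, t < a ∨ b < t → κ t = 0 := fun t ht => image_eq_zero_of_notMem_tsupport fun h => by
    have := hab h
    rcases ht with ht | ht
    · exact absurd this.1 (not_le.2 ht)
    · exact absurd this.2 (not_le.2 ht)
  have hsupp : tsupport (fun t => ∫ s in (0 : ℝ)..t, κ s) ⊆ Icc a b := by
    refine closure_minimal (fun t ht => ?_) isClosed_Icc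
    by_contra hn
    refine ht ?_
    rw [mem_Icc, not_and_or, not_le, not_le] at hn
    rcases hn with hn | hn
    · refine (intervalIntegral.integral_congr (g := fun _ => (0 : ℝ)) fun s hs => ?_).trans (by simp)
      exact hz s (Or.inl (hs.2.trans_lt (max_lt ha hn)))
    -- To the right of the support the primitive equals the total integral, which vanishes by `h0`.
    · have e1 : (∫ s in (0 : ℝ)..T, κ s) + ∫ s in T..t, κ s = ∫ s in (0 : ℝ)..t, κ s :=
        intervalIntegral.integral_add_adjacent_intervals (hc.intervalIntegrable _ _)
          (hc.intervalIntegrable _ _)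
      have e2 : ∫ s in T..t, κ s = 0 := by
        refine (intervalIntegral.integral_congr (g := fun _ => (0 : ℝ)) fun s hs => ?_).trans (by simp)
        exact hz s (Or.inr (lt_of_lt_of_le (lt_min hb hn) hs.1))
      change ∫ s in (0 : ℝ)..t, κ s = 0
      rw [← e1, e2, add_zero, intervalIntegral_eq_Ioo hT, h0]
  exact ⟨_, ⟨hsm, isCompact_Icc.of_isClosed_subset isClosed_closure hsupp,
    hsupp.trans fun x hx => ⟨ha.trans_le hx.1, hx.2.trans_lt hb⟩⟩, hderiv⟩

/-- The lemma of du Bois-Reymond. -/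
lemma ae_const_of_integral_mul_deriv (hT : 0 < T) {F : ℝ → ℝ}
    (hF : Integrable F (volume.restrict (Ioo 0 T)))
    (h : ∀ χ ∈ testFunctions (Ioo 0 T), ∫ t in Ioo 0 T, F t * deriv χ t = 0) :
    ∃ c, ∀ᵐ t ∂(volume.restrict (Ioo 0 T)), F t = c := by
  let ρ : ContDiffBump (T / 2) := ⟨T / 8, T / 4, by positivity, by linarith⟩
  have hint : ∀ ψ ∈ testFunctions (Ioo 0 T), Integrable ψ (volume.restrict (Ioo 0 T)) :=
    fun ψ hψ => (hψ.1.continuous.integrable_of_hasCompactSupport hψ.2.1).restrict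
  have hintm : ∀ ψ ∈ testFunctions (Ioo 0 T),
      Integrable (fun t => F t * ψ t) (volume.restrict (Ioo 0 T)) := fun ψ hψ => by
    obtain ⟨C, hC⟩ := hψ.1.continuous.bounded_above_of_compact_support hψ.2.1
    exact hF.mul_bdd (c := C) hψ.1.continuous.aestronglyMeasurable (ae_of_all _ hC)
  have hρ : ρ.normed volume ∈ testFunctions (Ioo 0 T) := by
    refine ⟨ρ.contDiff_normed, ρ.hasCompactSupport_normed, ?_⟩
    rw [ρ.tsupport_normed_eq]
    intro x hx
    rw [Metric.mem_closedBall, Real.dist_eq, abs_le] at hx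
    change -(T / 4) ≤ _ ∧ _ ≤ T / 4 at hx
    exact ⟨by linarith [hx.1], by linarith [hx.2]⟩
  have hρ1 : ∫ t in Ioo 0 T, ρ.normed volume t = 1 := by
    rw [setIntegral_eq_integral_of_forall_compl_eq_zero, ρ.integral_normed]
    exact fun x hx => image_eq_zero_of_notMem_tsupport fun h => hx (hρ.2.2 h)
  refine ⟨∫ t in Ioo 0 T, F t * ρ.normed volume t, ?_⟩
  have key := ae_eq_zero_of_forall_testFunctions (μ := volume) (U := Ioo (0 : ℝ) T) isOpen_Ioo
    (f := fun t => F t - ∫ t in Ioo 0 T, F t * ρ.normed volume t)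
    (hF.sub (integrable_const _)) fun ψ hψ => ?_
  · filter_upwards [key] with t ht
    exact sub_eq_zero.1 ht
  -- Subtracting from `ψ` its integral times a bump of integral one leaves mean zero, hence the
  -- derivative of a test function. The hypothesis then shows that `F` minus its bump average is
  -- orthogonal to `ψ`.
  · set m := ∫ t in Ioo 0 T, ψ t with hm
    have hk : (fun t => ψ t - m * ρ.normed volume t) ∈ testFunctions (Ioo 0 T) := by
      have hs : tsupport (fun t => m * ρ.normed volume t) ⊆ Ioo 0 T :=
        (tsupport_mul_subset_right).trans hρ.2.2
      exact ⟨hψ.1.sub (contDiff_const.mul hρ.1), hψ.2.1.sub hρ.2.1.mul_left,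
        (tsupport_sub _ _).trans (union_subset hψ.2.2 hs)⟩
    obtain ⟨χ, hχ, hχd⟩ := exists_primitive_testFunction hT hk (by
      rw [integral_sub (hint _ hψ) ((hint _ hρ).const_mul _), integral_const_mul, hρ1, mul_one, ← hm,
        sub_self])
    have h1 := h χ hχ
    rw [hχd] at h1
    have e1 : ∫ t in Ioo 0 T, F t * (ψ t - m * ρ.normed volume t)
        = (∫ t in Ioo 0 T, F t * ψ t) - m * ∫ t in Ioo 0 T, F t * ρ.normed volume t := by
      rw [← integral_const_mul, ← integral_sub (hintm _ hψ) ((hintm _ hρ).const_mul m)]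
      exact integral_congr_ae (ae_of_all _ fun t => by ring)
    have e2 : ∫ t in Ioo 0 T, ψ t • (F t - ∫ t in Ioo 0 T, F t * ρ.normed volume t)
        = (∫ t in Ioo 0 T, F t * ψ t) - m * ∫ t in Ioo 0 T, F t * ρ.normed volume t := by
      rw [hm, mul_comm, ← integral_const_mul, ← integral_sub (hintm _ hψ) ((hint _ hψ).const_mul _)]
      exact integral_congr_ae (ae_of_all _ fun t => by simp only [smul_eq_mul]; ring)
    rw [e2, ← e1, h1]

/-- The primitive of an integrable function is absolutely continuous with derivative `h` almost
everywhere, which is enough to integrate by parts; it vanishes at `0`, so only the boundary term at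
`T` remains. -/
lemma integral_primitive_mul_deriv (hT : 0 < T) {h : ℝ → ℝ}
    (hh : Integrable h (volume.restrict (Ioo 0 T))) {e : ℝ → ℝ} (he : ContDiff ℝ ∞ e) :
    ∫ t in Ioo 0 T, (∫ s in (0 : ℝ)..t, h s) * deriv e t
      = (∫ t in Ioo 0 T, h t) * e T - ∫ t in Ioo 0 T, h t * e t := by
  have hi := intervalIntegrable_of_Ioo hT hh
  have a1 := hi.absolutelyContinuousOnInterval_intervalIntegral (c := 0) (by simp)
  have a2 : AbsolutelyContinuousOnInterval e 0 T :=
    (he.of_le (by simp)).contDiffOn.absolutelyContinuousOnInterval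
  have h1 := a1.integral_mul_deriv_eq_deriv_mul a2
  have h2 : ∫ t in (0 : ℝ)..T, deriv (fun t => ∫ s in (0 : ℝ)..t, h s) t * e t
      = ∫ t in (0 : ℝ)..T, h t * e t := by
    refine intervalIntegral.integral_congr_ae ?_
    filter_upwards [hi.ae_hasDerivAt_integral] with t ht htm
    rw [(ht (uIoc_subset_uIcc htm) 0 (by simp)).deriv]
  rw [h2] at h1
  simpa only [intervalIntegral_eq_Ioo hT, intervalIntegral.integral_same, zero_mul, sub_zero] using h1

/-- Integration by parts over a period for a weakly differentiable function with a continuous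
periodic representative. -/
lemma integral_mul_deriv_of_weak (hT : 0 < T) {G h : ℝ → ℝ} (hG : ContinuousOn G (Icc 0 T))
    (hper : G 0 = G T) (hh : Integrable h (volume.restrict (Ioo 0 T)))
    (hw : ∀ χ ∈ testFunctions (Ioo 0 T),
      ∫ t in Ioo 0 T, G t * deriv χ t = -∫ t in Ioo 0 T, h t * χ t)
    {e : ℝ → ℝ} (he : ContDiff ℝ ∞ e) (hee : e 0 = e T) :
    ∫ t in Ioo 0 T, G t * deriv e t = -∫ t in Ioo 0 T, h t * e t := by
  set H : ℝ → ℝ := fun t => ∫ s in (0 : ℝ)..t, h s with hH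
  have hi := intervalIntegrable_of_Ioo hT hh
  have hHc : ContinuousOn H (Icc 0 T) := by
    have := (hi.absolutelyContinuousOnInterval_intervalIntegral (c := 0) (by simp)).continuousOn
    rwa [uIcc_of_le hT.le] at this
  have hint : ∀ {F e : ℝ → ℝ}, ContinuousOn F (Icc 0 T) → ContDiff ℝ ∞ e →
      Integrable (fun t => F t * deriv e t) (volume.restrict (Ioo 0 T)) := fun hF he =>
    ((hF.mul ((contDiff_infty_iff_deriv.1 he).2.continuous.continuousOn)).integrableOn_compact
      isCompact_Icc).mono_set Ioo_subset_Icc_self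
  -- `G` and the primitive `H` have the same weak derivative, so they differ by a constant, and by
  -- continuity they do so on the closed interval.
  obtain ⟨c, hc⟩ := ae_const_of_integral_mul_deriv hT (F := fun t => G t - H t)
    (((hG.sub hHc).integrableOn_compact isCompact_Icc).mono_set Ioo_subset_Icc_self) fun χ hχ => by
      simp only [sub_mul]
      rw [integral_sub (hint hG hχ.1) (hint hHc hχ.1), hw χ hχ, integral_primitive_mul_deriv hT hh hχ.1]
      have : χ T = 0 := image_eq_zero_of_notMem_tsupport fun h => lt_irrefl _ (hχ.2.2 h).2
      rw [this]; ring
  have hc' : EqOn (fun t => G t - H t) (fun _ => c) (Icc 0 T) := by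
    have := Measure.eqOn_Icc_of_ae_eq volume hT.ne (f := fun t => G t - H t) (g := fun _ => c)
      ((ae_restrict_congr_set Ioo_ae_eq_Icc).1 hc) (hG.sub hHc) continuousOn_const
    exact this
  have hG' : ∀ t ∈ Icc 0 T, G t = H t + c := fun t ht => by linarith [hc' ht]
  -- The equal end values of `G` force the weak derivative to have mean zero, which removes the
  -- remaining boundary term.
  have hHT : ∫ t in Ioo 0 T, h t = 0 := by
    have h0 := hG' 0 ⟨le_rfl, hT.le⟩
    have h1 := hG' T ⟨hT.le, le_rfl⟩
    rw [← hper, h0] at h1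
    simp only [hH, intervalIntegral.integral_same, intervalIntegral_eq_Ioo hT] at h1
    linarith
  have e1 : ∫ t in Ioo 0 T, G t * deriv e t
      = (∫ t in Ioo 0 T, H t * deriv e t) + c * ∫ t in Ioo 0 T, deriv e t := by
    rw [← integral_const_mul, ← integral_add (hint hHc he)
      ((hint (F := fun _ => c) continuousOn_const he))]
    refine setIntegral_congr_fun measurableSet_Ioo fun t ht => ?_
    simp only [hG' t (Ioo_subset_Icc_self ht)]; ring
  have e2 : ∫ t in Ioo 0 T, deriv e t = 0 := by
    rw [← intervalIntegral_eq_Ioo hT, intervalIntegral.integral_deriv_eq_sub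
      (fun x _ => he.differentiable (by simp) x)
      ((contDiff_infty_iff_deriv.1 he).2.continuous.intervalIntegrable _ _), hee, sub_self]
  rw [e1, e2, integral_primitive_mul_deriv hT hh he, hHT]
  ring

end OneDim

/-! ### Square integrability of slices. -/

section Slices

variable {X Y : Type*} [MeasurableSpace X] [MeasurableSpace Y] {μ : Measure X} {ν : Measure Y}
  [SFinite μ] [SFinite ν] {F : Type*} [NormedAddCommGroup F]

lemma MemLp.ae_slice_right {f : X × Y → F} (hf : MemLp f 2 (μ.prod ν)) :
    ∀ᵐ x ∂μ, MemLp (fun y => f (x, y)) 2 ν := by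
  filter_upwards [hf.1.prodMk_left, ((memLp_two_iff_integrable_sq_norm hf.1).1 hf).prod_right_ae]
    with x h1 h2
  exact (memLp_two_iff_integrable_sq_norm h1).2 h2

lemma MemLp.ae_slice_left {f : X × Y → F} (hf : MemLp f 2 (μ.prod ν)) :
    ∀ᵐ y ∂ν, MemLp (fun x => f (x, y)) 2 μ :=
  MemLp.ae_slice_right (hf.comp_measurePreserving Measure.measurePreserving_swap)

end Slices

/-! ### Fourier coefficients in time of functions on the cylinder. -/

section TimeFourier

variable {d : ℕ} {Ω : Set (Sp d)} {T : ℝ} {u u' w q : Sp d × ℝ → ℝ}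

lemma ae_memLp_time (hu : MemLp u 2 (volQ Ω T)) :
    ∀ᵐ x ∂(volume.restrict Ω), MemLp (fun t => u (x, t)) 2 (volume.restrict (Ioo 0 T)) := by
  rw [volQ_eq_prod] at hu
  exact MemLp.ae_slice_right hu

lemma integrable_mul_time (hb : Bornology.IsBounded Ω) (hu : MemLp u 2 (volQ Ω T)) {f : Sp d → ℝ}
    {e : ℝ → ℝ} (hf : Continuous f) (he : Continuous e) :
    Integrable (fun z => u z * (f z.1 * e z.2)) (volQ Ω T) :=
  integrable_continuous_smul hb hu ((hf.comp continuous_fst).mul (he.comp continuous_snd))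

/-- Integration by parts in time over a period, for almost every point of `Ω`. -/
lemma ae_integral_mul_deriv (hΩ : IsOpen Ω) (hb : Bornology.IsBounded Ω) (hT : 0 < T)
    (hu : u ∈ H01per Ω T) (hw : HasWeakTimeDeriv Ω T u w) {e : ℝ → ℝ} (he : ContDiff ℝ ∞ e)
    (hee : e 0 = e T) :
    ∀ᵐ x ∂(volume.restrict Ω), ∫ t in Ioo 0 T, u (x, t) * deriv e t
      = -∫ t in Ioo 0 T, w (x, t) * e t := by
  obtain ⟨⟨hu2, -⟩, U, hUc, hU, hUper⟩ := hu
  have hdc : ∀ {χ : ℝ → ℝ}, ContDiff ℝ ∞ χ → Continuous (deriv χ) := fun h =>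
    (contDiff_infty_iff_deriv.1 h).2.continuous
  have hI : ∀ {v : Sp d × ℝ → ℝ} {f : Sp d → ℝ} {χ : ℝ → ℝ}, MemLp v 2 (volQ Ω T) → Continuous f →
      Continuous χ → ∫ z, v z * (f z.1 * χ z.2) ∂(volQ Ω T)
        = ∫ t in Ioo 0 T, (∫ x in Ω, v (x, t) * f x) * χ t := by
    intro v f χ hv hf hχ
    rw [integral_volQ_time_space (integrable_mul_time hb hv hf hχ)]
    refine integral_congr_ae (ae_of_all _ fun t => ?_)
    simp only [← mul_assoc]
    exact integral_mul_const _ _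
  have hI' : ∀ {v : Sp d × ℝ → ℝ} {f : Sp d → ℝ} {χ : ℝ → ℝ}, MemLp v 2 (volQ Ω T) → Continuous f →
      Continuous χ → ∫ z, v z * (f z.1 * χ z.2) ∂(volQ Ω T)
        = ∫ x in Ω, f x * ∫ t in Ioo 0 T, v (x, t) * χ t := by
    intro v f χ hv hf hχ
    rw [integral_volQ_space_time (integrable_mul_time hb hv hf hχ)]
    refine integral_congr_ae (ae_of_all _ fun x => ?_)
    simp only
    rw [← integral_const_mul]
    exact integral_congr_ae (ae_of_all _ fun t => by ring)
  have hIi : ∀ {v : Sp d × ℝ → ℝ} {f : Sp d → ℝ} {χ : ℝ → ℝ}, MemLp v 2 (volQ Ω T) → Continuous f →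
      Continuous χ → Integrable (fun x => f x * ∫ t in Ioo 0 T, v (x, t) * χ t) (volume.restrict Ω) := by
    intro v f χ hv hf hχ
    have := integrable_mul_time hb hv hf hχ
    rw [volQ_eq_prod] at this
    refine this.integral_prod_left.congr (ae_of_all _ fun x => ?_)
    simp only
    rw [← integral_const_mul]
    exact integral_congr_ae (ae_of_all _ fun t => by ring)
  have i1 := hIi hu2 (continuous_const (y := 1)) (hdc he)
  have i2 := hIi hw.1 (continuous_const (y := 1)) he.continuous
  simp only [one_mul] at i1 i2
  -- Weighting the identity with a test function in space turns it into a scalar identity in time.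
  have key := ae_eq_zero_of_forall_testFunctions (μ := volume) hΩ (i1.add i2) fun φ hφ => ?_
  · filter_upwards [key] with x hx
    exact eq_neg_of_add_eq_zero_left hx
  · have hφc := hφ.1.continuous
    have hφL : MemLp φ 2 (volume.restrict Ω) := Continuous.memLp_restrict hb hφc
    -- Pairing the continuous representative `U` with `φ` gives a continuous scalar function with
    -- equal end values: this is where the periodicity of `u` enters.
    have hGae : ∀ᵐ t ∂(volume.restrict (Ioo 0 T)),
        inner ℝ (hφL.toLp φ) (U t) = ∫ x in Ω, u (x, t) * φ x := by
      filter_upwards [hU] with t ht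
      rw [L2.inner_def]
      refine integral_congr_ae ?_
      filter_upwards [ht, hφL.coeFn_toLp] with x h1 h2
      rw [h1, h2]; simp
    have hGi : ∀ χ : ℝ → ℝ, Continuous χ → ∫ t in Ioo 0 T, inner ℝ (hφL.toLp φ) (U t) * χ t
        = ∫ z, u z * (φ z.1 * χ z.2) ∂(volQ Ω T) := fun χ hχ => by
      rw [hI hu2 hφc hχ]
      refine integral_congr_ae ?_
      filter_upwards [hGae] with t ht
      rw [ht]
    have hhi : Integrable (fun t => ∫ x in Ω, w (x, t) * φ x) (volume.restrict (Ioo 0 T)) := by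
      have := integrable_mul_time hb hw.1 hφc (continuous_const (y := 1))
      rw [volQ_eq_prod] at this
      simpa using this.integral_prod_right
    have main := integral_mul_deriv_of_weak hT (G := fun t => inner ℝ (hφL.toLp φ) (U t))
      (continuousOn_const.inner hUc) (by simp only [hUper]) hhi (fun χ hχ => by
        have hψ : (fun z : Sp d × ℝ => φ z.1 * χ z.2) ∈ testFunctions (cyl Ω T) := by
          have hs : tsupport (fun z : Sp d × ℝ => φ z.1 * χ z.2) ⊆ tsupport φ ×ˢ tsupport χ := by
            refine closure_minimal (fun z hz => ?_) ((isClosed_tsupport _).prod (isClosed_tsupport _))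
            exact ⟨subset_tsupport _ (left_ne_zero_of_mul hz), subset_tsupport _ (right_ne_zero_of_mul hz)⟩
          exact ⟨(hφ.1.comp contDiff_fst).mul (hχ.1.comp contDiff_snd),
            (hφ.2.1.isCompact.prod hχ.2.1.isCompact).of_isClosed_subset isClosed_closure hs,
            hs.trans (Set.prod_mono hφ.2.2 hχ.2.2)⟩
        have h1 := hw.2 _ hψ
        have h2 : ∀ z : Sp d × ℝ, timeDeriv (fun z : Sp d × ℝ => φ z.1 * χ z.2) z
            = φ z.1 * deriv χ z.2 := fun z => by
          simp only [timeDeriv]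
          exact deriv_const_mul _ ((hχ.1.differentiable (by simp)) _)
        simp only [h2] at h1
        rw [hGi _ (hdc hχ.1), h1, hI hw.1 hφc hχ.1.continuous]) he hee
    rw [hGi _ (hdc he), ← hI hw.1 hφc he.continuous, hI' hu2 hφc (hdc he), hI' hw.1 hφc he.continuous]
      at main
    simp only [Pi.add_apply, smul_eq_mul, mul_add]
    rw [integral_add (hIi hu2 hφc (hdc he)) (hIi hw.1 hφc he.continuous), main]
    ring

lemma cosCoeff_eq (k : ℕ) (x : Sp d) : cosCoeff T k u x = fc T k fun t => u (x, t) := rfl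

lemma sinCoeff_eq (k : ℕ) (x : Sp d) : sinCoeff T k u x = fs T k fun t => u (x, t) := rfl

lemma freq_pos (hT : 0 < T) : 0 < freq T := by unfold freq; positivity

lemma cos_period (hT : 0 < T) (k : ℕ) : Real.cos (k * freq T * T) = 1 := by
  have : k * freq T * T = k * (2 * Real.pi) := by unfold freq; field_simp
  rw [this, Real.cos_nat_mul_two_pi]

lemma sin_period (hT : 0 < T) (k : ℕ) : Real.sin (k * freq T * T) = 0 := by
  have : k * freq T * T = (2 * k : ℕ) * Real.pi := by unfold freq; push_cast; field_simp
  rw [this, Real.sin_nat_mul_pi]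

/-- Integration by parts against `1`, `cos` and `sin`: the derivative has mean zero, and
differentiation scales the pair of coefficients by `kω` and rotates it. One null set serves all `k`.
-/
lemma ae_fourier_timeDeriv (hΩ : IsOpen Ω) (hb : Bornology.IsBounded Ω) (hT : 0 < T)
    (hu : u ∈ H01per Ω T) (hw : HasWeakTimeDeriv Ω T u w) :
    ∀ᵐ x ∂(volume.restrict Ω), (∫ t in Ioo 0 T, w (x, t)) = 0 ∧ ∀ k : ℕ,
      cosCoeff T k w x = k * freq T * sinCoeff T k u x ∧
      sinCoeff T k w x = -(k * freq T * cosCoeff T k u x) := by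
  have hc : ∀ k : ℕ, ContDiff ℝ ∞ fun t => Real.cos (k * freq T * t) := fun k =>
    Real.contDiff_cos.comp (contDiff_const.mul contDiff_id)
  have hs : ∀ k : ℕ, ContDiff ℝ ∞ fun t => Real.sin (k * freq T * t) := fun k =>
    Real.contDiff_sin.comp (contDiff_const.mul contDiff_id)
  have h0 := ae_integral_mul_deriv hΩ hb hT hu hw (contDiff_const (c := (1 : ℝ))) rfl
  have h1 := ae_all_iff.2 fun k : ℕ => ae_integral_mul_deriv hΩ hb hT hu hw (hc k)
    (by rw [cos_period hT]; simp)
  have h2 := ae_all_iff.2 fun k : ℕ => ae_integral_mul_deriv hΩ hb hT hu hw (hs k)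
    (by rw [sin_period hT]; simp)
  filter_upwards [h0, h1, h2] with x h0 h1 h2
  refine ⟨by simpa using h0, fun k => ⟨?_, ?_⟩⟩
  · have h := h1 k
    have hd : ∀ t, deriv (fun t => Real.cos (k * freq T * t)) t
        = -(k * freq T) * Real.sin (k * freq T * t) := fun t => by
      have := ((hasDerivAt_id t).const_mul (k * freq T : ℝ)).cos.deriv
      simp only [id, mul_one] at this
      rw [this]; ring
    simp only [hd] at h
    simp only [cosCoeff, sinCoeff, intervalIntegral_eq_Ioo hT]
    have e : ∫ t in Ioo 0 T, u (x, t) * (-(k * freq T) * Real.sin (k * freq T * t))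
        = -(k * freq T) * ∫ t in Ioo 0 T, u (x, t) * Real.sin (k * freq T * t) := by
      rw [← integral_const_mul]
      exact integral_congr_ae (ae_of_all _ fun t => by ring)
    rw [e] at h
    linear_combination (2 / T) * h
  · have h := h2 k
    have hd : ∀ t, deriv (fun t => Real.sin (k * freq T * t)) t
        = (k * freq T) * Real.cos (k * freq T * t) := fun t => by
      have := ((hasDerivAt_id t).const_mul (k * freq T : ℝ)).sin.deriv
      simp only [id, mul_one] at this
      rw [this]; ring
    simp only [hd] at h
    simp only [cosCoeff, sinCoeff, intervalIntegral_eq_Ioo hT]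
    have e : ∫ t in Ioo 0 T, u (x, t) * ((k * freq T) * Real.cos (k * freq T * t))
        = (k * freq T) * ∫ t in Ioo 0 T, u (x, t) * Real.cos (k * freq T * t) := by
      rw [← integral_const_mul]
      exact integral_congr_ae (ae_of_all _ fun t => by ring)
    rw [e] at h
    linear_combination (2 / T) * h

lemma aestronglyMeasurable_coeff (hu : MemLp u 2 (volQ Ω T)) (hT : 0 < T) {e : ℝ → ℝ}
    (he : Continuous e) :
    AEStronglyMeasurable (fun x => 2 / T * ∫ t in (0 : ℝ)..T, u (x, t) * e t) (volume.restrict Ω) := by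
  simp only [intervalIntegral_eq_Ioo hT]
  have h1 := hu.1
  rw [volQ_eq_prod] at h1
  have h2 : AEStronglyMeasurable (fun z : Sp d × ℝ => u z * e z.2)
      ((volume.restrict Ω).prod (volume.restrict (Ioo 0 T))) :=
    h1.mul (he.comp continuous_snd).aestronglyMeasurable
  exact h2.integral_prod_right'.const_mul _

/-- The sum of the squared Fourier coefficients of frequency `j + 1`. -/
def coeffSq (T : ℝ) (u : Sp d × ℝ → ℝ) (j : ℕ) (x : Sp d) : ℝ :=
  cosCoeff T (j + 1) u x ^ 2 + sinCoeff T (j + 1) u x ^ 2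

lemma coeffSq_nonneg (j : ℕ) (x : Sp d) : 0 ≤ coeffSq T u j x := by unfold coeffSq; positivity

/-- Bessel's inequality at almost every point: Parseval's identity with the nonnegative contribution
of the mean discarded, outside one null set for all finite sums. -/
lemma ae_sum_coeffSq_le (hT : 0 < T) (hu : MemLp u 2 (volQ Ω T)) :
    ∀ᵐ x ∂(volume.restrict Ω), ∀ s : Finset ℕ,
      ∑ j ∈ s, T / 2 * coeffSq T u j x ≤ ∫ t in Ioo 0 T, u (x, t) ^ 2 := by
  filter_upwards [ae_memLp_time hu] with x hx s
  have h := hasSum_parseval_sq hT hx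
  refine (sum_le_hasSum s (fun j _ => by positivity) h).trans ?_
  have : 0 ≤ (∫ t in Ioo 0 T, u (x, t)) ^ 2 / T := by positivity
  linarith

lemma integrable_sq_time (hu : MemLp u 2 (volQ Ω T)) :
    Integrable (fun x => ∫ t in Ioo 0 T, u (x, t) ^ 2) (volume.restrict Ω) := by
  have := hu.integrable_sq
  rw [volQ_eq_prod] at this
  exact this.integral_prod_left

/-- Bessel's inequality for a single frequency dominates the square by `2/T` times the time integral
of `u²`, which is integrable by Fubini's theorem. -/
lemma memLp_cosCoeff (hT : 0 < T) (hu : MemLp u 2 (volQ Ω T)) (j : ℕ) :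
    MemLp (cosCoeff T (j + 1) u) 2 (volume.restrict Ω) := by
  have hm : AEStronglyMeasurable (cosCoeff T (j + 1) u) (volume.restrict Ω) :=
    aestronglyMeasurable_coeff hu hT (by fun_prop)
  refine (memLp_two_iff_integrable_sq hm).2 (((integrable_sq_time hu).const_mul (2 / T)).mono'
    (hm.pow 2) ?_)
  filter_upwards [ae_sum_coeffSq_le hT hu] with x hx
  have := hx {j}
  rw [Finset.sum_singleton, coeffSq] at this
  rw [Real.norm_eq_abs, abs_of_nonneg (sq_nonneg _), div_mul_eq_mul_div, le_div_iff₀ hT]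
  nlinarith [mul_nonneg hT.le (sq_nonneg (sinCoeff T (j + 1) u x))]

lemma memLp_sinCoeff (hT : 0 < T) (hu : MemLp u 2 (volQ Ω T)) (j : ℕ) :
    MemLp (sinCoeff T (j + 1) u) 2 (volume.restrict Ω) := by
  have hm : AEStronglyMeasurable (sinCoeff T (j + 1) u) (volume.restrict Ω) :=
    aestronglyMeasurable_coeff hu hT (by fun_prop)
  refine (memLp_two_iff_integrable_sq hm).2 (((integrable_sq_time hu).const_mul (2 / T)).mono'
    (hm.pow 2) ?_)
  filter_upwards [ae_sum_coeffSq_le hT hu] with x hx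
  have := hx {j}
  rw [Finset.sum_singleton, coeffSq] at this
  rw [Real.norm_eq_abs, abs_of_nonneg (sq_nonneg _), div_mul_eq_mul_div, le_div_iff₀ hT]
  nlinarith [mul_nonneg hT.le (sq_nonneg (cosCoeff T (j + 1) u x))]

lemma integrable_coeffSq (hT : 0 < T) (hu : MemLp u 2 (volQ Ω T)) (j : ℕ) :
    Integrable (coeffSq T u j) (volume.restrict Ω) :=
  (memLp_cosCoeff hT hu j).integrable_sq.add (memLp_sinCoeff hT hu j).integrable_sq

/-- Bessel's inequality. -/
lemma summable_integral_coeffSq (hT : 0 < T) (hu : MemLp u 2 (volQ Ω T)) :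
    Summable fun j => ∫ x in Ω, coeffSq T u j x := by
  refine summable_of_sum_le (c := 2 / T * ∫ x in Ω, ∫ t in Ioo 0 T, u (x, t) ^ 2)
    (fun j => integral_nonneg fun x => coeffSq_nonneg j x) fun s => ?_
  rw [← integral_finsetSum _ fun j _ => integrable_coeffSq hT hu j, ← integral_const_mul]
  refine integral_mono_ae (integrable_finsetSum _ fun j _ => integrable_coeffSq hT hu j)
    ((integrable_sq_time hu).const_mul _) ?_
  filter_upwards [ae_sum_coeffSq_le hT hu] with x hx
  have := hx s
  rw [← Finset.mul_sum] at this
  rw [div_mul_eq_mul_div, le_div_iff₀ hT]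
  linarith

lemma eLpNorm_sq_eq {X : Type*} [MeasurableSpace X] {μ : Measure X} {f : X → ℝ} (hf : MemLp f 2 μ) :
    eLpNorm f 2 μ ^ 2 = ENNReal.ofReal (∫ x, f x ^ 2 ∂μ) := by
  rw [← sq_l2' hf, ENNReal.ofReal_pow (l2_nonneg f), ofReal_l2 hf]

lemma halfSq_lt_top_iff (hT : 0 < T) (hu : MemLp u 2 (volQ Ω T)) :
    halfSq Ω T u < ⊤ ↔ Summable fun j : ℕ => ((j + 1 : ℕ) : ℝ) * freq T * ∫ x in Ω, coeffSq T u j x := by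
  have hω := freq_pos hT
  have hnn : ∀ j : ℕ, 0 ≤ ((j + 1 : ℕ) : ℝ) * freq T * ∫ x in Ω, coeffSq T u j x := fun j =>
    mul_nonneg (by positivity) (integral_nonneg fun x => coeffSq_nonneg j x)
  have h1 : ∀ j : ℕ, ENNReal.ofReal (((j + 1 : ℕ) : ℝ) * freq T) *
      (eLpNorm (cosCoeff T (j + 1) u) 2 (volume.restrict Ω) ^ 2 +
        eLpNorm (sinCoeff T (j + 1) u) 2 (volume.restrict Ω) ^ 2)
      = ENNReal.ofReal (((j + 1 : ℕ) : ℝ) * freq T * ∫ x in Ω, coeffSq T u j x) := fun j => by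
    rw [eLpNorm_sq_eq (memLp_cosCoeff hT hu j), eLpNorm_sq_eq (memLp_sinCoeff hT hu j),
      ← ENNReal.ofReal_add (integral_nonneg fun x => sq_nonneg _) (integral_nonneg fun x => sq_nonneg _),
      ← ENNReal.ofReal_mul (by positivity), ← integral_add (memLp_cosCoeff hT hu j).integrable_sq
        (memLp_sinCoeff hT hu j).integrable_sq]
    rfl
  rw [halfSq]
  simp only [h1]
  constructor
  · intro h
    have h2 : ∑' j : ℕ, ENNReal.ofReal (((j + 1 : ℕ) : ℝ) * freq T * ∫ x in Ω, coeffSq T u j x) ≠ ⊤ := by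
      intro h3
      rw [h3, ENNReal.mul_top (by simpa using hT)] at h
      exact lt_irrefl _ h
    have h3 := ENNReal.summable_toReal h2
    simpa only [ENNReal.toReal_ofReal (hnn _)] using h3
  · intro h
    refine ENNReal.mul_lt_top ENNReal.ofReal_lt_top ?_
    rw [← ENNReal.ofReal_tsum_of_nonneg hnn h]
    exact ENNReal.ofReal_lt_top

/-- For `k ≥ 1` one has `kω ≤ (kω)²/ω`, and `(kω)²` times the squared coefficients of `u` are those
of its time derivative, which are summable by Bessel's inequality. -/
lemma halfSq_lt_top_of_H01per (hΩ : IsOpen Ω) (hb : Bornology.IsBounded Ω) (hT : 0 < T)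
    (hu : u ∈ H01per Ω T) : halfSq Ω T u < ⊤ := by
  obtain ⟨w, hw⟩ := hu.1.2
  have hu2 : MemLp u 2 (volQ Ω T) := hu.1.1
  have hω := freq_pos hT
  rw [halfSq_lt_top_iff hT hu2]
  refine Summable.of_nonneg_of_le (fun j => mul_nonneg (by positivity)
    (integral_nonneg fun x => coeffSq_nonneg j x)) (fun j => ?_)
    ((summable_integral_coeffSq hT hw.1).mul_left (1 / freq T))
  have e : ∫ x in Ω, coeffSq T w j x
      = (((j + 1 : ℕ) : ℝ) * freq T) ^ 2 * ∫ x in Ω, coeffSq T u j x := by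
    rw [← integral_const_mul]
    refine integral_congr_ae ?_
    filter_upwards [ae_fourier_timeDeriv hΩ hb hT hu hw] with x hx
    rw [coeffSq, (hx.2 _).1, (hx.2 _).2, coeffSq]; ring
  have hI : 0 ≤ ∫ x in Ω, coeffSq T u j x := integral_nonneg fun x => coeffSq_nonneg j x
  have h1 : (1 : ℝ) ≤ ((j + 1 : ℕ) : ℝ) := by exact_mod_cast Nat.le_add_left 1 j
  rw [e, ← mul_assoc]
  refine mul_le_mul_of_nonneg_right ?_ hI
  rw [one_div, mul_pow, pow_two (freq T), mul_comm (freq T)⁻¹, mul_assoc, mul_assoc,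
    mul_inv_cancel₀ hω.ne', mul_one]
  have h2 := mul_le_mul_of_nonneg_left h1 (mul_nonneg (zero_le_one.trans h1) hω.le)
  nlinarith

variable {σ : Sp d → ℝ} {C : ℝ}

lemma integrable_coeff_prod (hσm : AEStronglyMeasurable σ (volume.restrict Ω))
    (hσ : ∀ᵐ x ∂(volume.restrict Ω), |σ x| ≤ C) {a b a' b' : Sp d → ℝ}
    (ha : MemLp a 2 (volume.restrict Ω)) (hb : MemLp b 2 (volume.restrict Ω))
    (ha' : MemLp a' 2 (volume.restrict Ω)) (hb' : MemLp b' 2 (volume.restrict Ω)) :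
    Integrable (fun x => σ x * (a x * b x + a' x * b' x)) (volume.restrict Ω) :=
  ((integrable_mul_l2 ha hb).add (integrable_mul_l2 ha' hb')).bdd_mul hσm hσ

lemma integral_norm_coeff_prod_le
    (hσ : ∀ᵐ x ∂(volume.restrict Ω), |σ x| ≤ C) {a b a' b' : Sp d → ℝ}
    (ha : MemLp a 2 (volume.restrict Ω)) (hb : MemLp b 2 (volume.restrict Ω))
    (ha' : MemLp a' 2 (volume.restrict Ω)) (hb' : MemLp b' 2 (volume.restrict Ω)) :
    ∫ x in Ω, ‖σ x * (a x * b x + a' x * b' x)‖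
      ≤ C / 2 * ((∫ x in Ω, (a x ^ 2 + a' x ^ 2)) + ∫ x in Ω, (b x ^ 2 + b' x ^ 2)) := by
  have i1 : Integrable (fun x => a x ^ 2 + a' x ^ 2) (volume.restrict Ω) :=
    ha.integrable_sq.add ha'.integrable_sq
  have i2 : Integrable (fun x => b x ^ 2 + b' x ^ 2) (volume.restrict Ω) :=
    hb.integrable_sq.add hb'.integrable_sq
  rw [← integral_add i1 i2, ← integral_const_mul]
  refine integral_mono_of_nonneg (ae_of_all _ fun x => norm_nonneg _) ((i1.add i2).const_mul _) ?_
  filter_upwards [hσ] with x hx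
  simp only [Real.norm_eq_abs, abs_mul]
  have h1 : |a x * b x + a' x * b' x| ≤ (a x ^ 2 + a' x ^ 2 + (b x ^ 2 + b' x ^ 2)) / 2 := by
    rw [abs_le]
    constructor <;> nlinarith [sq_nonneg (a x + b x), sq_nonneg (a' x + b' x), sq_nonneg (a x - b x),
      sq_nonneg (a' x - b' x)]
  have h2 := mul_le_mul hx h1 (abs_nonneg _) ((abs_nonneg _).trans hx)
  linarith

/-- Parseval's identity on the space-time cylinder, for a factor of mean zero in time. -/
lemma hasSum_parseval_volQ (hT : 0 < T)
    (hσm : AEStronglyMeasurable σ (volume.restrict Ω)) (hσ : ∀ᵐ x ∂(volume.restrict Ω), |σ x| ≤ C)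
    (hw : MemLp w 2 (volQ Ω T)) (hq : MemLp q 2 (volQ Ω T))
    (h0 : ∀ᵐ x ∂(volume.restrict Ω), (∫ t in Ioo 0 T, w (x, t)) = 0) :
    HasSum (fun j : ℕ => T / 2 * ∫ x in Ω, σ x * (cosCoeff T (j + 1) w x * cosCoeff T (j + 1) q x
      + sinCoeff T (j + 1) w x * sinCoeff T (j + 1) q x)) (∫ z, σ z.1 * w z * q z ∂(volQ Ω T)) := by
  have hci := fun j => integrable_coeff_prod hσm hσ (memLp_cosCoeff hT hw j)
    (memLp_cosCoeff hT hq j) (memLp_sinCoeff hT hw j) (memLp_sinCoeff hT hq j)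
  -- The series may be integrated termwise because its `L¹` norms are summable, by the Bessel bounds
  -- for `w` and `q`.
  have h := hasSum_integral_of_summable_integral_norm (fun j => (hci j).const_mul (T / 2))
    (Summable.of_nonneg_of_le (fun j => integral_nonneg fun x => norm_nonneg _) (fun j => ?_)
      (((summable_integral_coeffSq hT hw).add (summable_integral_coeffSq hT hq)).mul_left
        (T / 2 * (C / 2))))
  · simp only [integral_const_mul] at h
    have e : ∫ z, σ z.1 * w z * q z ∂(volQ Ω T) = ∫ x in Ω, ∑' j : ℕ, T / 2 *
        (σ x * (cosCoeff T (j + 1) w x * cosCoeff T (j + 1) q x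
          + sinCoeff T (j + 1) w x * sinCoeff T (j + 1) q x)) := by
      have hi : Integrable (fun z : Sp d × ℝ => σ z.1 * w z * q z) (volQ Ω T) := by
        have h1 := integrable_mul_l2 hw hq
        have h2 : Integrable (fun z : Sp d × ℝ => σ z.1 * (w z * q z)) (volQ Ω T) := by
          rw [volQ_eq_prod] at *
          exact h1.bdd_mul hσm.comp_fst (Measure.quasiMeasurePreserving_fst.ae hσ)
        exact h2.congr (ae_of_all _ fun z => (mul_assoc _ _ _).symm)
      rw [integral_volQ_space_time hi]
      refine integral_congr_ae ?_
      filter_upwards [ae_memLp_time hw, ae_memLp_time hq, h0] with x h1 h2 h3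
      -- The mean of `w` vanishes, so nothing is lost by starting the series at frequency one.
      have h4 := (hasSum_parseval hT h1 h2).mul_left (σ x)
      rw [h3, zero_mul, zero_div, sub_zero, ← integral_const_mul] at h4
      simp only [mul_assoc]
      rw [← h4.tsum_eq]
      refine tsum_congr fun j => ?_
      simp only [cosCoeff_eq, sinCoeff_eq]; ring
    rw [e]; exact h
  · have := integral_norm_coeff_prod_le hσ (memLp_cosCoeff hT hw j)
      (memLp_cosCoeff hT hq j) (memLp_sinCoeff hT hw j) (memLp_sinCoeff hT hq j)
    simp only [norm_mul (T / 2), integral_const_mul]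
    rw [Real.norm_of_nonneg (by positivity : 0 ≤ T / 2), mul_assoc]
    exact mul_le_mul_of_nonneg_left this (by positivity)

/-- On `H^{0,1}_per(Q)` the form is the integral `∫ σ ∂ₜu q`. -/
lemma timeForm_eq_integral (hΩ : IsOpen Ω) (hb : Bornology.IsBounded Ω) (hT : 0 < T)
    (hσm : AEStronglyMeasurable σ (volume.restrict Ω)) (hσ : ∀ᵐ x ∂(volume.restrict Ω), |σ x| ≤ C)
    (hu : u ∈ H01per Ω T) (hw : HasWeakTimeDeriv Ω T u w) (hq : MemLp q 2 (volQ Ω T)) :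
    timeForm Ω T σ u q = ∫ z, σ z.1 * w z * q z ∂(volQ Ω T) := by
  have hF := ae_fourier_timeDeriv hΩ hb hT hu hw
  -- The weights `kω` are absorbed into the coefficients of `w`, so square integrability of `q`
  -- suffices.
  have h := hasSum_parseval_volQ hT hσm hσ hw.1 hq (hF.mono fun x hx => hx.1)
  rw [← h.tsum_eq, tsum_mul_left, timeForm]
  congr 1
  refine tsum_congr fun j => ?_
  rw [← integral_const_mul]
  refine integral_congr_ae ?_
  filter_upwards [hF] with x hx
  rw [(hx.2 _).1, (hx.2 _).2]; ring

end TimeFourier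

/-! ### The half-order space, the time form and the energy estimate. -/

section HalfSpace

variable {d : ℕ} {Ω : Set (Sp d)} {T : ℝ} {y y' q p : Sp d × ℝ → ℝ} {σ ν : Sp d → ℝ} {C : ℝ}

lemma ae_volQ_of_ae {P : Sp d → Prop} (h : ∀ᵐ x ∂(volume.restrict Ω), P x) :
    ∀ᵐ z ∂(volQ Ω T), P z.1 := by
  rw [volQ_eq_prod]
  exact Measure.quasiMeasurePreserving_fst.ae h

lemma aestronglyMeasurable_volQ_fst (h : AEStronglyMeasurable σ (volume.restrict Ω)) :
    AEStronglyMeasurable (fun z : Sp d × ℝ => σ z.1) (volQ Ω T) := by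
  rw [volQ_eq_prod]
  exact h.comp_fst

lemma ae_coeff_add_mul (hT : 0 < T) (hy : MemLp y 2 (volQ Ω T)) (hy' : MemLp y' 2 (volQ Ω T))
    (c : ℝ) : ∀ᵐ x ∂(volume.restrict Ω), ∀ k,
      cosCoeff T k (fun z => y z + c * y' z) x = cosCoeff T k y x + c * cosCoeff T k y' x ∧
      sinCoeff T k (fun z => y z + c * y' z) x = sinCoeff T k y x + c * sinCoeff T k y' x := by
  filter_upwards [ae_memLp_time hy, ae_memLp_time hy'] with x h1 h2 k
  simp only [cosCoeff_eq, sinCoeff_eq]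
  rw [fc_add hT h1 (h2.const_mul c), fs_add hT h1 (h2.const_mul c), fc_const_mul, fs_const_mul]
  exact ⟨rfl, rfl⟩

lemma memLp_of_mem_H1half (hy : y ∈ H1halfZeroPer Ω T) : MemLp y 2 (volQ Ω T) := hy.1.1.1

lemma isH10Pair_add_mul (hb : Bornology.IsBounded Ω) (hy : y ∈ H10Zero Ω T) (hy' : y' ∈ H10Zero Ω T)
    (c : ℝ) : IsH10Pair Ω T (fun z => y z + c * y' z)
      (fun z => wGrad Ω T y z + c • wGrad Ω T y' z) :=
  (isH10Pair_wGrad hb hy).add hb ((isH10Pair_wGrad hb hy').smul c)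

lemma mem_H1half_add_mul (hΩ : IsOpen Ω) (hb : Bornology.IsBounded Ω) (hT : 0 < T)
    (hy : y ∈ H1halfZeroPer Ω T) (hy' : y' ∈ H1halfZeroPer Ω T) (c : ℝ) :
    (fun z => y z + c * y' z) ∈ H1halfZeroPer Ω T := by
  have hp := isH10Pair_add_mul hb hy.1 hy'.1 c
  have m1 := memLp_of_mem_H1half hy
  have m2 := memLp_of_mem_H1half hy'
  refine ⟨hp.mem_H10Zero hΩ hb, ?_⟩
  rw [halfSq_lt_top_iff hT hp.1]
  have s1 := (halfSq_lt_top_iff hT m1).1 hy.2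
  have s2 := (halfSq_lt_top_iff hT m2).1 hy'.2
  have hω := freq_pos hT
  refine Summable.of_nonneg_of_le (fun j => mul_nonneg (by positivity)
    (integral_nonneg fun x => coeffSq_nonneg j x)) (fun j => ?_)
    ((s1.mul_left 2).add (s2.mul_left (2 * c ^ 2)))
  have i1 := integrable_coeffSq hT m1 j
  have i2 := integrable_coeffSq hT m2 j
  have h1 : ∫ x in Ω, coeffSq T (fun z => y z + c * y' z) j x
      ≤ 2 * (∫ x in Ω, coeffSq T y j x) + 2 * c ^ 2 * ∫ x in Ω, coeffSq T y' j x := by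
    rw [← integral_const_mul, ← integral_const_mul,
      ← integral_add (i1.const_mul 2) (i2.const_mul (2 * c ^ 2))]
    refine integral_mono_ae (integrable_coeffSq hT hp.1 j)
      ((i1.const_mul 2).add (i2.const_mul (2 * c ^ 2))) ?_
    filter_upwards [ae_coeff_add_mul hT m1 m2 c] with x hx
    rw [coeffSq, (hx _).1, (hx _).2, coeffSq, coeffSq]
    nlinarith [sq_nonneg (cosCoeff T (j + 1) y x - c * cosCoeff T (j + 1) y' x),
      sq_nonneg (sinCoeff T (j + 1) y x - c * sinCoeff T (j + 1) y' x)]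
  refine (mul_le_mul_of_nonneg_left h1 (by positivity)).trans (le_of_eq (by ring))

lemma integrable_timeForm_term (hT : 0 < T) (hσm : AEStronglyMeasurable σ (volume.restrict Ω))
    (hσ : ∀ᵐ x ∂(volume.restrict Ω), |σ x| ≤ C) (hy : MemLp y 2 (volQ Ω T))
    (hq : MemLp q 2 (volQ Ω T)) (j : ℕ) :
    Integrable (fun x => σ x * (sinCoeff T (j + 1) y x * cosCoeff T (j + 1) q x
      - cosCoeff T (j + 1) y x * sinCoeff T (j + 1) q x)) (volume.restrict Ω) := by
  have := integrable_coeff_prod hσm hσ (memLp_sinCoeff hT hy j) (memLp_cosCoeff hT hq j)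
    (memLp_cosCoeff hT hy j).neg (memLp_sinCoeff hT hq j)
  refine this.congr (ae_of_all _ fun x => ?_)
  simp only [Pi.neg_apply]; ring

/-- Young's inequality splits each term into squared coefficients of `y` and of `q`; the weight `kω`
is the one that membership in the half-order space makes summable. -/
lemma summable_timeForm (hT : 0 < T)
    (hσ : ∀ᵐ x ∂(volume.restrict Ω), |σ x| ≤ C) (hy : y ∈ H1halfZeroPer Ω T)
    (hq : q ∈ H1halfZeroPer Ω T) :
    Summable fun j : ℕ => ((j + 1 : ℕ) : ℝ) * freq T *
      ∫ x in Ω, σ x * (sinCoeff T (j + 1) y x * cosCoeff T (j + 1) q x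
        - cosCoeff T (j + 1) y x * sinCoeff T (j + 1) q x) := by
  have m1 := memLp_of_mem_H1half hy
  have m2 := memLp_of_mem_H1half hq
  have s1 := (halfSq_lt_top_iff hT m1).1 hy.2
  have s2 := (halfSq_lt_top_iff hT m2).1 hq.2
  have hω := freq_pos hT
  refine Summable.of_norm_bounded ((s1.add s2).mul_left (C / 2)) fun j => ?_
  have h1 := integral_norm_coeff_prod_le hσ (memLp_sinCoeff hT m1 j) (memLp_cosCoeff hT m2 j)
    (memLp_cosCoeff hT m1 j).neg (memLp_sinCoeff hT m2 j)
  have e1 : ∫ x in Ω, (sinCoeff T (j + 1) y x ^ 2 + (-cosCoeff T (j + 1) y) x ^ 2)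
      = ∫ x in Ω, coeffSq T y j x :=
    integral_congr_ae (ae_of_all _ fun x => by simp only [Pi.neg_apply, coeffSq]; ring)
  have e2 : ∫ x in Ω, (cosCoeff T (j + 1) q x ^ 2 + sinCoeff T (j + 1) q x ^ 2)
      = ∫ x in Ω, coeffSq T q j x := rfl
  rw [e1, e2] at h1
  rw [norm_mul, Real.norm_of_nonneg (by positivity : 0 ≤ ((j + 1 : ℕ) : ℝ) * freq T)]
  have h2 : ‖∫ x in Ω, σ x * (sinCoeff T (j + 1) y x * cosCoeff T (j + 1) q x
        - cosCoeff T (j + 1) y x * sinCoeff T (j + 1) q x)‖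
      ≤ C / 2 * ((∫ x in Ω, coeffSq T y j x) + ∫ x in Ω, coeffSq T q j x) := by
    refine (norm_integral_le_integral_norm _).trans (le_trans (le_of_eq ?_) h1)
    refine integral_congr_ae (ae_of_all _ fun x => ?_)
    simp only [Pi.neg_apply]
    congr 1; ring
  refine (mul_le_mul_of_nonneg_left h2 (by positivity)).trans (le_of_eq (by ring))

/-- A `tsum` is additive only for convergent series; this is why all three functions are taken from
the half-order space. -/
lemma timeForm_add_mul (hT : 0 < T) (hσm : AEStronglyMeasurable σ (volume.restrict Ω))
    (hσ : ∀ᵐ x ∂(volume.restrict Ω), |σ x| ≤ C) (hy : y ∈ H1halfZeroPer Ω T)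
    (hy' : y' ∈ H1halfZeroPer Ω T) (hq : q ∈ H1halfZeroPer Ω T) (c : ℝ) :
    timeForm Ω T σ (fun z => y z + c * y' z) q = timeForm Ω T σ y q + c * timeForm Ω T σ y' q := by
  have m1 := memLp_of_mem_H1half hy
  have m1' := memLp_of_mem_H1half hy'
  have m2 := memLp_of_mem_H1half hq
  have s1 := summable_timeForm hT hσ hy hq
  have s2 := summable_timeForm hT hσ hy' hq
  unfold timeForm
  rw [mul_left_comm c, ← mul_add, ← tsum_mul_left (a := c), ← s1.tsum_add (s2.mul_left c)]
  congr 1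
  refine tsum_congr fun j => ?_
  have i1 := integrable_timeForm_term hT hσm hσ m1 m2 j
  have i2 := integrable_timeForm_term hT hσm hσ m1' m2 j
  rw [mul_left_comm c, ← mul_add, ← integral_const_mul c, ← integral_add i1 (i2.const_mul c)]
  congr 1
  refine integral_congr_ae ?_
  filter_upwards [ae_coeff_add_mul hT m1 m1' c] with x hx
  simp only [(hx _).1, (hx _).2]; ring

/-- The sign changes term by term, so neither summability nor integrability is needed. This removes
the time form from energy estimates and links the state equation with the adjoint equation. -/
lemma timeForm_antisymm (y q : Sp d × ℝ → ℝ) : timeForm Ω T σ y q = -timeForm Ω T σ q y := by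
  unfold timeForm
  rw [← mul_neg, ← tsum_neg]
  congr 1
  refine tsum_congr fun j => ?_
  rw [← mul_neg, ← integral_neg]
  congr 1
  refine integral_congr_ae (ae_of_all _ fun x => ?_)
  simp only; ring

lemma timeForm_self (y : Sp d × ℝ → ℝ) : timeForm Ω T σ y y = 0 := by
  linarith [timeForm_antisymm (Ω := Ω) (T := T) (σ := σ) y y]

variable {g g' h : Sp d × ℝ → Sp d}

lemma memLp_coeff_smul (hνm : AEStronglyMeasurable ν (volume.restrict Ω))
    (hν : ∀ᵐ x ∂(volume.restrict Ω), |ν x| ≤ C) (hg : MemLp g 2 (volQ Ω T)) :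
    MemLp (fun z => ν z.1 • g z) 2 (volQ Ω T) :=
  memLp_smul_bdd (aestronglyMeasurable_volQ_fst hνm) (ae_volQ_of_ae hν) hg

lemma memLp_coeff_mul (hσm : AEStronglyMeasurable σ (volume.restrict Ω))
    (hσ : ∀ᵐ x ∂(volume.restrict Ω), |σ x| ≤ C) (hy : MemLp y 2 (volQ Ω T)) :
    MemLp (fun z => σ z.1 * y z) 2 (volQ Ω T) :=
  memLp_mul_bdd (aestronglyMeasurable_volQ_fst hσm) (ae_volQ_of_ae hσ) hy

lemma integrable_coeff_inner (hνm : AEStronglyMeasurable ν (volume.restrict Ω))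
    (hν : ∀ᵐ x ∂(volume.restrict Ω), |ν x| ≤ C) (hg : MemLp g 2 (volQ Ω T))
    (hh : MemLp h 2 (volQ Ω T)) :
    Integrable (fun z => ν z.1 * inner ℝ (g z) (h z)) (volQ Ω T) := by
  simpa only [real_inner_smul_left] using integrable_inner (memLp_coeff_smul hνm hν hg) hh

lemma coercive_coeff {ν₀ : ℝ} (hνm : AEStronglyMeasurable ν (volume.restrict Ω))
    (hν : ∀ᵐ x ∂(volume.restrict Ω), |ν x| ≤ C) (hν₀ : ∀ᵐ x ∂(volume.restrict Ω), ν₀ ≤ ν x)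
    (hg : MemLp g 2 (volQ Ω T)) :
    ν₀ * l2 (volQ Ω T) g ^ 2 ≤ ∫ z, ν z.1 * inner ℝ (g z) (g z) ∂(volQ Ω T) := by
  rw [sq_l2 hg, ← integral_const_mul]
  refine integral_mono_ae ((integrable_inner hg hg).const_mul _)
    (integrable_coeff_inner hνm hν hg hg) ?_
  filter_upwards [ae_volQ_of_ae hν₀] with z hz
  exact mul_le_mul_of_nonneg_right hz real_inner_self_nonneg

lemma coercive_coeff_mul {σ₀ : ℝ} (hσm : AEStronglyMeasurable σ (volume.restrict Ω))
    (hσ : ∀ᵐ x ∂(volume.restrict Ω), |σ x| ≤ C) (hσ₀ : ∀ᵐ x ∂(volume.restrict Ω), σ₀ ≤ σ x)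
    (hy : MemLp y 2 (volQ Ω T)) :
    σ₀ * l2 (volQ Ω T) y ^ 2 ≤ ∫ z, σ z.1 * y z * y z ∂(volQ Ω T) := by
  rw [sq_l2' hy, ← integral_const_mul]
  refine integral_mono_ae (hy.integrable_sq.const_mul _)
    (integrable_mul_l2 (memLp_coeff_mul hσm hσ hy) hy) ?_
  filter_upwards [ae_volQ_of_ae hσ₀] with z hz
  simp only [mul_assoc, ← pow_two]
  exact mul_le_mul_of_nonneg_right hz (sq_nonneg _)

variable {v v' : Sp d × ℝ → ℝ}

lemma memLp_wGrad (hy : y ∈ H10Zero Ω T) : MemLp (wGrad Ω T y) 2 (volQ Ω T) := by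
  obtain ⟨g, hg⟩ := hy.1.2
  exact hg.wGrad.1

lemma wGrad_add_mul (hΩ : IsOpen Ω) (hb : Bornology.IsBounded Ω) (hy : y ∈ H10Zero Ω T)
    (hy' : y' ∈ H10Zero Ω T) (c : ℝ) : wGrad Ω T (fun z => y z + c * y' z)
      =ᵐ[volQ Ω T] fun z => wGrad Ω T y z + c • wGrad Ω T y' z :=
  (isH10Pair_add_mul hb hy hy' c).wGrad_ae_eq hΩ hb

lemma IsState.add_mul (hΩ : IsOpen Ω) (hb : Bornology.IsBounded Ω) (hT : 0 < T)
    (hσm : AEStronglyMeasurable σ (volume.restrict Ω))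
    (hσ : ∀ᵐ x ∂(volume.restrict Ω), |σ x| ≤ C)
    (hνm : AEStronglyMeasurable ν (volume.restrict Ω)) {C' : ℝ}
    (hν : ∀ᵐ x ∂(volume.restrict Ω), |ν x| ≤ C') (hv : MemLp v 2 (volQ Ω T))
    (hv' : MemLp v' 2 (volQ Ω T)) (hy : IsState Ω T σ ν v y) (hy' : IsState Ω T σ ν v' y') (c : ℝ) :
    IsState Ω T σ ν (fun z => v z + c * v' z) (fun z => y z + c * y' z) := by
  refine ⟨mem_H1half_add_mul hΩ hb hT hy.1 hy'.1 c, fun q hq => ?_⟩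
  rw [timeForm_add_mul hT hσm hσ hy.1 hy'.1 hq]
  have hgq := memLp_wGrad hq.1
  have e1 : ∫ z, ν z.1 * inner ℝ (wGrad Ω T (fun z => y z + c * y' z) z) (wGrad Ω T q z) ∂(volQ Ω T)
      = (∫ z, ν z.1 * inner ℝ (wGrad Ω T y z) (wGrad Ω T q z) ∂(volQ Ω T))
        + c * ∫ z, ν z.1 * inner ℝ (wGrad Ω T y' z) (wGrad Ω T q z) ∂(volQ Ω T) := by
    rw [← integral_const_mul, ← integral_add (integrable_coeff_inner hνm hν (memLp_wGrad hy.1.1) hgq)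
      ((integrable_coeff_inner hνm hν (memLp_wGrad hy'.1.1) hgq).const_mul c)]
    refine integral_congr_ae ?_
    filter_upwards [wGrad_add_mul hΩ hb hy.1.1 hy'.1.1 c] with z hz
    rw [hz, inner_add_left, real_inner_smul_left]; ring
  have e2 : ∫ z, (v z + c * v' z) * q z ∂(volQ Ω T)
      = (∫ z, v z * q z ∂(volQ Ω T)) + c * ∫ z, v' z * q z ∂(volQ Ω T) := by
    have mq := memLp_of_mem_H1half hq
    rw [← integral_const_mul, ← integral_add (integrable_mul_l2 hv mq)
      ((integrable_mul_l2 hv' mq).const_mul c)]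
    exact integral_congr_ae (ae_of_all _ fun z => by ring)
  rw [e1, e2, ← hy.2 q hq, ← hy'.2 q hq]; ring

/-- The energy estimate for states. -/
lemma IsState.energy {ν₀ : ℝ} (hνm : AEStronglyMeasurable ν (volume.restrict Ω))
    (hν : ∀ᵐ x ∂(volume.restrict Ω), |ν x| ≤ C) (hν₀ : ∀ᵐ x ∂(volume.restrict Ω), ν₀ ≤ ν x)
    (hy : IsState Ω T σ ν v y) :
    ν₀ * l2 (volQ Ω T) (wGrad Ω T y) ^ 2 ≤ ∫ z, v z * y z ∂(volQ Ω T) := by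
  have h := hy.2 y hy.1
  rw [timeForm_self, add_zero] at h
  rw [← h]
  exact coercive_coeff hνm hν hν₀ (memLp_wGrad hy.1.1)

/-- In the energy estimate, Cauchy–Schwarz and Friedrichs bound the right side by `C_F ‖v‖ ‖∇y‖`,
and one factor `‖∇y‖` cancels. -/
lemma IsState.l2_wGrad_le (hΩ : IsOpen Ω) (hb : Bornology.IsBounded Ω) {ν₀ CF : ℝ}
    (hνm : AEStronglyMeasurable ν (volume.restrict Ω))
    (hν : ∀ᵐ x ∂(volume.restrict Ω), |ν x| ≤ C) (hν₀ : ∀ᵐ x ∂(volume.restrict Ω), ν₀ ≤ ν x)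
    (hν₀p : 0 < ν₀) (hCF : IsFriedrichsConstant Ω T CF) (hv : MemLp v 2 (volQ Ω T))
    (hy : IsState Ω T σ ν v y) :
    l2 (volQ Ω T) (wGrad Ω T y) ≤ CF / ν₀ * l2 (volQ Ω T) v := by
  have h1 := hy.energy hνm hν hν₀
  have h2 := (le_abs_self _).trans (abs_integral_mul_le hv (memLp_of_mem_H1half hy.1))
  have h3 := hCF.l2_le hΩ hb (isH10Pair_wGrad hb hy.1.1)
  have h4 := mul_le_mul_of_nonneg_left h3 (l2_nonneg (μ := volQ Ω T) v)
  rw [div_mul_eq_mul_div, le_div_iff₀ hν₀p]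
  rcases (l2_nonneg (μ := volQ Ω T) (wGrad Ω T y)).eq_or_lt with h0 | h0
  · rw [← h0, zero_mul]; exact mul_nonneg hCF.1.le (l2_nonneg _)
  · refine le_of_mul_le_mul_right ?_ h0
    nlinarith

/-- Uniqueness of the state. -/
lemma IsState.unique (hΩ : IsOpen Ω) (hb : Bornology.IsBounded Ω) (hT : 0 < T)
    (hσm : AEStronglyMeasurable σ (volume.restrict Ω))
    (hσ : ∀ᵐ x ∂(volume.restrict Ω), |σ x| ≤ C)
    (hνm : AEStronglyMeasurable ν (volume.restrict Ω)) {C' ν₀ CF : ℝ}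
    (hν : ∀ᵐ x ∂(volume.restrict Ω), |ν x| ≤ C') (hν₀ : ∀ᵐ x ∂(volume.restrict Ω), ν₀ ≤ ν x)
    (hν₀p : 0 < ν₀) (hCF : IsFriedrichsConstant Ω T CF) (hv : MemLp v 2 (volQ Ω T))
    (hy : IsState Ω T σ ν v y) (hy' : IsState Ω T σ ν v y') : y =ᵐ[volQ Ω T] y' := by
  have hs := hy.add_mul hΩ hb hT hσm hσ hνm hν hv hv hy' (-1)
  have hm : MemLp (fun z => v z + -1 * v z) 2 (volQ Ω T) := hv.add (hv.const_mul (-1))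
  have h1 := hs.l2_wGrad_le hΩ hb hνm hν hν₀ hν₀p hCF hm
  have h0 : l2 (volQ Ω T) (fun z => v z + -1 * v z) = 0 := by
    simp [l2]
  rw [h0, mul_zero] at h1
  have h2 := hCF.l2_le hΩ hb (isH10Pair_wGrad hb hs.1.1)
  have h3 : l2 (volQ Ω T) (fun z => y z + -1 * y' z) = 0 := by
    refine le_antisymm (h2.trans ?_) (l2_nonneg _)
    exact mul_nonpos_of_nonneg_of_nonpos hCF.1.le h1
  filter_upwards [eq_zero_of_l2_eq_zero (memLp_of_mem_H1half hs.1) h3] with z hz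
  simp only [Pi.zero_apply] at hz
  linarith

end HalfSpace

/-! ### Lions' projection lemma. -/

section Lions

variable {Φ H : Type*} [AddCommGroup Φ] [Module ℝ Φ] [NormedAddCommGroup H] [InnerProductSpace ℝ H]
  [CompleteSpace H]

/-- The bound makes `L` a bounded functional of `K q` on the range of `K`, which need not be closed.
Hahn–Banach extends it and the Riesz representation theorem supplies `y`. -/
lemma exists_inner_eq_of_bound (K : Φ →ₗ[ℝ] H) (L : Φ →ₗ[ℝ] ℝ) (C : ℝ)
    (h : ∀ q, |L q| ≤ C * ‖K q‖) : ∃ y : H, ∀ q, inner ℝ y (K q) = L q := by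
  obtain ⟨s, hs⟩ := K.rangeRestrict.exists_rightInverse_of_surjective K.range_rangeRestrict
  have hs' : ∀ x, K (s x) = x := fun x => congrArg Subtype.val (LinearMap.congr_fun hs x)
  let l : StrongDual ℝ K.range := (L ∘ₗ s).mkContinuous C fun x => by
    have := h (s x)
    rwa [hs'] at this
  obtain ⟨m, hm, -⟩ := exists_extension_norm_eq K.range l
  refine ⟨(InnerProductSpace.toDual ℝ H).symm m, fun q => ?_⟩
  rw [InnerProductSpace.toDual_symm_apply]
  have h1 := hm ⟨K q, LinearMap.mem_range_self K q⟩
  rw [h1]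
  change L (s ⟨K q, _⟩) = L q
  -- The bound forces `L` to vanish on the kernel of `K`, so the value does not depend on the
  -- section `s`.
  have h2 := h (s ⟨K q, LinearMap.mem_range_self K q⟩ - q)
  rw [map_sub K, hs', sub_self, norm_zero, mul_zero, map_sub] at h2
  exact sub_eq_zero.1 (abs_nonpos_iff.1 h2)

/-- Lions' projection lemma. -/
lemma exists_lions (J K : Φ →ₗ[ℝ] H) (L : Φ →ₗ[ℝ] ℝ) {c C : ℝ} (hc : 0 < c) (hC : 0 ≤ C)
    (hJK : ∀ q, c * ‖J q‖ ^ 2 ≤ inner ℝ (J q) (K q)) (hL : ∀ q, |L q| ≤ C * ‖J q‖) :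
    ∃ y ∈ closure (range J), ∀ q, inner ℝ y (K q) = L q := by
  let M : Submodule ℝ H := J.range.topologicalClosure
  have hMc : IsClosed (M : Set H) := Submodule.isClosed_topologicalClosure _
  have : CompleteSpace M := hMc.completeSpace_coe
  -- Replacing `K` by its projection onto the closure of the range of `J` places the solution in
  -- that closure; the inner products with `J q` do not change, so coercivity survives.
  let P : H →L[ℝ] M := M.orthogonalProjectionOnto
  have hmem : ∀ q, J q ∈ M := fun q => Submodule.le_topologicalClosure _ (LinearMap.mem_range_self J q)
  have hP : ∀ (y : M) (x : H), inner ℝ y (P x) = inner ℝ (y : H) x := fun y x =>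
    Submodule.inner_orthogonalProjectionOnto_eq_of_mem_left y x
  obtain ⟨y, hy⟩ := exists_inner_eq_of_bound (P.toLinearMap ∘ₗ K) L (C / c) fun q => by
    have h1 : c * ‖J q‖ ^ 2 ≤ ‖J q‖ * ‖P (K q)‖ := by
      refine (hJK q).trans ?_
      rw [← hP ⟨J q, hmem q⟩ (K q)]
      exact real_inner_le_norm _ _
    have h2 : c * ‖J q‖ ≤ ‖P (K q)‖ := by
      rcases (norm_nonneg (J q)).eq_or_lt with h0 | h0
      · rw [← h0, mul_zero]; exact norm_nonneg _
      · refine le_of_mul_le_mul_right ?_ h0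
        nlinarith
    refine (hL q).trans ?_
    rw [div_mul_eq_mul_div, le_div_iff₀ hc]
    change C * ‖J q‖ * c ≤ C * ‖P (K q)‖
    nlinarith
  refine ⟨y, ?_, fun q => ?_⟩
  · have := y.2
    rwa [← SetLike.mem_coe, Submodule.topologicalClosure_coe] at this
  · rw [← hy q, LinearMap.comp_apply, ← hP]; rfl

end Lions

/-! ### Linear maps into `L²` and into Hilbert sums. -/

section LpLinear

variable {Φ X E : Type*} [AddCommGroup Φ] [Module ℝ Φ] [MeasurableSpace X] {μ : Measure X}
  [NormedAddCommGroup E] [InnerProductSpace ℝ E]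

/-- The linear map to `L²` given by a linear family of square integrable functions. -/
def lpLin (μ : Measure X) (f : Φ → X → E) (hf : ∀ q, MemLp (f q) 2 μ)
    (hadd : ∀ q q' x, f (q + q') x = f q x + f q' x) (hsmul : ∀ (c : ℝ) q x, f (c • q) x = c • f q x) :
    Φ →ₗ[ℝ] Lp E 2 μ where
  toFun q := (hf q).toLp (f q)
  map_add' q q' := by
    rw [← MemLp.toLp_add]
    exact MemLp.toLp_congr _ _ (ae_of_all _ fun x => hadd q q' x)
  map_smul' c q := by
    rw [RingHom.id_apply, ← MemLp.toLp_const_smul]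
    exact MemLp.toLp_congr _ _ (ae_of_all _ fun x => hsmul c q x)

/-- Pairing of two linear maps into the Hilbert sum. -/
def pairLin {A B : Type*} [NormedAddCommGroup A] [InnerProductSpace ℝ A] [NormedAddCommGroup B]
    [InnerProductSpace ℝ B] (a : Φ →ₗ[ℝ] A) (b : Φ →ₗ[ℝ] B) : Φ →ₗ[ℝ] WithLp 2 (A × B) :=
  (WithLp.linearEquiv 2 ℝ (A × B)).symm.toLinearMap ∘ₗ a.prod b

end LpLinear

/-! ### Smooth periodic functions and vanishing integrals over a period. -/

section Periodic

variable {d : ℕ} {Ω : Set (Sp d)} {T : ℝ}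

/-- Functions in `smoothLat` that are `T`-periodic in time. -/
def perLat (Ω : Set (Sp d)) (T : ℝ) : Submodule ℝ (Sp d × ℝ → ℝ) :=
  smoothLat Ω ⊓
  { carrier := {φ | ∀ x t, φ (x, t + T) = φ (x, t)}
    add_mem' := fun h h' x t => by simp [h x t, h' x t]
    zero_mem' := fun _ _ => rfl
    smul_mem' := fun c φ h x t => by simp [h x t] }

lemma perLat_period {φ : Sp d × ℝ → ℝ} (h : φ ∈ perLat Ω T) (x : Sp d) : φ (x, T) = φ (x, 0) := by
  have := h.2 x 0
  rwa [zero_add] at this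

lemma perLat_spaceGrad_period {φ : Sp d × ℝ → ℝ} (h : φ ∈ perLat Ω T) (x : Sp d) :
    spaceGrad φ (x, T) = spaceGrad φ (x, 0) := by
  simp only [spaceGrad]
  congr 1
  exact funext fun s => perLat_period h s

/-- The integrand is half the derivative of `‖f‖²`, which takes the same value at both ends. -/
lemma integral_inner_deriv_period {E : Type*} [NormedAddCommGroup E] [InnerProductSpace ℝ E]
    (hT : 0 < T) {f f' : ℝ → E} (hf : ∀ t, HasDerivAt f (f' t) t) (hf' : Continuous f')
    (hp : f T = f 0) : ∫ t in Ioo 0 T, inner ℝ (f t) (f' t) = 0 := by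
  have hfc : Continuous f := continuous_iff_continuousAt.2 fun t => (hf t).continuousAt
  have h1 : ∀ t, HasDerivAt (fun t => inner ℝ (f t) (f t)) (2 * inner ℝ (f t) (f' t)) t := fun t => by
    have := (hf t).inner ℝ (hf t)
    rwa [real_inner_comm (f t) (f' t), ← two_mul] at this
  have h2 := intervalIntegral.integral_eq_sub_of_hasDerivAt (a := 0) (b := T) (fun t _ => h1 t)
    ((continuous_const.mul (hfc.inner hf')).intervalIntegrable _ _)
  rw [hp, sub_self, intervalIntegral.integral_const_mul, intervalIntegral_eq_Ioo hT] at h2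
  linarith

/-- The coefficient depends on `x` alone and leaves the time integral. These are the cross terms
that disappear from the coercivity estimate. -/
lemma integral_coeff_inner_period {E : Type*} [NormedAddCommGroup E] [InnerProductSpace ℝ E]
    (hT : 0 < T) {ν : Sp d → ℝ} {f f' : Sp d × ℝ → E}
    (hi : Integrable (fun z => ν z.1 * inner ℝ (f z) (f' z)) (volQ Ω T))
    (hf : ∀ x t, HasDerivAt (fun t => f (x, t)) (f' (x, t)) t) (hf' : Continuous f')
    (hp : ∀ x, f (x, T) = f (x, 0)) :
    ∫ z, ν z.1 * inner ℝ (f z) (f' z) ∂(volQ Ω T) = 0 := by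
  rw [integral_volQ_space_time hi]
  refine (integral_congr_ae (g := fun _ => (0 : ℝ)) (ae_of_all _ fun x => ?_)).trans (by simp)
  simp only
  rw [integral_const_mul, integral_inner_deriv_period hT (hf x) (hf'.comp (by fun_prop)) (hp x),
    mul_zero]

end Periodic

/-! ### A solution of the equation tested with `ψ + ∂ₜψ`. -/

section Existence

variable {d : ℕ} {Ω : Set (Sp d)} {T : ℝ} {σ ν : Sp d → ℝ} {C C' σ₀ ν₀ : ℝ} {v : Sp d × ℝ → ℝ}

/-- Existence of a weak solution with square integrable time derivative, as a limit of smooth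
periodic functions. -/
lemma exists_solution_limit (hd : 0 < d) (hΩ : IsOpen Ω) (hb : Bornology.IsBounded Ω) (hT : 0 < T)
    (hσm : AEStronglyMeasurable σ (volume.restrict Ω))
    (hσ : ∀ᵐ x ∂(volume.restrict Ω), |σ x| ≤ C) (hσ₀ : ∀ᵐ x ∂(volume.restrict Ω), σ₀ ≤ σ x)
    (hνm : AEStronglyMeasurable ν (volume.restrict Ω))
    (hν : ∀ᵐ x ∂(volume.restrict Ω), |ν x| ≤ C') (hν₀ : ∀ᵐ x ∂(volume.restrict Ω), ν₀ ≤ ν x)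
    (hσ₀p : 0 < σ₀) (hν₀p : 0 < ν₀) (hv : MemLp v 2 (volQ Ω T)) :
    ∃ (y w : Sp d × ℝ → ℝ) (g : Sp d × ℝ → Sp d) (q : ℕ → Sp d × ℝ → ℝ),
      MemLp y 2 (volQ Ω T) ∧ MemLp w 2 (volQ Ω T) ∧ MemLp g 2 (volQ Ω T) ∧
      (∀ n, q n ∈ perLat Ω T) ∧
      Tendsto (fun n => l2 (volQ Ω T) (fun z => y z - q n z)) atTop (𝓝 0) ∧
      Tendsto (fun n => l2 (volQ Ω T) (fun z => w z - timeDeriv (q n) z)) atTop (𝓝 0) ∧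
      Tendsto (fun n => l2 (volQ Ω T) (fun z => g z - spaceGrad (q n) z)) atTop (𝓝 0) ∧
      ∀ ψ ∈ perLat Ω T,
        (∫ z, inner ℝ (ν z.1 • g z) (spaceGrad (ψ + timeDeriv ψ) z) ∂(volQ Ω T))
          + ∫ z, (σ z.1 * w z - v z) * (ψ + timeDeriv ψ) z ∂(volQ Ω T) = 0 := by
  obtain ⟨CF, hCF, hF, -⟩ := exists_friedrichs hd hΩ hb T
  have sm : ∀ q : perLat Ω T, ContDiff ℝ ∞ (q : Sp d × ℝ → ℝ) := fun q => q.2.1.1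
  have smt : ∀ q : perLat Ω T, ContDiff ℝ ∞ (timeDeriv (q : Sp d × ℝ → ℝ)) := fun q =>
    contDiff_timeDeriv (sm q)
  have sms : ∀ q : perLat Ω T, ContDiff ℝ ∞ ((q : Sp d × ℝ → ℝ) + timeDeriv (q : Sp d × ℝ → ℝ)) :=
    fun q => (sm q).add (smt q)
  have tadd : ∀ q q' : perLat Ω T, timeDeriv ((q + q' : perLat Ω T) : Sp d × ℝ → ℝ)
      = timeDeriv (q : Sp d × ℝ → ℝ) + timeDeriv (q' : Sp d × ℝ → ℝ) := fun q q' =>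
    funext fun z => timeDeriv_add (sm q) (sm q') z
  have tsmul : ∀ (c : ℝ) (q : perLat Ω T), timeDeriv ((c • q : perLat Ω T) : Sp d × ℝ → ℝ)
      = c • timeDeriv (q : Sp d × ℝ → ℝ) := fun c q => funext fun z => timeDeriv_smul (sm q) c z
  have hsadd : ∀ q q' : perLat Ω T, ((q + q' : perLat Ω T) : Sp d × ℝ → ℝ)
      + timeDeriv ((q + q' : perLat Ω T) : Sp d × ℝ → ℝ)
      = ((q : Sp d × ℝ → ℝ) + timeDeriv (q : Sp d × ℝ → ℝ))
        + ((q' : Sp d × ℝ → ℝ) + timeDeriv (q' : Sp d × ℝ → ℝ)) := fun q q' => by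
    rw [tadd, Submodule.coe_add]; abel
  have hssmul : ∀ (c : ℝ) (q : perLat Ω T), ((c • q : perLat Ω T) : Sp d × ℝ → ℝ)
      + timeDeriv ((c • q : perLat Ω T) : Sp d × ℝ → ℝ)
      = c • ((q : Sp d × ℝ → ℝ) + timeDeriv (q : Sp d × ℝ → ℝ)) := fun c q => by
    rw [tsmul, Submodule.coe_smul, smul_add]
  -- The data for Lions' lemma: `J q = (∇q, ∂ₜq)`, `K q = (ν ∇(q + ∂ₜq), σ (q + ∂ₜq))` and `L q = ∫
  -- v (q + ∂ₜq)`.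
  let jg : perLat Ω T →ₗ[ℝ] Lp (Sp d) 2 (volQ Ω T) := lpLin (volQ Ω T) (fun q => spaceGrad (q : Sp d × ℝ → ℝ))
    (fun q => memLp_spaceGrad hb (sm q)) (fun q q' z => spaceGrad_add (sm q) (sm q') z)
    (fun c q z => spaceGrad_smul (sm q) c z)
  let jt : perLat Ω T →ₗ[ℝ] Lp ℝ 2 (volQ Ω T) := lpLin (volQ Ω T) (fun q => timeDeriv (q : Sp d × ℝ → ℝ))
    (fun q => memLp_timeDeriv hb (sm q)) (fun q q' z => timeDeriv_add (sm q) (sm q') z)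
    (fun c q z => timeDeriv_smul (sm q) c z)
  let j0 : perLat Ω T →ₗ[ℝ] Lp ℝ 2 (volQ Ω T) := lpLin (volQ Ω T) (fun q => (q : Sp d × ℝ → ℝ))
    (fun q => memLp_test hb (sm q)) (fun q q' z => rfl) (fun c q z => rfl)
  let kg : perLat Ω T →ₗ[ℝ] Lp (Sp d) 2 (volQ Ω T) := lpLin (volQ Ω T)
    (fun q z => ν z.1 • spaceGrad ((q : Sp d × ℝ → ℝ) + timeDeriv (q : Sp d × ℝ → ℝ)) z)
    (fun q => memLp_coeff_smul hνm hν (memLp_spaceGrad hb (sms q)))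
    (fun q q' z => by rw [hsadd, spaceGrad_add (sms q) (sms q'), smul_add])
    (fun c q z => by rw [hssmul, spaceGrad_smul (sms q), smul_comm])
  let kt : perLat Ω T →ₗ[ℝ] Lp ℝ 2 (volQ Ω T) := lpLin (volQ Ω T)
    (fun q z => σ z.1 * ((q : Sp d × ℝ → ℝ) + timeDeriv (q : Sp d × ℝ → ℝ)) z)
    (fun q => memLp_coeff_mul hσm hσ (memLp_test hb (sms q)))
    (fun q q' z => by rw [hsadd, Pi.add_apply, mul_add])
    (fun c q z => by rw [hssmul, Pi.smul_apply, smul_eq_mul, smul_eq_mul]; ring)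
  let L : perLat Ω T →ₗ[ℝ] ℝ := (innerSL ℝ (hv.toLp v)).toLinearMap ∘ₗ (j0 + jt)
  have hLq : ∀ q : perLat Ω T, L q
      = ∫ z, v z * ((q : Sp d × ℝ → ℝ) + timeDeriv (q : Sp d × ℝ → ℝ)) z ∂(volQ Ω T) := fun q => by
    change inner ℝ (hv.toLp v) ((memLp_test hb (sm q)).toLp (q : Sp d × ℝ → ℝ)
      + (memLp_timeDeriv hb (sm q)).toLp (timeDeriv (q : Sp d × ℝ → ℝ))) = _
    rw [← MemLp.toLp_add, inner_toLp]
    exact integral_congr_ae (ae_of_all _ fun z => by simp [mul_comm])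
  have hJn : ∀ q, ‖pairLin jg jt q‖ ^ 2 = ‖jg q‖ ^ 2 + ‖jt q‖ ^ 2 := fun q =>
    WithLp.prod_norm_sq_eq_of_L2 _
  have hj0 : ∀ q, ‖j0 q‖ ≤ CF * ‖jg q‖ := fun q => by
    change ‖(memLp_test hb (sm q)).toLp (q : Sp d × ℝ → ℝ)‖
      ≤ CF * ‖(memLp_spaceGrad hb (sm q)).toLp (spaceGrad (q : Sp d × ℝ → ℝ))‖
    rw [norm_toLp_eq_l2, norm_toLp_eq_l2]
    exact hF _ q.2.1
  have hcoer : ∀ q, min ν₀ σ₀ * ‖pairLin jg jt q‖ ^ 2 ≤ inner ℝ (pairLin jg jt q) (pairLin kg kt q) := by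
    intro q
    have mg := memLp_spaceGrad (Ω := Ω) (T := T) hb (sm q)
    have mgt := memLp_spaceGrad (Ω := Ω) (T := T) hb (smt q)
    have m0 := memLp_test (Ω := Ω) (T := T) hb (sm q)
    have mt := memLp_timeDeriv (Ω := Ω) (T := T) hb (sm q)
    have i1 := integrable_coeff_inner hνm hν mg mg
    have i2 := integrable_coeff_inner hνm hν mg mgt
    have i4 : Integrable (fun z => σ z.1 * inner ℝ ((q : Sp d × ℝ → ℝ) z) (timeDeriv (q : Sp d × ℝ → ℝ) z)) (volQ Ω T) := by
      have := integrable_mul_l2 (memLp_coeff_mul hσm hσ mt) m0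
      exact this.congr (ae_of_all _ fun z => by simp [mul_assoc])
    have i5 := integrable_mul_l2 (memLp_coeff_mul hσm hσ mt) mt
    -- The two cross terms vanish by periodicity, leaving the squares of `∇q` and `∂ₜq` with weights
    -- `ν` and `σ`.
    have z1 := integral_coeff_inner_period hT i2 (fun x t => hasDerivAt_spaceGrad (sm q) x t)
      (continuous_spaceGrad (smt q)) (fun x => perLat_spaceGrad_period q.2 x)
    have z2 := integral_coeff_inner_period hT i4
      (fun x t => hasDerivAt_timeDeriv (contDiff_differentiable (sm q)) x t)
      (smt q).continuous (fun x => perLat_period q.2 x)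
    have e1 : inner ℝ (jg q) (kg q)
        = ∫ z, ν z.1 * inner ℝ (spaceGrad (q : Sp d × ℝ → ℝ) z) (spaceGrad (q : Sp d × ℝ → ℝ) z) ∂(volQ Ω T) := by
      rw [← add_zero (∫ z, ν z.1 * inner ℝ (spaceGrad (q : Sp d × ℝ → ℝ) z)
        (spaceGrad (q : Sp d × ℝ → ℝ) z) ∂(volQ Ω T)), ← z1, ← integral_add i1 i2]
      refine (inner_toLp mg (memLp_coeff_smul hνm hν (memLp_spaceGrad hb (sms q)))).trans
        (integral_congr_ae (ae_of_all _ fun z => ?_))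
      simp only [spaceGrad_add (sm q) (smt q), real_inner_smul_right, inner_add_right]
      ring
    have e2 : inner ℝ (jt q) (kt q)
        = ∫ z, σ z.1 * timeDeriv (q : Sp d × ℝ → ℝ) z * timeDeriv (q : Sp d × ℝ → ℝ) z ∂(volQ Ω T) := by
      rw [← zero_add (∫ z, σ z.1 * timeDeriv (q : Sp d × ℝ → ℝ) z * timeDeriv (q : Sp d × ℝ → ℝ) z ∂(volQ Ω T)),
        ← z2, ← integral_add i4 i5]
      refine (inner_toLp mt (memLp_coeff_mul hσm hσ (memLp_test hb (sms q)))).trans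
        (integral_congr_ae (ae_of_all _ fun z => ?_))
      simp; ring
    have h1 := coercive_coeff hνm hν hν₀ mg
    have h2 := coercive_coeff_mul hσm hσ hσ₀ mt
    have e3 : inner ℝ (pairLin jg jt q) (pairLin kg kt q) = inner ℝ (jg q) (kg q) + inner ℝ (jt q) (kt q) :=
      WithLp.prod_inner_apply _ _
    have n1 : ‖jg q‖ = l2 (volQ Ω T) (spaceGrad (q : Sp d × ℝ → ℝ)) := norm_toLp_eq_l2 mg
    have n2 : ‖jt q‖ = l2 (volQ Ω T) (timeDeriv (q : Sp d × ℝ → ℝ)) := norm_toLp_eq_l2 mt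
    rw [e3, e1, e2, hJn, n1, n2, mul_add]
    refine add_le_add (le_trans ?_ h1) (le_trans ?_ h2)
    · exact mul_le_mul_of_nonneg_right (min_le_left _ _) (sq_nonneg _)
    · exact mul_le_mul_of_nonneg_right (min_le_right _ _) (sq_nonneg _)
  have hLb : ∀ q, |L q| ≤ (‖hv.toLp v‖ * (CF + 1)) * ‖pairLin jg jt q‖ := fun q => by
    have h1 : ‖jg q‖ ≤ ‖pairLin jg jt q‖ :=
      abs_le_of_sq_le_sq' (by rw [hJn]; nlinarith [sq_nonneg ‖jt q‖]) (norm_nonneg _) |>.2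
    have h2 : ‖jt q‖ ≤ ‖pairLin jg jt q‖ :=
      abs_le_of_sq_le_sq' (by rw [hJn]; nlinarith [sq_nonneg ‖jg q‖]) (norm_nonneg _) |>.2
    have h3 : |L q| ≤ ‖hv.toLp v‖ * ‖j0 q + jt q‖ :=
      abs_real_inner_le_norm (hv.toLp v) (j0 q + jt q)
    refine h3.trans ?_
    rw [mul_assoc]
    refine mul_le_mul_of_nonneg_left ((norm_add_le _ _).trans ?_) (norm_nonneg _)
    nlinarith [hj0 q]
  obtain ⟨Y, hYc, hY⟩ := exists_lions (pairLin jg jt) (pairLin kg kt) L (lt_min hν₀p hσ₀p)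
    (by positivity) hcoer hLb
  obtain ⟨s, hs, hsl⟩ := mem_closure_iff_seq_limit.1 hYc
  choose q hq using hs
  have hJl : Tendsto (fun n => pairLin jg jt (q n)) atTop (𝓝 Y) := hsl.congr fun n => (hq n).symm
  have hgl : Tendsto (fun n => jg (q n)) atTop (𝓝 Y.fst) :=
    ((WithLp.prod_continuous_ofLp 2 _ _).fst.tendsto Y).comp hJl
  have htl : Tendsto (fun n => jt (q n)) atTop (𝓝 Y.snd) :=
    ((WithLp.prod_continuous_ofLp 2 _ _).snd.tendsto Y).comp hJl
  have hlim : ∀ {E : Type} [NormedAddCommGroup E] (f : ℕ → Sp d × ℝ → E) (hf : ∀ n, MemLp (f n) 2 (volQ Ω T))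
      (G : Lp E 2 (volQ Ω T)), Tendsto (fun n => (hf n).toLp (f n)) atTop (𝓝 G) →
      Tendsto (fun n => l2 (volQ Ω T) (fun z => G z - f n z)) atTop (𝓝 0) := by
    intro E _ f hf G h
    have h := ((tendsto_const_nhds (x := G)).sub h).norm
    rw [sub_self, norm_zero] at h
    refine h.congr fun n => ?_
    rw [Lp.norm_def]
    refine congrArg _ (eLpNorm_congr_ae ?_)
    filter_upwards [Lp.coeFn_sub G ((hf n).toLp (f n)), (hf n).coeFn_toLp] with x h1 h2
    rw [h1, Pi.sub_apply, h2]
  -- The Hilbert space limit records only gradients and time derivatives; Friedrichs' inequality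
  -- makes the functions themselves converge.
  have hc0 : CauchySeq fun n => (memLp_test (Ω := Ω) (T := T) hb (sm (q n))).toLp
      (q n : Sp d × ℝ → ℝ) := by
    have hcg := hgl.cauchySeq
    rw [Metric.cauchySeq_iff] at hcg ⊢
    intro ε hε
    obtain ⟨N, hN⟩ := hcg (ε / CF) (by positivity)
    refine ⟨N, fun m hm n hn => ?_⟩
    have h1 := hN m hm n hn
    have h2 := hj0 (q m - q n)
    rw [map_sub, map_sub, ← dist_eq_norm, ← dist_eq_norm] at h2
    rw [lt_div_iff₀ hCF, mul_comm] at h1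
    exact h2.trans_lt h1
  obtain ⟨y, hy, hyl⟩ := exists_l2_limit _ hc0
  refine ⟨y, (Y.snd : Sp d × ℝ → ℝ), (Y.fst : Sp d × ℝ → Sp d), fun n => q n, hy, Lp.memLp _,
    Lp.memLp _, fun n => (q n).2, hyl,
    hlim (fun n => timeDeriv (q n : Sp d × ℝ → ℝ)) (fun n => memLp_timeDeriv hb (sm (q n))) Y.snd htl,
    hlim (fun n => spaceGrad (q n : Sp d × ℝ → ℝ)) (fun n => memLp_spaceGrad hb (sm (q n))) Y.fst hgl,
    fun ψ hψ => ?_⟩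
  have h1 := hY ⟨ψ, hψ⟩
  rw [hLq] at h1
  have e3 : inner ℝ Y (pairLin kg kt ⟨ψ, hψ⟩)
      = inner ℝ Y.fst (kg ⟨ψ, hψ⟩) + inner ℝ Y.snd (kt ⟨ψ, hψ⟩) := WithLp.prod_inner_apply _ _
  have hψs := sms ⟨ψ, hψ⟩
  have e4 : inner ℝ Y.fst (kg ⟨ψ, hψ⟩)
      = ∫ z, inner ℝ (ν z.1 • (Y.fst : Sp d × ℝ → Sp d) z) (spaceGrad (ψ + timeDeriv ψ) z) ∂(volQ Ω T) := by
    rw [L2.inner_def]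
    refine integral_congr_ae ?_
    filter_upwards [(memLp_coeff_smul hνm hν (memLp_spaceGrad (T := T) hb hψs)).coeFn_toLp] with z hz
    change inner ℝ _ (((memLp_coeff_smul hνm hν (memLp_spaceGrad (T := T) hb hψs)).toLp _ :
      Lp (Sp d) 2 (volQ Ω T)) z) = _
    rw [hz, real_inner_smul_left, real_inner_smul_right]
  have e5 : inner ℝ Y.snd (kt ⟨ψ, hψ⟩)
      = ∫ z, σ z.1 * (Y.snd : Sp d × ℝ → ℝ) z * (ψ + timeDeriv ψ) z ∂(volQ Ω T) := by
    rw [L2.inner_def]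
    refine integral_congr_ae ?_
    filter_upwards [(memLp_coeff_mul hσm hσ (memLp_test (T := T) hb hψs)).coeFn_toLp] with z hz
    change inner ℝ _ (((memLp_coeff_mul hσm hσ (memLp_test (T := T) hb hψs)).toLp _ :
      Lp ℝ 2 (volQ Ω T)) z) = _
    rw [hz]; simp; ring
  have e6 : ∫ z, (σ z.1 * (Y.snd : Sp d × ℝ → ℝ) z - v z) * (ψ + timeDeriv ψ) z ∂(volQ Ω T)
      = (∫ z, σ z.1 * (Y.snd : Sp d × ℝ → ℝ) z * (ψ + timeDeriv ψ) z ∂(volQ Ω T))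
        - ∫ z, v z * (ψ + timeDeriv ψ) z ∂(volQ Ω T) := by
    rw [← integral_sub (integrable_mul_l2 (memLp_coeff_mul hσm hσ (Lp.memLp Y.snd)) (memLp_test hb hψs))
      (integrable_mul_l2 hv (memLp_test hb hψs))]
    exact integral_congr_ae (ae_of_all _ fun z => by simp only [sub_mul])
  rw [e6, ← e4, ← e5, ← h1, e3]
  ring

end Existence

/-! ### Time traces and periodicity of limits. -/

section Trace

variable {d : ℕ} {Ω : Set (Sp d)} {T : ℝ}

/-- For every `s` one has `f(t)² ≤ f(s)² + ∫ |2 f f'| ≤ f(s)² + ∫ f² + ∫ f'²`; integrating over `s`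
in `(0,T)` gives the constants. -/
lemma sq_le_of_hasDerivAt (hT : 0 < T) {f f' : ℝ → ℝ} (hf : ∀ t, HasDerivAt f (f' t) t)
    (hf' : Continuous f') {t : ℝ} (ht : t ∈ Icc 0 T) :
    T * f t ^ 2 ≤ (1 + T) * (∫ s in Ioo 0 T, f s ^ 2) + T * ∫ s in Ioo 0 T, f' s ^ 2 := by
  have hfc : Continuous f := continuous_iff_continuousAt.2 fun t => (hf t).continuousAt
  have hi : ∀ {g : ℝ → ℝ}, Continuous g → IntegrableOn g (Ioo 0 T) := fun hg =>
    (hg.continuousOn.integrableOn_compact isCompact_Icc).mono_set Ioo_subset_Icc_self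
  have hi' : ∀ {g : ℝ → ℝ}, Continuous g → IntegrableOn g (Ioc 0 T) := fun hg =>
    (hg.continuousOn.integrableOn_compact isCompact_Icc).mono_set Ioc_subset_Icc_self
  have h1 : ∀ s, HasDerivAt (fun s => f s ^ 2) (2 * f s * f' s) s := fun s => by
    convert! (hf s).pow 2 using 1
    simp
  have i1 : IntegrableOn (fun s => f s ^ 2) (Ioo 0 T) := hi (hfc.pow 2)
  have i2 : IntegrableOn (fun s => f' s ^ 2) (Ioo 0 T) := hi (hf'.pow 2)
  set B := (∫ s in Ioo 0 T, f s ^ 2) + ∫ s in Ioo 0 T, f' s ^ 2 with hB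
  have h2 : ∀ s ∈ Ioo 0 T, f t ^ 2 ≤ f s ^ 2 + B := by
    intro s hs
    have e1 := intervalIntegral.integral_eq_sub_of_hasDerivAt (a := s) (b := t) (fun t _ => h1 t)
      (((continuous_const.mul hfc).mul hf').intervalIntegrable _ _)
    have e2 : ‖∫ r in s..t, 2 * f r * f' r‖ ≤ B := by
      refine (intervalIntegral.norm_integral_le_integral_norm_uIoc).trans ?_
      have e3 : ∫ r in uIoc s t, ‖2 * f r * f' r‖ ≤ ∫ r in Ioc 0 T, ‖2 * f r * f' r‖ := by
        refine setIntegral_mono_set (hi' ((continuous_const.mul hfc).mul hf').norm)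
          (ae_of_all _ fun _ => norm_nonneg _) (LE.le.eventuallyLE ?_)
        exact Ioc_subset_Ioc (le_min hs.1.le ht.1) (max_le hs.2.le ht.2)
      refine e3.trans ?_
      rw [hB, integral_Ioc_eq_integral_Ioo, ← integral_add i1 i2]
      refine integral_mono (hi ((continuous_const.mul hfc).mul hf').norm)
        (i1.add i2) fun r => ?_
      simp only [Real.norm_eq_abs]
      rw [abs_le]
      constructor <;> nlinarith [sq_nonneg (f r - f' r), sq_nonneg (f r + f' r)]
    have := (abs_le.1 e2).2
    rw [e1] at this
    linarith
  have h3 : ∫ s in Ioo 0 T, f t ^ 2 ≤ ∫ s in Ioo 0 T, (f s ^ 2 + B) :=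
    setIntegral_mono_on (hi continuous_const) (i1.add (hi continuous_const))
      measurableSet_Ioo h2
  rw [integral_add i1 (hi continuous_const), setIntegral_const, setIntegral_const,
    Real.volume_real_Ioo_of_le hT.le, sub_zero, smul_eq_mul, smul_eq_mul] at h3
  linarith

/-- The slice of a smooth function at time `t`, as an element of `L²(Ω)`. -/
def sliceLp (hb : Bornology.IsBounded Ω) {φ : Sp d × ℝ → ℝ} (hφ : ContDiff ℝ ∞ φ) (t : ℝ) :
    Lp ℝ 2 (volume.restrict Ω) :=
  (Continuous.memLp_restrict hb (f := fun x => φ (x, t))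
    (hφ.continuous.comp (by fun_prop))).toLp _

/-- A trace inequality uniform in `t`, from the one-dimensional bound integrated over `Ω`. It turns
convergence of functions and time derivatives in `L²(Q)` into uniform convergence of slices. -/
lemma norm_sliceLp_sq_le (hb : Bornology.IsBounded Ω) (hT : 0 < T) {φ : Sp d × ℝ → ℝ}
    (hφ : ContDiff ℝ ∞ φ) {t : ℝ} (ht : t ∈ Icc 0 T) :
    T * ‖sliceLp hb hφ t‖ ^ 2 ≤ (1 + T) * l2 (volQ Ω T) φ ^ 2 + T * l2 (volQ Ω T) (timeDeriv φ) ^ 2 := by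
  have m0 := memLp_test (T := T) hb hφ
  have mt := memLp_timeDeriv (T := T) hb hφ
  have ms : MemLp (fun x => φ (x, t)) 2 (volume.restrict Ω) := Continuous.memLp_restrict hb
    (hφ.continuous.comp (by fun_prop))
  rw [sliceLp, norm_toLp_eq_l2, sq_l2' ms, sq_l2' m0, sq_l2' mt,
    integral_volQ_space_time m0.integrable_sq, integral_volQ_space_time mt.integrable_sq,
    ← integral_const_mul, ← integral_const_mul, ← integral_const_mul]
  have i1 := (integrable_sq_time m0).const_mul (1 + T)
  have i2 := (integrable_sq_time mt).const_mul T
  rw [← integral_add i1 i2]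
  refine integral_mono (ms.integrable_sq.const_mul T) (i1.add i2) fun x => ?_
  exact sq_le_of_hasDerivAt hT (fun s => hasDerivAt_timeDeriv (contDiff_differentiable hφ) x s)
    ((contDiff_timeDeriv hφ).continuous.comp (by fun_prop)) ht

/-- The time derivative is bounded on the compact set `closure Ω × [0, T]`, so by the mean value
inequality the slices are even Lipschitz in time. -/
lemma continuousOn_sliceLp (hΩ : IsOpen Ω) (hb : Bornology.IsBounded Ω) {φ : Sp d × ℝ → ℝ}
    (hφ : ContDiff ℝ ∞ φ) : ContinuousOn (sliceLp hb hφ) (Icc 0 T) := by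
  have := isFiniteMeasure_restrict hb
  obtain ⟨M, hM⟩ := (hb.isCompact_closure.prod (isCompact_Icc (a := (0 : ℝ)) (b := T))).exists_bound_of_continuousOn
    (contDiff_timeDeriv hφ).continuous.continuousOn
  set A : ℝ := measureUnivNNReal (volume.restrict Ω) ^ (2 : ℝ≥0∞).toReal⁻¹ with hA
  have hA0 : 0 ≤ A := by positivity
  have hlip : ∀ s ∈ Icc 0 T, ∀ t ∈ Icc 0 T,
      ‖sliceLp hb hφ t - sliceLp hb hφ s‖ ≤ A * (|M| * ‖t - s‖) := by
    intro s hs t ht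
    rw [hA]
    refine Lp.norm_le_of_ae_bound (by positivity) ?_
    filter_upwards [Lp.coeFn_sub (sliceLp hb hφ t) (sliceLp hb hφ s), MemLp.coeFn_toLp
      (Continuous.memLp_restrict hb (f := fun x => φ (x, t)) (hφ.continuous.comp (by fun_prop))),
      MemLp.coeFn_toLp (Continuous.memLp_restrict hb (f := fun x => φ (x, s))
        (hφ.continuous.comp (by fun_prop))), ae_restrict_mem hΩ.measurableSet] with x h1 h2 h3 hx
    rw [h1, Pi.sub_apply, sliceLp, sliceLp, h2, h3]
    exact (convex_Icc 0 T).norm_image_sub_le_of_norm_hasDerivWithin_le (f := fun t => φ (x, t))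
      (fun r hr => (hasDerivAt_timeDeriv (contDiff_differentiable hφ) x r).hasDerivWithinAt)
      (fun r hr => (hM (x, r) ⟨subset_closure hx, hr⟩).trans (le_abs_self M)) hs ht
  refine LipschitzOnWith.continuousOn (K := ⟨A * |M|, by positivity⟩)
    (LipschitzOnWith.of_dist_le_mul fun t ht s hs => ?_)
  rw [dist_eq_norm, dist_eq_norm]
  exact (hlip s hs t ht).trans (le_of_eq (by rw [← mul_assoc]; rfl))

variable {y w : Sp d × ℝ → ℝ} {q : ℕ → Sp d × ℝ → ℝ}

/-- Limits of smooth periodic functions lie in `H^{0,1}_per(Q)`. -/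
lemma mem_H01per_of_tendsto (hΩ : IsOpen Ω) (hb : Bornology.IsBounded Ω) (hT : 0 < T)
    (hy : MemLp y 2 (volQ Ω T)) (hw : MemLp w 2 (volQ Ω T)) (hq : ∀ n, q n ∈ perLat Ω T)
    (h1 : Tendsto (fun n => l2 (volQ Ω T) (fun z => y z - q n z)) atTop (𝓝 0))
    (h2 : Tendsto (fun n => l2 (volQ Ω T) (fun z => w z - timeDeriv (q n) z)) atTop (𝓝 0)) :
    HasWeakTimeDeriv Ω T y w ∧ y ∈ H01per Ω T := by
  have hfin := isFiniteMeasure_restrict hb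
  have sm : ∀ n, ContDiff ℝ ∞ (q n) := fun n => (hq n).1.1
  have mq : ∀ n, MemLp (q n) 2 (volQ Ω T) := fun n => memLp_test hb (sm n)
  have mqt : ∀ n, MemLp (timeDeriv (q n)) 2 (volQ Ω T) := fun n => memLp_timeDeriv hb (sm n)
  have hwd : HasWeakTimeDeriv Ω T y w := hasWeakTimeDeriv_of_tendsto hb
    (fun n => hasWeakTimeDeriv_of_smooth hb hT (sm n)) mq hy hw h1 h2
  refine ⟨hwd, ⟨hy, w, hwd⟩, ?_⟩
  set ε : ℕ → ℝ := fun n => l2 (volQ Ω T) (fun z => y z - q n z)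
    + l2 (volQ Ω T) (fun z => w z - timeDeriv (q n) z) with hε
  have hε0 : Tendsto ε atTop (𝓝 0) := by simpa using h1.add h2
  -- Chosen so that `K² T = (1 + T) + T`, the sum of the two constants in the trace inequality.
  set K : ℝ := Real.sqrt ((1 + 2 * T) / T) with hK
  have hKp : 0 < K := Real.sqrt_pos.2 (by positivity)
  have hK2 : K ^ 2 * T = 1 + 2 * T := by
    rw [hK, Real.sq_sqrt (by positivity)]; field_simp
  have hbound : ∀ n m, ∀ t ∈ Icc 0 T,
      ‖sliceLp hb (sm n) t - sliceLp hb (sm m) t‖ ≤ K * (ε n + ε m) := by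
    intro n m t ht
    have hs := (sm n).sub (sm m)
    have e0 : sliceLp hb (sm n) t - sliceLp hb (sm m) t = sliceLp hb hs t := by
      rw [sliceLp, sliceLp, ← MemLp.toLp_sub]; rfl
    have e1 := norm_sliceLp_sq_le hb hT hs ht
    have tri : ∀ {a b c : Sp d × ℝ → ℝ}, MemLp a 2 (volQ Ω T) → MemLp b 2 (volQ Ω T) →
        MemLp c 2 (volQ Ω T) → l2 (volQ Ω T) (fun z => b z - c z)
          ≤ l2 (volQ Ω T) (fun z => a z - b z) + l2 (volQ Ω T) (fun z => a z - c z) := by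
      intro a b c ha hb' hc
      rw [l2_sub_comm a b]
      refine le_trans (le_of_eq ?_) (l2_add_le (hb'.sub ha) (ha.sub hc))
      congr 1; ext z; simp
    have a1 : l2 (volQ Ω T) (fun z => q n z - q m z) ≤ ε n + ε m := by
      refine (tri hy (mq n) (mq m)).trans ?_
      simp only [hε]
      linarith [l2_nonneg (μ := volQ Ω T) (fun z => w z - timeDeriv (q n) z),
        l2_nonneg (μ := volQ Ω T) (fun z => w z - timeDeriv (q m) z)]
    have e2 : timeDeriv (fun z => q n z - q m z) = fun z => timeDeriv (q n) z - timeDeriv (q m) z := by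
      funext z
      have d1 := contDiff_differentiable (sm n) z
      have d2 := contDiff_differentiable (sm m) z
      rw [timeDeriv_eq (φ := fun z => q n z - q m z) (d1.sub d2), timeDeriv_eq d1, timeDeriv_eq d2, fderiv_fun_sub d1 d2]
      rfl
    have a2 : l2 (volQ Ω T) (timeDeriv fun z => q n z - q m z) ≤ ε n + ε m := by
      rw [e2]
      refine (tri hw (mqt n) (mqt m)).trans ?_
      simp only [hε]
      linarith [l2_nonneg (μ := volQ Ω T) (fun z => y z - q n z),
        l2_nonneg (μ := volQ Ω T) (fun z => y z - q m z)]
    have b0 : 0 ≤ ε n + ε m := (l2_nonneg _).trans a1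
    have c1 := pow_le_pow_left₀ (l2_nonneg _) a1 2
    have c2 := pow_le_pow_left₀ (l2_nonneg _) a2 2
    rw [e0]
    refine abs_le_of_sq_le_sq' ?_ (by positivity) |>.2
    have c3 : T * ‖sliceLp hb hs t‖ ^ 2 ≤ T * (K * (ε n + ε m)) ^ 2 := by
      have : T * (K * (ε n + ε m)) ^ 2 = (1 + 2 * T) * (ε n + ε m) ^ 2 := by rw [← hK2]; ring
      rw [this]
      nlinarith
    exact le_of_mul_le_mul_left c3 hT
  have hcs : UniformCauchySeqOn (fun n => sliceLp hb (sm n)) atTop (Icc 0 T) := by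
    rw [Metric.uniformCauchySeqOn_iff]
    intro δ hδ
    have : ∀ᶠ n in atTop, K * ε n < δ / 2 := by
      have := hε0.const_mul K
      rw [mul_zero] at this
      exact this.eventually_lt_const (by positivity)
    obtain ⟨N, hN⟩ := eventually_atTop.1 this
    refine ⟨N, fun m hm n hn t ht => ?_⟩
    rw [dist_eq_norm]
    refine (hbound m n t ht).trans_lt ?_
    have := hN m hm
    have := hN n hn
    linarith
  -- Outside `[0, T]` nothing is asked of the limit, and `0` serves.
  have hex : ∀ t, ∃ V : Lp ℝ 2 (volume.restrict Ω), t ∈ Icc 0 T →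
      Tendsto (fun n => sliceLp hb (sm n) t) atTop (𝓝 V) := by
    intro t
    by_cases ht : t ∈ Icc 0 T
    · obtain ⟨V, hV⟩ := cauchySeq_tendsto_of_complete (hcs.cauchySeq ht)
      exact ⟨V, fun _ => hV⟩
    · exact ⟨0, fun h => absurd h ht⟩
  choose U hU using hex
  have hunif := hcs.tendstoUniformlyOn_of_tendsto hU
  refine ⟨U, hunif.continuousOn (Frequently.of_forall fun n => continuousOn_sliceLp hΩ hb (sm n)),
    ?_, ?_⟩
  · have my : ∀ n, MemLp (fun z => y z - q n z) 2 (volQ Ω T) := fun n => hy.sub (mq n)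
    have ig : ∀ n, Integrable (fun t => ∫ x in Ω, (y (x, t) - q n (x, t)) ^ 2)
        (volume.restrict (Ioo 0 T)) := fun n => by
      have := (my n).integrable_sq
      rw [volQ_eq_prod] at this
      exact this.integral_prod_right
    -- Along a subsequence almost every slice converges in `L²(Ω)` to the slice of `y`, which
    -- identifies the uniform limit `U`.
    have htm : TendstoInMeasure (volume.restrict (Ioo 0 T))
        (fun n t => ∫ x in Ω, (y (x, t) - q n (x, t)) ^ 2) atTop 0 := by
      refine tendstoInMeasure_of_tendsto_eLpNorm one_ne_zero (fun n => (ig n).1)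
        aestronglyMeasurable_zero ?_
      have e : ∀ n, eLpNorm ((fun t => ∫ x in Ω, (y (x, t) - q n (x, t)) ^ 2) - 0) 1
          (volume.restrict (Ioo 0 T))
          = ENNReal.ofReal (l2 (volQ Ω T) (fun z => y z - q n z) ^ 2) := by
        intro n
        rw [sub_zero, eLpNorm_one_eq_lintegral_enorm, ← ofReal_integral_norm_eq_lintegral_enorm (ig n),
          sq_l2' (my n), integral_volQ_time_space (my n).integrable_sq]
        congr 1
        refine integral_congr_ae (ae_of_all _ fun t => ?_)
        exact Real.norm_of_nonneg (integral_nonneg fun x => sq_nonneg _)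
      simp only [e]
      have := ENNReal.tendsto_ofReal (h1.pow 2)
      simpa using this
    obtain ⟨k, hk, hae⟩ := htm.exists_seq_tendsto_ae
    have hyt : ∀ᵐ t ∂(volume.restrict (Ioo 0 T)),
        MemLp (fun x => y (x, t)) 2 (volume.restrict Ω) := by
      have := hy
      rw [volQ_eq_prod] at this
      exact MemLp.ae_slice_left this
    filter_upwards [hae, hyt, ae_restrict_mem measurableSet_Ioo] with t ht hyt htT
    have c1 : Tendsto (fun n => sliceLp hb (sm (k n)) t) atTop (𝓝 (U t)) :=
      (hU t (Ioo_subset_Icc_self htT)).comp hk.tendsto_atTop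
    have mt : ∀ n, MemLp (fun x => q n (x, t)) 2 (volume.restrict Ω) := fun n =>
      Continuous.memLp_restrict hb ((sm n).continuous.comp (by fun_prop))
    have c2 : Tendsto (fun n => sliceLp hb (sm (k n)) t) atTop (𝓝 (hyt.toLp _)) := by
      rw [tendsto_iff_norm_sub_tendsto_zero]
      have : ∀ n, ‖sliceLp hb (sm (k n)) t - hyt.toLp _‖
          = Real.sqrt (∫ x in Ω, (y (x, t) - q (k n) (x, t)) ^ 2) := by
        intro n
        rw [sliceLp, ← MemLp.toLp_sub, norm_toLp_eq_l2]
        have := l2_sub_comm (μ := volume.restrict Ω) (fun x => y (x, t)) (fun x => q (k n) (x, t))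
        have e := sq_l2' (μ := volume.restrict Ω) (f := fun x => y (x, t) - q (k n) (x, t))
          (hyt.sub (mt (k n)))
        rw [← e, Real.sqrt_sq (l2_nonneg _), this]
        rfl
      simp only [this]
      have := (Real.continuous_sqrt.tendsto _).comp ht
      rw [Pi.zero_apply, Real.sqrt_zero] at this
      exact this
    rw [tendsto_nhds_unique c1 c2]
    exact hyt.coeFn_toLp
  · have hz := hU 0 (left_mem_Icc.2 hT.le)
    have hz' := hU T (right_mem_Icc.2 hT.le)
    refine tendsto_nhds_unique hz (hz'.congr fun n => ?_)
    rw [sliceLp, sliceLp]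
    congr 1
    funext x
    have := (hq n).2 x 0
    simpa using this

end Trace

/-! ### From the space-time equation to almost every time slice. -/

section SliceEquation

variable {d : ℕ} {Ω : Set (Sp d)} {T : ℝ}

lemma ae_memLp_space {F : Type*} [NormedAddCommGroup F] {G : Sp d × ℝ → F}
    (hG : MemLp G 2 (volQ Ω T)) :
    ∀ᵐ t ∂(volume.restrict (Ioo 0 T)), MemLp (fun x => G (x, t)) 2 (volume.restrict Ω) := by
  rw [volQ_eq_prod] at hG
  exact MemLp.ae_slice_left hG

lemma integrable_integral_space {f : Sp d × ℝ → ℝ} (hf : Integrable f (volQ Ω T)) :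
    Integrable (fun t => ∫ x in Ω, f (x, t)) (volume.restrict (Ioo 0 T)) := by
  rw [volQ_eq_prod] at hf
  exact hf.integral_prod_right

section Pairing

variable {E : Type*} [NormedAddCommGroup E] [InnerProductSpace ℝ E]

/-- Cauchy–Schwarz in space bounds the square by `‖G(·,t)‖² ‖a‖²`, which is integrable in `t`. The
Fourier uniqueness argument needs this square integrability. -/
lemma memLp_integral_inner_slice (hb : Bornology.IsBounded Ω) {G : Sp d × ℝ → E}
    (hG : MemLp G 2 (volQ Ω T)) {a : Sp d → E} (ha : Continuous a) :
    MemLp (fun t => ∫ x in Ω, inner ℝ (G (x, t)) (a x)) 2 (volume.restrict (Ioo 0 T)) := by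
  have ma : MemLp (fun z : Sp d × ℝ => a z.1) 2 (volQ Ω T) :=
    Continuous.memLp_volQ hb (ha.comp continuous_fst)
  have hm := (integrable_integral_space (integrable_inner hG ma)).1
  refine (memLp_two_iff_integrable_sq hm).2 (((integrable_integral_space
    (integrable_inner hG hG)).mul_const (l2 (volume.restrict Ω) a ^ 2)).mono' (hm.pow 2) ?_)
  filter_upwards [ae_memLp_space hG] with t ht
  have h1 := abs_integral_inner_le ht (Continuous.memLp_restrict hb ha)
  rw [Real.norm_eq_abs, abs_of_nonneg (sq_nonneg _), ← sq_abs, ← sq_l2 ht, ← mul_pow]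
  exact pow_le_pow_left₀ (abs_nonneg _) h1 2

lemma integral_inner_smul_slice (hb : Bornology.IsBounded Ω) {G : Sp d × ℝ → E}
    (hG : MemLp G 2 (volQ Ω T)) {a : Sp d → E} (ha : Continuous a) {χ : ℝ → ℝ}
    (hχ : Continuous χ) :
    ∫ z, inner ℝ (G z) (χ z.2 • a z.1) ∂(volQ Ω T)
      = ∫ t in Ioo 0 T, (∫ x in Ω, inner ℝ (G (x, t)) (a x)) * χ t := by
  have m : MemLp (fun z : Sp d × ℝ => χ z.2 • a z.1) 2 (volQ Ω T) :=
    Continuous.memLp_volQ hb ((hχ.comp continuous_snd).smul (ha.comp continuous_fst))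
  rw [integral_volQ_time_space (integrable_inner hG m)]
  refine integral_congr_ae (ae_of_all _ fun t => ?_)
  simp only [real_inner_smul_right]
  rw [integral_const_mul, mul_comm]

end Pairing

variable {G : Sp d × ℝ → Sp d} {f : Sp d × ℝ → ℝ}

/-- The pairing of the slice at time `t` with a test function. -/
def slicePairing (Ω : Set (Sp d)) (G : Sp d × ℝ → Sp d) (f : Sp d × ℝ → ℝ) (φ : Sp d → ℝ)
    (t : ℝ) : ℝ :=
  (∫ x in Ω, inner ℝ (G (x, t)) (gradient φ x)) + ∫ x in Ω, f (x, t) * φ x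

lemma continuous_gradient {φ : Sp d → ℝ} (hφ : ContDiff ℝ ∞ φ) : Continuous (gradient φ) :=
  (InnerProductSpace.toDual ℝ (Sp d)).symm.continuous.comp (hφ.continuous_fderiv (by simp))

lemma memLp_slicePairing (hb : Bornology.IsBounded Ω) (hG : MemLp G 2 (volQ Ω T))
    (hf : MemLp f 2 (volQ Ω T)) {φ : Sp d → ℝ} (hφ : ContDiff ℝ ∞ φ) :
    MemLp (slicePairing Ω G f φ) 2 (volume.restrict (Ioo 0 T)) := by
  refine (memLp_integral_inner_slice hb hG (continuous_gradient hφ)).add ?_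
  simpa [mul_comm] using memLp_integral_inner_slice hb hf hφ.continuous

lemma integral_slicePairing_mul (hb : Bornology.IsBounded Ω) (hG : MemLp G 2 (volQ Ω T))
    (hf : MemLp f 2 (volQ Ω T)) {φ : Sp d → ℝ} (hφ : ContDiff ℝ ∞ φ) {χ : ℝ → ℝ}
    (hχ : Continuous χ) :
    ∫ t in Ioo 0 T, slicePairing Ω G f φ t * χ t
      = (∫ z, inner ℝ (G z) (χ z.2 • gradient φ z.1) ∂(volQ Ω T))
        + ∫ z, f z * (φ z.1 * χ z.2) ∂(volQ Ω T) := by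
  have hχ2 : MemLp χ 2 (volume.restrict (Ioo 0 T)) := by
    obtain ⟨C, hC⟩ := (isCompact_Icc (a := (0 : ℝ)) (b := T)).exists_bound_of_continuousOn
      hχ.continuousOn
    refine MemLp.of_bound hχ.aestronglyMeasurable C ?_
    filter_upwards [ae_restrict_mem measurableSet_Ioo] with t ht
    exact hC t (Ioo_subset_Icc_self ht)
  have e1 := integral_inner_smul_slice hb hG (continuous_gradient hφ) hχ
  have e2 := integral_inner_smul_slice hb hf hφ.continuous hχ
  have m1 := memLp_integral_inner_slice hb hG (continuous_gradient hφ)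
  have m2 := memLp_integral_inner_slice hb hf hφ.continuous
  have e3 : ∫ z, f z * (φ z.1 * χ z.2) ∂(volQ Ω T) = ∫ z, inner ℝ (f z) (χ z.2 • φ z.1) ∂(volQ Ω T) :=
    integral_congr_ae (ae_of_all _ fun z => by simp; ring)
  rw [e3, e1, e2, ← integral_add (integrable_mul_l2 m1 hχ2) (integrable_mul_l2 m2 hχ2)]
  refine integral_congr_ae (ae_of_all _ fun t => ?_)
  simp only [slicePairing, add_mul, RCLike.inner_apply, conj_trivial, mul_comm (f _)]

/-- Products of test functions in space with trigonometric polynomials are periodic. -/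
lemma space_mul_time_mem_perLat {φ : Sp d → ℝ} (hφ : φ ∈ testFunctions Ω) {χ : ℝ → ℝ}
    (hχ : ContDiff ℝ ∞ χ) (hper : ∀ t, χ (t + T) = χ t) :
    (fun z : Sp d × ℝ => φ z.1 * χ z.2) ∈ perLat Ω T :=
  ⟨mul_time_mem_smoothLat (space_mem_smoothLat hφ) hχ, fun x t => by simp [hper t]⟩

/-- For `ψ = φ(x) χ(t)` one has `ψ + ∂ₜψ = φ (χ + χ')`, so the equation becomes a scalar
orthogonality in time. -/
lemma integral_slicePairing_mul_eq_zero (hb : Bornology.IsBounded Ω) (hG : MemLp G 2 (volQ Ω T))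
    (hf : MemLp f 2 (volQ Ω T))
    (H : ∀ ψ ∈ perLat Ω T, (∫ z, inner ℝ (G z) (spaceGrad (ψ + timeDeriv ψ) z) ∂(volQ Ω T))
      + ∫ z, f z * (ψ + timeDeriv ψ) z ∂(volQ Ω T) = 0)
    {φ : Sp d → ℝ} (hφ : φ ∈ testFunctions Ω) {χ χ' : ℝ → ℝ} (hχ : ContDiff ℝ ∞ χ)
    (hχ' : ∀ t, HasDerivAt χ (χ' t) t) (hper : ∀ t, χ (t + T) = χ t) :
    ∫ t in Ioo 0 T, slicePairing Ω G f φ t * (χ t + χ' t) = 0 := by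
  have hd : deriv χ = χ' := funext fun t => (hχ' t).deriv
  have hc' : ContDiff ℝ ∞ χ' := hd ▸ (contDiff_infty_iff_deriv.1 hχ).2
  have hψ := space_mul_time_mem_perLat hφ hχ hper
  have e : (fun z : Sp d × ℝ => φ z.1 * χ z.2) + timeDeriv (fun z : Sp d × ℝ => φ z.1 * χ z.2)
      = fun z => φ z.1 * (χ z.2 + χ' z.2) := by
    funext z
    have : timeDeriv (fun z : Sp d × ℝ => φ z.1 * χ z.2) z = φ z.1 * χ' z.2 :=
      ((hχ' z.2).const_mul (φ z.1)).deriv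
    rw [Pi.add_apply, this, mul_add]
  have h := H _ hψ
  rw [e] at h
  rw [integral_slicePairing_mul hb hG hf hφ.1 (χ := fun t => χ t + χ' t)
    (hχ.continuous.add hc'.continuous), ← h]
  congr 1
  refine integral_congr_ae (ae_of_all _ fun z => ?_)
  simp only
  rw [spaceGrad_mul_time (φ := fun z : Sp d × ℝ => φ z.1) (χ := fun t => χ t + χ' t)
    (space_mem_smoothLat hφ).1 z]
  rfl

/-- On the span of `cos kωt` and `sin kωt` the operator `1 + d/dt` has determinant `1 + (kω)²` and
is invertible. Every mode is thus `χ + χ'` for a periodic `χ`, and all Fourier coefficients of the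
pairing vanish. -/
lemma ae_slicePairing_eq_zero (hb : Bornology.IsBounded Ω) (hT : 0 < T)
    (hG : MemLp G 2 (volQ Ω T)) (hf : MemLp f 2 (volQ Ω T))
    (H : ∀ ψ ∈ perLat Ω T, (∫ z, inner ℝ (G z) (spaceGrad (ψ + timeDeriv ψ) z) ∂(volQ Ω T))
      + ∫ z, f z * (ψ + timeDeriv ψ) z ∂(volQ Ω T) = 0)
    {φ : Sp d → ℝ} (hφ : φ ∈ testFunctions Ω) :
    ∀ᵐ t ∂(volume.restrict (Ioo 0 T)), slicePairing Ω G f φ t = 0 := by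
  have hmode : ∀ (k : ℕ) (a b : ℝ), ∫ t in Ioo 0 T, slicePairing Ω G f φ t *
      ((a * Real.cos (k * freq T * t) + b * Real.sin (k * freq T * t))
        + (k * freq T) * (b * Real.cos (k * freq T * t) - a * Real.sin (k * freq T * t))) = 0 := by
    intro k a b
    refine integral_slicePairing_mul_eq_zero hb hG hf H hφ
      (χ := fun t => a * Real.cos (k * freq T * t) + b * Real.sin (k * freq T * t)) ?_ ?_ ?_
    · exact ((contDiff_const.mul (Real.contDiff_cos.comp (contDiff_const.mul contDiff_id))).add
        (contDiff_const.mul (Real.contDiff_sin.comp (contDiff_const.mul contDiff_id))))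
    · intro t
      have h1 : HasDerivAt (fun t : ℝ => k * freq T * t) (k * freq T) t := by
        simpa using (hasDerivAt_id t).const_mul (k * freq T)
      convert! (h1.cos.const_mul a).add (h1.sin.const_mul b) using 1
      ring
    · intro t
      simp only [mul_add, Real.cos_add, Real.sin_add, cos_period hT k, sin_period hT k]
      ring
  have := ae_eq_zero_of_fourier hT (memLp_slicePairing hb hG hf hφ.1) (fun k => ?_) fun k => ?_
  · exact this
  · set κ : ℝ := k * freq T
    have hk : 1 + κ ^ 2 ≠ 0 := by positivity
    -- The solution of `a + κ b = 1`, `b - κ a = 0`.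
    refine Eq.trans ?_ (hmode k (1 / (1 + κ ^ 2)) (κ / (1 + κ ^ 2)))
    refine integral_congr_ae (ae_of_all _ fun t => ?_)
    simp only
    change _ = _ * ((_ / _ * Real.cos (κ * t) + _ / _ * Real.sin (κ * t))
      + κ * (_ / _ * Real.cos (κ * t) - _ / _ * Real.sin (κ * t)))
    field_simp
    ring
  · set κ : ℝ := k * freq T
    have hk : 1 + κ ^ 2 ≠ 0 := by positivity
    -- The solution of `a + κ b = 0`, `b - κ a = 1`.
    refine Eq.trans ?_ (hmode k (-κ / (1 + κ ^ 2)) (1 / (1 + κ ^ 2)))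
    refine integral_congr_ae (ae_of_all _ fun t => ?_)
    simp only
    change _ = _ * ((_ / _ * Real.cos (κ * t) + _ / _ * Real.sin (κ * t))
      + κ * (_ / _ * Real.cos (κ * t) - _ / _ * Real.sin (κ * t)))
    field_simp
    ring

/-- The null sets may be chosen independently of the test function. -/
lemma ae_forall_slicePairing_eq_zero (hb : Bornology.IsBounded Ω) (hG : MemLp G 2 (volQ Ω T))
    (hf : MemLp f 2 (volQ Ω T))
    (H : ∀ φ ∈ testFunctions Ω, ∀ᵐ t ∂(volume.restrict (Ioo 0 T)), slicePairing Ω G f φ t = 0) :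
    ∀ᵐ t ∂(volume.restrict (Ioo 0 T)), ∀ φ ∈ testFunctions Ω, slicePairing Ω G f φ t = 0 := by
  have : Fact ((2 : ℝ≥0∞) ≠ ⊤) := ⟨by norm_num⟩
  have s1 : SecondCountableTopology (Lp (Sp d) 2 (volume.restrict Ω)) := inferInstance
  have s2 : SecondCountableTopology (Lp ℝ 2 (volume.restrict Ω)) := inferInstance
  have mg : ∀ φ : testFunctions Ω, MemLp (gradient (φ : Sp d → ℝ)) 2 (volume.restrict Ω) :=
    fun φ => Continuous.memLp_restrict hb (continuous_gradient φ.2.1)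
  have mf : ∀ φ : testFunctions Ω, MemLp (φ : Sp d → ℝ) 2 (volume.restrict Ω) :=
    fun φ => Continuous.memLp_restrict hb φ.2.1.continuous
  -- The pairing sees `φ` only through `(∇φ, φ)` in a separable space. A countable dense part of the
  -- image of `j` fixes one null set, and continuity does the rest.
  let j : testFunctions Ω → Lp (Sp d) 2 (volume.restrict Ω) × Lp ℝ 2 (volume.restrict Ω) :=
    fun φ => ((mg φ).toLp _, (mf φ).toLp _)
  have h0 : (0 : Sp d → ℝ) ∈ testFunctions Ω := ⟨contDiff_const, HasCompactSupport.zero, by simp⟩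
  have : Nonempty (range j) := ⟨⟨_, ⟨⟨0, h0⟩, rfl⟩⟩⟩
  have hsurj : ∀ n, ∃ φ, j φ = (TopologicalSpace.denseSeq (range j) n).1 := fun n =>
    (TopologicalSpace.denseSeq (range j) n).2
  choose φs hφs using hsurj
  filter_upwards [ae_all_iff.2 fun n => H _ (φs n).2, ae_memLp_space hG, ae_memLp_space hf]
    with t ht hGt hft φ hφ
  have key : ∀ φ : testFunctions Ω, slicePairing Ω G f φ t
      = inner ℝ (hGt.toLp _) (j φ).1 + inner ℝ (hft.toLp _) (j φ).2 := by
    intro φ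
    rw [inner_toLp, inner_toLp, slicePairing]
    simp [mul_comm]
  have heq := (TopologicalSpace.denseRange_denseSeq (range j)).equalizer
    (g := fun p : range j => inner ℝ (hGt.toLp _) p.1.1 + inner ℝ (hft.toLp _) p.1.2)
    (h := fun _ => (0 : ℝ))
    (by fun_prop) continuous_const (funext fun n => by
      rw [Function.comp_apply, Function.comp_apply, ← hφs n, ← key, ht n])
  have := congrFun heq ⟨j ⟨φ, hφ⟩, ⟨⟨φ, hφ⟩, rfl⟩⟩
  rw [← key ⟨φ, hφ⟩] at this
  exact this

/-- Each time slice of a smooth approximation is a test function in space, so the slice equation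
integrates over `t`; density then reaches all of `H10Zero` with no time regularity of `u`. -/
lemma integral_add_eq_zero_of_slicePairing (hb : Bornology.IsBounded Ω)
    (hG : MemLp G 2 (volQ Ω T)) (hf : MemLp f 2 (volQ Ω T))
    (H : ∀ᵐ t ∂(volume.restrict (Ioo 0 T)), ∀ φ ∈ testFunctions Ω, slicePairing Ω G f φ t = 0)
    {u : Sp d × ℝ → ℝ} {g : Sp d × ℝ → Sp d} (h : IsH10Pair Ω T u g) :
    (∫ z, inner ℝ (G z) (g z) ∂(volQ Ω T)) + ∫ z, f z * u z ∂(volQ Ω T) = 0 := by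
  refine h.integral_eq_zero hb hG hf fun φ hφ => ?_
  have i1 := integrable_inner hG (memLp_spaceGrad hb hφ.1)
  have i2 := integrable_mul_l2 hf (memLp_test hb hφ.1)
  rw [integral_volQ_time_space i1, integral_volQ_time_space i2,
    ← integral_add (integrable_integral_space i1) (integrable_integral_space i2)]
  refine integral_eq_zero_of_ae ?_
  filter_upwards [H] with t ht
  have h := ht (fun x => φ (x, t)) (slice_mem_testFunctions (testFunctions_lat_subset hφ) t)
  rw [slicePairing] at h
  simpa only [spaceGrad, Pi.zero_apply] using h

end SliceEquation

/-! ### Existence of a state with square integrable time derivative. -/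

section RegularState

variable {d : ℕ} {Ω : Set (Sp d)} {T : ℝ} {y y' v : Sp d × ℝ → ℝ} {σ ν : Sp d → ℝ}
  {C C' σ₀ ν₀ : ℝ}

lemma wDt_congr (h : y =ᵐ[volQ Ω T] y') : wDt Ω T y = wDt Ω T y' := by
  have : HasWeakTimeDeriv Ω T y = HasWeakTimeDeriv Ω T y' :=
    funext fun _ => propext ⟨fun h' => h'.congr h, fun h' => h'.congr h.symm⟩
  rw [wDt, this, wDt]

lemma ae_slice_eq_space (h : y =ᵐ[volQ Ω T] y') :
    ∀ᵐ t ∂(volume.restrict (Ioo 0 T)), (fun x => y (x, t)) =ᵐ[volume.restrict Ω] fun x => y' (x, t) := by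
  rw [volQ_eq_prod] at h
  exact Measure.ae_ae_of_ae_prod (Measure.measurePreserving_swap.quasiMeasurePreserving.ae h)

lemma mem_H01per_congr (h : y =ᵐ[volQ Ω T] y') (hy : y ∈ H01per Ω T) : y' ∈ H01per Ω T := by
  obtain ⟨⟨h1, w, hw⟩, U, hU, hUy, hper⟩ := hy
  refine ⟨⟨MemLp.ae_eq h h1, w, hw.congr h⟩, U, hU, ?_, hper⟩
  filter_upwards [hUy, ae_slice_eq_space h] with t h2 h3
  exact h2.trans h3

lemma mem_H11ZeroPer_congr (hΩ : IsOpen Ω) (hb : Bornology.IsBounded Ω)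
    (h : y =ᵐ[volQ Ω T] y') (hy : y ∈ H11ZeroPer Ω T) : y' ∈ H11ZeroPer Ω T :=
  ⟨((isH10Pair_wGrad hb hy.1).congr h (ae_eq_refl _)).mem_H10Zero hΩ hb, mem_H01per_congr h hy.2⟩

/-- The state equation has a solution with a square integrable time derivative. -/
lemma exists_regular_state (hd : 0 < d) (hΩ : IsOpen Ω) (hb : Bornology.IsBounded Ω) (hT : 0 < T)
    (hσm : AEStronglyMeasurable σ (volume.restrict Ω))
    (hσ : ∀ᵐ x ∂(volume.restrict Ω), |σ x| ≤ C) (hσ₀ : ∀ᵐ x ∂(volume.restrict Ω), σ₀ ≤ σ x)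
    (hνm : AEStronglyMeasurable ν (volume.restrict Ω))
    (hν : ∀ᵐ x ∂(volume.restrict Ω), |ν x| ≤ C') (hν₀ : ∀ᵐ x ∂(volume.restrict Ω), ν₀ ≤ ν x)
    (hσ₀p : 0 < σ₀) (hν₀p : 0 < ν₀) (hv : MemLp v 2 (volQ Ω T)) :
    ∃ y, y ∈ H11ZeroPer Ω T ∧ IsState Ω T σ ν v y ∧
      HasWeakDiv Ω T (fun z => ν z.1 • wGrad Ω T y z) (fun z => σ z.1 * wDt Ω T y z - v z) := by
  obtain ⟨y, w, g, q, hy, hw, hg, hq, h1, h2, h3, H⟩ :=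
    exists_solution_limit hd hΩ hb hT hσm hσ hσ₀ hνm hν hν₀ hσ₀p hν₀p hv
  have hp : IsH10Pair Ω T y g := isH10Pair_of_tendsto hb
    (fun n => isH10Pair_of_smoothLat hΩ hb hT (hq n).1) hy hg h1 h3
  obtain ⟨hwd, hper⟩ := mem_H01per_of_tendsto hΩ hb hT hy hw hq h1 h2
  have hyz := hp.mem_H10Zero hΩ hb
  have eg := hp.wGrad_ae_eq hΩ hb
  have ew := hwd.wDt_ae_eq hΩ hb
  have mG : MemLp (fun z => ν z.1 • wGrad Ω T y z) 2 (volQ Ω T) :=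
    memLp_coeff_smul hνm hν (memLp_wGrad hyz)
  have mf : MemLp (fun z => σ z.1 * wDt Ω T y z - v z) 2 (volQ Ω T) :=
    (memLp_coeff_mul hσm hσ hwd.wDt.1).sub hv
  have H' : ∀ ψ ∈ perLat Ω T,
      (∫ z, inner ℝ (ν z.1 • wGrad Ω T y z) (spaceGrad (ψ + timeDeriv ψ) z) ∂(volQ Ω T))
        + ∫ z, (σ z.1 * wDt Ω T y z - v z) * (ψ + timeDeriv ψ) z ∂(volQ Ω T) = 0 := by
    intro ψ hψ
    rw [← H ψ hψ]
    congr 1 <;> refine integral_congr_ae ?_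
    · filter_upwards [eg] with z hz
      rw [hz]
    · filter_upwards [ew] with z hz
      rw [hz]
  -- The slice equation yields both conclusions: integrated in time it is the weak formulation, and
  -- read slice by slice it is the divergence of the flux.
  have hs := ae_forall_slicePairing_eq_zero hb mG mf fun φ hφ =>
    ae_slicePairing_eq_zero hb hT mG mf H' hφ
  refine ⟨y, ⟨hyz, hper⟩, ⟨⟨hyz, halfSq_lt_top_of_H01per hΩ hb hT hper⟩, fun q hq => ?_⟩, mf.1, ?_⟩
  · have mq := memLp_of_mem_H1half hq
    have e := integral_add_eq_zero_of_slicePairing hb mG mf hs (isH10Pair_wGrad hb hq.1)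
    rw [timeForm_eq_integral hΩ hb hT hσm hσ hper hwd.wDt mq]
    simp only [real_inner_smul_left, sub_mul] at e
    rw [integral_sub (integrable_mul_l2 (memLp_coeff_mul hσm hσ hwd.wDt.1) mq)
      (integrable_mul_l2 hv mq)] at e
    linarith
  · filter_upwards [hs, ae_memLp_space mf] with t h1 h2
    refine ⟨h2, fun φ hφ => ?_⟩
    have := h1 φ hφ
    rw [slicePairing] at this
    linarith

end RegularState

/-! ### Weak spatial divergence. -/

section Divergence

variable {d : ℕ} {Ω : Set (Sp d)} {T : ℝ} {τ : Sp d × ℝ → Sp d} {h h' : Sp d × ℝ → ℝ}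

/-- Uniqueness is clear slice by slice; joint measurability of the two candidates turns it into
uniqueness almost everywhere on the cylinder. -/
lemma HasWeakDiv.ae_eq (hΩ : IsOpen Ω) (hb : Bornology.IsBounded Ω) (H : HasWeakDiv Ω T τ h)
    (H' : HasWeakDiv Ω T τ h') : h =ᵐ[volQ Ω T] h' := by
  have hfin := isFiniteMeasure_restrict hb
  have hs : ∀ᵐ t ∂(volume.restrict (Ioo 0 T)), ∀ᵐ x ∂(volume.restrict Ω), h (x, t) - h' (x, t) = 0 := by
    filter_upwards [H.2, H'.2] with t h1 h2
    refine ae_eq_zero_of_forall_testFunctions hΩ ((h1.1.sub h2.1).integrable (by norm_num))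
      fun φ hφ => ?_
    have mφ := Continuous.memLp_restrict hb hφ.1.continuous
    have i1 := integrable_mul_l2 h1.1 mφ
    have i2 := integrable_mul_l2 h2.1 mφ
    have e := integral_sub i1 i2
    rw [h1.2 φ hφ, h2.2 φ hφ, sub_self] at e
    rw [← e]
    refine integral_congr_ae (ae_of_all _ fun x => ?_)
    simp only [smul_eq_mul]
    ring
  have m := H.1.sub H'.1
  have e := m.ae_eq_mk
  -- Fubini's theorem for null sets needs a measurable set, hence the strongly measurable
  -- representative of the difference.
  have h0 : ∀ᵐ p ∂((volume.restrict (Ioo 0 T)).prod (volume.restrict Ω)), m.mk (h - h') p.swap = 0 := by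
    have hms : MeasurableSet {p : ℝ × Sp d | m.mk (h - h') p.swap = 0} :=
      (m.stronglyMeasurable_mk.measurable.comp measurable_swap) (measurableSet_singleton 0)
    rw [Measure.ae_prod_iff_ae_ae hms]
    filter_upwards [hs, ae_slice_eq_space e] with t h1 h2
    filter_upwards [h1, h2] with x h3 h4
    exact h4.symm.trans h3
  have h1 : ∀ᵐ z ∂(volQ Ω T), m.mk (h - h') z = 0 := by
    have h1 := Measure.measurePreserving_swap.quasiMeasurePreserving.ae h0
    rw [← volQ_eq_prod] at h1
    exact h1
  filter_upwards [e, h1] with z h2 h3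
  exact sub_eq_zero.1 (h2.trans h3)

lemma HasWeakDiv.wDiv (H : HasWeakDiv Ω T τ h) : HasWeakDiv Ω T τ (wDiv Ω T τ) :=
  Classical.epsilon_spec (p := HasWeakDiv Ω T τ) ⟨h, H⟩

lemma HasWeakDiv.wDiv_ae_eq (hΩ : IsOpen Ω) (hb : Bornology.IsBounded Ω)
    (H : HasWeakDiv Ω T τ h) : TPOC.wDiv Ω T τ =ᵐ[volQ Ω T] h := H.wDiv.ae_eq hΩ hb H

/-- Integration by parts on slices, integrated in time. `HasWeakDiv` controls `h` only on single
slices, so its square integrability on the cylinder is a separate assumption. -/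
lemma HasWeakDiv.integral_inner (hb : Bornology.IsBounded Ω) (H : HasWeakDiv Ω T τ h)
    (hτ : MemLp τ 2 (volQ Ω T)) (hh : MemLp h 2 (volQ Ω T)) {u : Sp d × ℝ → ℝ}
    {g : Sp d × ℝ → Sp d} (hu : IsH10Pair Ω T u g) :
    ∫ z, inner ℝ (τ z) (g z) ∂(volQ Ω T) = -∫ z, h z * u z ∂(volQ Ω T) := by
  have := integral_add_eq_zero_of_slicePairing hb hτ hh (G := τ) (f := h) ?_ hu
  · linarith
  · filter_upwards [H.2] with t ht φ hφ
    rw [slicePairing, ht.2 φ hφ]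
    ring

end Divergence

/-! ### The guaranteed upper bound. -/

section Majorant

variable {d : ℕ} {Ω : Set (Sp d)} {T : ℝ} {y η v : Sp d × ℝ → ℝ} {τ gd : Sp d × ℝ → Sp d}
  {σ ν : Sp d → ℝ} {C C' σ₀ ν₀ CF lam α β : ℝ}

lemma nrm_sq_eq {F : Type*} [NormedAddCommGroup F] {f : Sp d × ℝ → F} (hf : MemLp f 2 (volQ Ω T)) :
    nrm Ω T f ^ 2 = ENNReal.ofReal (l2 (volQ Ω T) f ^ 2) := by
  rw [nrm, ← ofReal_l2 hf, ENNReal.ofReal_pow (l2_nonneg f)]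

lemma cost_eq (hlam : 0 ≤ lam) (hy : MemLp (wGrad Ω T y) 2 (volQ Ω T)) (hgd : MemLp gd 2 (volQ Ω T))
    (hv : MemLp v 2 (volQ Ω T)) :
    cost Ω T lam gd y v = ENNReal.ofReal
      (1 / 2 * l2 (volQ Ω T) (fun z => wGrad Ω T y z - gd z) ^ 2 + lam / 2 * l2 (volQ Ω T) v ^ 2) := by
  have m : MemLp (fun z => wGrad Ω T y z - gd z) 2 (volQ Ω T) := hy.sub hgd
  rw [cost, nrm_sq_eq m, nrm_sq_eq hv, ← ENNReal.ofReal_mul (by norm_num),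
    ← ENNReal.ofReal_mul (by positivity), ← ENNReal.ofReal_add (by positivity) (by positivity)]

lemma mu1_pos (hν₀ : 0 < ν₀) (hσ₀ : 0 < σ₀) : 0 < mu1 ν₀ σ₀ := by
  have := lt_min hν₀ hσ₀
  unfold mu1; positivity

/-- The gradient error estimate holds with `ν₀` itself; the smaller `mu1` only enlarges the
majorant. -/
lemma mu1_le (hν₀ : 0 < ν₀) (hσ₀ : 0 < σ₀) : mu1 ν₀ σ₀ ≤ ν₀ := by
  have h0 := lt_min hν₀ hσ₀
  have h1 : 1 / Real.sqrt 2 ≤ 1 := by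
    rw [div_le_one (by positivity)]
    exact Real.one_le_sqrt.2 (by norm_num)
  calc mu1 ν₀ σ₀ ≤ 1 * min ν₀ σ₀ := mul_le_mul_of_nonneg_right h1 h0.le
    _ ≤ ν₀ := by rw [one_mul]; exact min_le_left _ _

lemma gam_pos {μ : ℝ} (hα : 0 < α) (hβ : 0 < β) (hμ : 0 < μ) : 0 < gam α β μ := by
  unfold gam; positivity

lemma majorant_eq (hα : 0 < α) (hβ : 0 < β) (hlam : 0 ≤ lam) (hμ : 0 < mu1 ν₀ σ₀)
    (hη : MemLp (wGrad Ω T η) 2 (volQ Ω T)) (hgd : MemLp gd 2 (volQ Ω T))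
    (h1 : MemLp (R1 Ω T σ η τ v) 2 (volQ Ω T)) (h2 : MemLp (R2 Ω T ν η τ) 2 (volQ Ω T))
    (hv : MemLp v 2 (volQ Ω T)) :
    majorant Ω T σ ν σ₀ ν₀ CF lam gd α β η τ v = ENNReal.ofReal
      ((1 + α) / 2 * l2 (volQ Ω T) (fun z => wGrad Ω T η z - gd z) ^ 2
        + gam α β (mu1 ν₀ σ₀) * (l2 (volQ Ω T) (R2 Ω T ν η τ) ^ 2
          + CF ^ 2 / β * l2 (volQ Ω T) (R1 Ω T σ η τ v) ^ 2)
        + lam / 2 * l2 (volQ Ω T) v ^ 2) := by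
  have m : MemLp (fun z => wGrad Ω T η z - gd z) 2 (volQ Ω T) := hη.sub hgd
  have hg := gam_pos hα hβ hμ
  rw [majorant, nrm_sq_eq m, nrm_sq_eq hv, nrm_sq_eq h1, nrm_sq_eq h2,
    ← ENNReal.ofReal_mul (by positivity), ← ENNReal.ofReal_mul (by positivity),
    ← ENNReal.ofReal_add (by positivity) (by positivity), ← ENNReal.ofReal_mul hg.le,
    ← ENNReal.ofReal_mul (by positivity), ← ENNReal.ofReal_add (by positivity) (by positivity),
    ← ENNReal.ofReal_add (by positivity) (by positivity)]

/-- Membership in `Hdiv` bounds the divergence only slice by slice, so `R1` may leave `L²(Q)`; since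
its weight is positive, the upper bound is then trivial. -/
lemma majorant_eq_top (hα : 0 < α) (hβ : 0 < β) (hCF : 0 < CF) (hμ : 0 < mu1 ν₀ σ₀)
    (h : nrm Ω T (R1 Ω T σ η τ v) = ⊤) :
    majorant Ω T σ ν σ₀ ν₀ CF lam gd α β η τ v = ⊤ := by
  have h1 : ENNReal.ofReal (CF ^ 2 / β) ≠ 0 := by
    rw [ne_eq, ENNReal.ofReal_eq_zero, not_le]; positivity
  have h2 : ENNReal.ofReal (gam α β (mu1 ν₀ σ₀)) ≠ 0 := by
    rw [ne_eq, ENNReal.ofReal_eq_zero, not_le]; exact gam_pos hα hβ hμ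
  rw [majorant, h, ENNReal.top_pow two_ne_zero, ENNReal.mul_top h1, add_top, ENNReal.mul_top h2,
    add_top, top_add]

/-- Young's inequality applied twice. -/
lemma sq_le_of_two_young {A B D r₁ r₂ μ : ℝ} (hα : 0 < α) (hβ : 0 < β) (hμ : 0 < μ) (hμν : μ ≤ ν₀)
    (hA : 0 ≤ A) (hD : 0 ≤ D) (h1 : A ≤ B + D) (h2 : ν₀ * D ≤ CF * r₁ + r₂) :
    1 / 2 * A ^ 2 ≤ (1 + α) / 2 * B ^ 2 + gam α β μ * (r₂ ^ 2 + CF ^ 2 / β * r₁ ^ 2) := by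
  have e1 : A ^ 2 ≤ (1 + α) * B ^ 2 + (1 + α) / α * D ^ 2 := by
    have h3 := pow_le_pow_left₀ hA h1 2
    -- Young's inequality for `(B + D)²`, with its defect as a perfect square.
    have h4 : (1 + α) * B ^ 2 + (1 + α) / α * D ^ 2 - (B + D) ^ 2 = (α * B - D) ^ 2 / α := by
      field_simp; ring
    have h5 : 0 ≤ (α * B - D) ^ 2 / α := by positivity
    linarith
  have e2 : μ ^ 2 * D ^ 2 ≤ (1 + β) * (r₂ ^ 2 + CF ^ 2 / β * r₁ ^ 2) := by
    have h3 : μ * D ≤ CF * r₁ + r₂ := (mul_le_mul_of_nonneg_right hμν hD).trans h2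
    have h4 := pow_le_pow_left₀ (by positivity) h3 2
    -- The same with parameter `β`; the weight `1 + β` goes to `r₂²` and `1 + 1/β` to `(C_F r₁)²`.
    have h5 : (1 + β) * (r₂ ^ 2 + CF ^ 2 / β * r₁ ^ 2) - (CF * r₁ + r₂) ^ 2
        = (β * r₂ - CF * r₁) ^ 2 / β := by
      field_simp; ring
    have h6 : 0 ≤ (β * r₂ - CF * r₁) ^ 2 / β := by positivity
    rw [mul_pow] at h4
    linarith
  have e3 : gam α β μ * (r₂ ^ 2 + CF ^ 2 / β * r₁ ^ 2)
      = (1 + α) / α / 2 / μ ^ 2 * ((1 + β) * (r₂ ^ 2 + CF ^ 2 / β * r₁ ^ 2)) := by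
    unfold gam; field_simp
  have e4 : (1 + α) / α / 2 / μ ^ 2 * (μ ^ 2 * D ^ 2) = (1 + α) / α * D ^ 2 / 2 := by
    field_simp
  have e5 := mul_le_mul_of_nonneg_left e2 (show 0 ≤ (1 + α) / α / 2 / μ ^ 2 by positivity)
  rw [e3]
  linarith

/-- A posteriori estimate of the error between the state and an approximation. -/
lemma l2_grad_error_le (hΩ : IsOpen Ω) (hb : Bornology.IsBounded Ω) (hT : 0 < T)
    (hσm : AEStronglyMeasurable σ (volume.restrict Ω))
    (hσ : ∀ᵐ x ∂(volume.restrict Ω), |σ x| ≤ C)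
    (hνm : AEStronglyMeasurable ν (volume.restrict Ω))
    (hν : ∀ᵐ x ∂(volume.restrict Ω), |ν x| ≤ C') (hν₀ : ∀ᵐ x ∂(volume.restrict Ω), ν₀ ≤ ν x)
    (hCF : IsFriedrichsConstant Ω T CF) (hv : MemLp v 2 (volQ Ω T))
    (hy : IsState Ω T σ ν v y) (hη : η ∈ H11ZeroPer Ω T) (hτ : τ ∈ Hdiv Ω T)
    (h1 : MemLp (R1 Ω T σ η τ v) 2 (volQ Ω T)) :
    ν₀ * l2 (volQ Ω T) (fun z => wGrad Ω T y z + (-1 : ℝ) • wGrad Ω T η z)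
      ≤ CF * l2 (volQ Ω T) (R1 Ω T σ η τ v) + l2 (volQ Ω T) (R2 Ω T ν η τ) := by
  obtain ⟨hτ2, h, hdiv⟩ := hτ
  obtain ⟨w, hw⟩ := hη.2.1.2
  have hηh : η ∈ H1halfZeroPer Ω T := ⟨hη.1, halfSq_lt_top_of_H01per hΩ hb hT hη.2⟩
  have he := mem_H1half_add_mul hΩ hb hT hy.1 hηh (-1)
  have hp := isH10Pair_add_mul hb hy.1.1 hη.1 (-1)
  set e : Sp d × ℝ → ℝ := fun z => y z + (-1) * η z with he_def
  set g : Sp d × ℝ → Sp d := fun z => wGrad Ω T y z + (-1 : ℝ) • wGrad Ω T η z with hg_def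
  have eg := hp.wGrad_ae_eq hΩ hb
  have my := memLp_wGrad hy.1.1
  have mη := memLp_wGrad hη.1
  have me : MemLp e 2 (volQ Ω T) := hp.1
  have mg : MemLp g 2 (volQ Ω T) := hp.2.1
  have mσ := memLp_coeff_mul hσm hσ hw.wDt.1
  -- The other terms of `R1` are square integrable, so the divergence is as well.
  have md : MemLp (wDiv Ω T τ) 2 (volQ Ω T) := by
    have : MemLp (fun z => σ z.1 * wDt Ω T η z - v z - R1 Ω T σ η τ v z) 2 (volQ Ω T) :=
      (mσ.sub hv).sub h1
    refine this.congr_norm hdiv.wDiv.1 (ae_of_all _ fun z => ?_)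
    simp [R1]
  have m2 : MemLp (R2 Ω T ν η τ) 2 (volQ Ω T) := hτ2.sub (memLp_coeff_smul hνm hν mη)
  have s1 := hy.2 e he
  -- As the form vanishes at `(e, e)`, `y` may be replaced by `η`, which has a time derivative in
  -- `L²(Q)`.
  have s2 : timeForm Ω T σ y e = ∫ z, σ z.1 * wDt Ω T η z * e z ∂(volQ Ω T) := by
    have h3 := timeForm_add_mul hT hσm hσ hy.1 hηh he (-1)
    rw [timeForm_self] at h3
    rw [← timeForm_eq_integral hΩ hb hT hσm hσ hη.2 hw.wDt me]
    linarith
  have s3 : ∫ z, ν z.1 * inner ℝ (wGrad Ω T y z) (wGrad Ω T e z) ∂(volQ Ω T)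
      = ∫ z, ν z.1 * inner ℝ (wGrad Ω T y z) (g z) ∂(volQ Ω T) := by
    refine integral_congr_ae ?_
    filter_upwards [eg] with z hz
    rw [hz]
  have s4 := hdiv.wDiv.integral_inner hb hτ2 md hp
  have s5 : ∫ z, ν z.1 * inner ℝ (g z) (g z) ∂(volQ Ω T)
      = (∫ z, ν z.1 * inner ℝ (wGrad Ω T y z) (g z) ∂(volQ Ω T))
        - ∫ z, ν z.1 * inner ℝ (wGrad Ω T η z) (g z) ∂(volQ Ω T) := by
    rw [← integral_sub (integrable_coeff_inner hνm hν my mg) (integrable_coeff_inner hνm hν mη mg)]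
    refine integral_congr_ae (ae_of_all _ fun z => ?_)
    simp only
    conv_lhs => rw [hg_def]
    simp only [inner_add_left, real_inner_smul_left]
    ring
  have s6 : ∫ z, inner ℝ (R2 Ω T ν η τ z) (g z) ∂(volQ Ω T)
      = (∫ z, inner ℝ (τ z) (g z) ∂(volQ Ω T))
        - ∫ z, ν z.1 * inner ℝ (wGrad Ω T η z) (g z) ∂(volQ Ω T) := by
    rw [← integral_sub (integrable_inner hτ2 mg) (integrable_coeff_inner hνm hν mη mg)]
    refine integral_congr_ae (ae_of_all _ fun z => ?_)
    simp only [R2, inner_sub_left, real_inner_smul_left]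
  have s7 : ∫ z, R1 Ω T σ η τ v z * e z ∂(volQ Ω T)
      = (∫ z, σ z.1 * wDt Ω T η z * e z ∂(volQ Ω T)) - (∫ z, wDiv Ω T τ z * e z ∂(volQ Ω T))
        - ∫ z, v z * e z ∂(volQ Ω T) := by
    have i1 := integrable_mul_l2 mσ me
    have i2 := integrable_mul_l2 md me
    rw [← integral_sub i1 i2, ← integral_sub (f := fun z => σ z.1 * wDt Ω T η z * e z
      - wDiv Ω T τ z * e z) (i1.sub i2) (integrable_mul_l2 hv me)]
    refine integral_congr_ae (ae_of_all _ fun z => ?_)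
    simp only [R1]
    ring
  have c0 := coercive_coeff hνm hν hν₀ mg
  have c1 := neg_le_of_abs_le (abs_integral_mul_le h1 me)
  have c2 := le_of_abs_le (abs_integral_inner_le m2 mg)
  have c3 := hCF.l2_le hΩ hb hp
  have c4 := mul_le_mul_of_nonneg_left c3 (l2_nonneg (μ := volQ Ω T) (R1 Ω T σ η τ v))
  -- The identities above combine to `∫ ν |g|² = ∫ R₂ · g - ∫ R₁ e`.
  have c5 : ν₀ * l2 (volQ Ω T) g ^ 2 ≤ (CF * l2 (volQ Ω T) (R1 Ω T σ η τ v)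
      + l2 (volQ Ω T) (R2 Ω T ν η τ)) * l2 (volQ Ω T) g := by
    rw [s3] at s1
    linarith
  rcases (l2_nonneg (μ := volQ Ω T) g).eq_or_lt with h0 | h0
  · rw [← h0, mul_zero]
    exact add_nonneg (mul_nonneg hCF.1.le (l2_nonneg _)) (l2_nonneg _)
  · refine le_of_mul_le_mul_right ?_ h0
    rwa [mul_assoc, ← pow_two]

/-- The majorant bounds the cost from above. -/
lemma cost_le_majorant (hΩ : IsOpen Ω) (hb : Bornology.IsBounded Ω) (hT : 0 < T)
    (hσm : AEStronglyMeasurable σ (volume.restrict Ω))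
    (hσ : ∀ᵐ x ∂(volume.restrict Ω), |σ x| ≤ C)
    (hνm : AEStronglyMeasurable ν (volume.restrict Ω))
    (hν : ∀ᵐ x ∂(volume.restrict Ω), |ν x| ≤ C') (hν₀ : ∀ᵐ x ∂(volume.restrict Ω), ν₀ ≤ ν x)
    (hν₀p : 0 < ν₀) (hσ₀p : 0 < σ₀) (hlam : 0 ≤ lam) (hgd : MemLp gd 2 (volQ Ω T))
    (hCF : IsFriedrichsConstant Ω T CF) (hv : MemLp v 2 (volQ Ω T))
    (hy : IsState Ω T σ ν v y) (hα : 0 < α) (hβ : 0 < β) (hη : η ∈ H11ZeroPer Ω T)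
    (hτ : τ ∈ Hdiv Ω T) :
    cost Ω T lam gd y v ≤ majorant Ω T σ ν σ₀ ν₀ CF lam gd α β η τ v := by
  have hμ := mu1_pos hν₀p hσ₀p
  by_cases h1 : MemLp (R1 Ω T σ η τ v) 2 (volQ Ω T)
  · have my := memLp_wGrad hy.1.1
    have mη := memLp_wGrad hη.1
    have m2 : MemLp (R2 Ω T ν η τ) 2 (volQ Ω T) := hτ.1.sub (memLp_coeff_smul hνm hν mη)
    rw [cost_eq hlam my hgd hv, majorant_eq hα hβ hlam hμ mη hgd h1 m2 hv]
    refine ENNReal.ofReal_le_ofReal (add_le_add_left (sq_le_of_two_young hα hβ hμ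
      (mu1_le hν₀p hσ₀p) (l2_nonneg _) (l2_nonneg _) ?_
      (l2_grad_error_le hΩ hb hT hσm hσ hνm hν hν₀ hCF hv hy hη hτ h1)) _)
    refine le_trans (le_of_eq ?_) (l2_add_le (mη.sub hgd) (my.add (mη.const_smul (-1 : ℝ))))
    congr 1
    funext z
    simp only [neg_smul, one_smul]
    abel
  · obtain ⟨w, hw⟩ := hη.2.1.2
    obtain ⟨hτ2, h, hdiv⟩ := hτ
    have hm : AEStronglyMeasurable (R1 Ω T σ η τ v) (volQ Ω T) :=
      ((memLp_coeff_mul hσm hσ hw.wDt.1).1.sub hdiv.wDiv.1).sub hv.1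
    rw [majorant_eq_top hα hβ hCF.1 hμ]
    · exact le_top
    · by_contra h2
      exact h1 ⟨hm, lt_top_iff_ne_top.2 h2⟩

end Majorant

/-! ### Minimizers of quadratic functionals. -/

section Minimizer

variable {X Y : Type*} [NormedAddCommGroup X] [InnerProductSpace ℝ X] [CompleteSpace X]
  [NormedAddCommGroup Y] [InnerProductSpace ℝ Y] [CompleteSpace Y]

/-- Tikhonov functionals have minimizers. -/
lemma exists_tikhonov_minimizer (S : X →L[ℝ] Y) (g : Y) {lam : ℝ} (hlam : 0 < lam) :
    ∃ u, ∀ v, 1 / 2 * ‖S u - g‖ ^ 2 + lam / 2 * ‖u‖ ^ 2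
      ≤ 1 / 2 * ‖S v - g‖ ^ 2 + lam / 2 * ‖v‖ ^ 2 := by
  -- The normal operator is coercive with constant `lam`, so Lions' lemma with `J` the identity
  -- solves the normal equation.
  let K : X →L[ℝ] X := (ContinuousLinearMap.adjoint S).comp S + lam • ContinuousLinearMap.id ℝ X
  have hK : ∀ u q, inner ℝ u (K q) = inner ℝ (S u) (S q) + lam * inner ℝ u q := fun u q => by
    simp [K, inner_add_right, ContinuousLinearMap.adjoint_inner_right, real_inner_smul_right]
  let L : X →L[ℝ] ℝ := (innerSL ℝ g).comp S
  obtain ⟨u, -, hu⟩ := exists_lions (LinearMap.id : X →ₗ[ℝ] X) K.toLinearMap L.toLinearMap hlam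
    (norm_nonneg L) (fun q => by
      change lam * ‖q‖ ^ 2 ≤ inner ℝ q (K q)
      rw [hK, real_inner_self_eq_norm_sq, real_inner_self_eq_norm_sq]
      nlinarith [sq_nonneg ‖S q‖]) (fun q => L.le_opNorm q)
  have hu' : ∀ q, inner ℝ (S u) (S q) + lam * inner ℝ u q = inner ℝ g (S q) := fun q => by
    rw [← hK]; exact hu q
  refine ⟨u, fun v => ?_⟩
  -- In the expansion about `u` the linear part vanishes by the normal equation, and the remainder
  -- is nonnegative.
  obtain ⟨h, rfl⟩ : ∃ h, v = u + h := ⟨v - u, by abel⟩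
  have e1 : S (u + h) - g = (S u - g) + S h := by rw [map_add]; abel
  have e2 := hu' h
  rw [e1, norm_add_sq_real, norm_add_sq_real, inner_sub_left]
  nlinarith [sq_nonneg ‖S h‖, mul_nonneg hlam.le (sq_nonneg ‖h‖)]

/-- Convexity of the squared norm: the quadratic remainder is dropped. -/
lemma sq_l2_add_ge {X E : Type*} [MeasurableSpace X] {μ : Measure X} [NormedAddCommGroup E]
    [InnerProductSpace ℝ E] {a b : X → E} (ha : MemLp a 2 μ) (hb : MemLp b 2 μ) :
    l2 μ a ^ 2 + 2 * ∫ x, inner ℝ (a x) (b x) ∂μ ≤ l2 μ (fun x => a x + b x) ^ 2 := by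
  have e : l2 μ (fun x => a x + b x) = ‖ha.toLp a + hb.toLp b‖ := by
    rw [← MemLp.toLp_add, norm_toLp_eq_l2]; rfl
  rw [e, norm_add_sq_real, norm_toLp_eq_l2, inner_toLp]
  linarith [sq_nonneg ‖hb.toLp b‖]

end Minimizer

/-! ### Optimal controls and the optimality system. -/

section OptimalControl

variable {d : ℕ} {Ω : Set (Sp d)} {T : ℝ} {y p u v v' : Sp d × ℝ → ℝ} {gd : Sp d × ℝ → Sp d}
  {σ ν : Sp d → ℝ} {C C' σ₀ ν₀ lam : ℝ}

lemma IsState.congr_control (hy : IsState Ω T σ ν v y) (h : v =ᵐ[volQ Ω T] v') :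
    IsState Ω T σ ν v' y := by
  refine ⟨hy.1, fun q hq => ?_⟩
  rw [hy.2 q hq]
  refine integral_congr_ae ?_
  filter_upwards [h] with z hz
  rw [hz]

/-- By convexity the cost exceeds its value at `(y, u)` by at least its linear part there, and this
vanishes. With `e = y' - y` and `w = v - u`, the adjoint equation tested with `e`, the equation of
`e` tested with `p` and antisymmetry give `∫ (∇y - g_d) · ∇e = ∫ w p`, while `lam ∫ u w = -∫ w p`.
-/
lemma isOptimal_of_optimalitySystem (hΩ : IsOpen Ω) (hb : Bornology.IsBounded Ω) (hT : 0 < T)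
    (hσm : AEStronglyMeasurable σ (volume.restrict Ω))
    (hσ : ∀ᵐ x ∂(volume.restrict Ω), |σ x| ≤ C)
    (hνm : AEStronglyMeasurable ν (volume.restrict Ω))
    (hν : ∀ᵐ x ∂(volume.restrict Ω), |ν x| ≤ C') (hlam : 0 < lam) (hgd : MemLp gd 2 (volQ Ω T))
    (h : IsOptimalitySystemSolution Ω T σ ν lam gd y p) :
    IsOptimal Ω T σ ν lam gd (fun z => -(lam⁻¹ * p z)) y := by
  obtain ⟨hy, hp, hadj, hstate⟩ := h
  have mp := memLp_of_mem_H1half hp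
  have my := memLp_wGrad hy.1
  have mgp := memLp_wGrad hp.1
  have mu : MemLp (fun z => -(lam⁻¹ * p z)) 2 (volQ Ω T) := (mp.const_mul lam⁻¹).neg
  have hs : IsState Ω T σ ν (fun z => -(lam⁻¹ * p z)) y := by
    refine ⟨hy, fun q hq => ?_⟩
    have h1 := hstate q hq
    have mq := memLp_of_mem_H1half hq
    rw [integral_add (integrable_coeff_inner hνm hν my (memLp_wGrad hq.1))
      ((integrable_mul_l2 mp mq).const_mul _)] at h1
    have h2 : ∫ z, -(lam⁻¹ * p z) * q z ∂(volQ Ω T) = -∫ z, lam⁻¹ * (p z * q z) ∂(volQ Ω T) := by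
      rw [← integral_neg]
      exact integral_congr_ae (ae_of_all _ fun z => by simp only; ring)
    rw [h2]
    linarith
  refine ⟨mu, hs, fun v hv y' hy' => ?_⟩
  have hv : MemLp v 2 (volQ Ω T) := hv
  have my' := memLp_wGrad hy'.1.1
  set u : Sp d × ℝ → ℝ := fun z => -(lam⁻¹ * p z) with hu_def
  have he := hy'.add_mul hΩ hb hT hσm hσ hνm hν hv mu hs (-1)
  have eg := wGrad_add_mul hΩ hb hy'.1.1 hy.1 (-1)
  set e : Sp d × ℝ → ℝ := fun z => y' z + (-1) * y z
  set g : Sp d × ℝ → Sp d := fun z => wGrad Ω T y' z + (-1 : ℝ) • wGrad Ω T y z with hg_def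
  set w : Sp d × ℝ → ℝ := fun z => v z + (-1) * u z with hw_def
  have mw : MemLp w 2 (volQ Ω T) := hv.add (mu.const_mul (-1))
  have mg : MemLp g 2 (volQ Ω T) := my'.add (my.const_smul (-1 : ℝ))
  have mge := memLp_wGrad he.1.1
  have a1 := hadj e he.1
  rw [integral_sub (integrable_inner my mge) (integrable_coeff_inner hνm hν mgp mge)] at a1
  have a2 := he.2 p hp
  have a3 := timeForm_antisymm (Ω := Ω) (T := T) (σ := σ) p e
  have a4 : ∫ z, ν z.1 * inner ℝ (wGrad Ω T e z) (wGrad Ω T p z) ∂(volQ Ω T)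
      = ∫ z, ν z.1 * inner ℝ (wGrad Ω T p z) (wGrad Ω T e z) ∂(volQ Ω T) :=
    integral_congr_ae (ae_of_all _ fun z => by simp only [real_inner_comm])
  have a5 : ∫ z, inner ℝ (wGrad Ω T y z - gd z) (g z) ∂(volQ Ω T) = ∫ z, w z * p z ∂(volQ Ω T) := by
    have e1 : ∫ z, inner ℝ (wGrad Ω T y z - gd z) (g z) ∂(volQ Ω T)
        = (∫ z, inner ℝ (wGrad Ω T y z) (wGrad Ω T e z) ∂(volQ Ω T))
          - ∫ z, inner ℝ (gd z) (wGrad Ω T e z) ∂(volQ Ω T) := by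
      rw [← integral_sub (integrable_inner my mge) (integrable_inner hgd mge)]
      refine integral_congr_ae ?_
      filter_upwards [eg] with z hz
      rw [hz, inner_sub_left]
    linarith
  have a6 : lam * ∫ z, inner ℝ (u z) (w z) ∂(volQ Ω T) = -∫ z, w z * p z ∂(volQ Ω T) := by
    rw [← integral_const_mul, ← integral_neg]
    refine integral_congr_ae (ae_of_all _ fun z => ?_)
    simp only [hu_def, RCLike.inner_apply, conj_trivial]
    field_simp
  have b1 := sq_l2_add_ge (my.sub hgd) mg
  have b2 := sq_l2_add_ge mu mw
  have c1 : (fun z => (wGrad Ω T y - gd) z + g z) = fun z => wGrad Ω T y' z - gd z := by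
    funext z
    simp only [hg_def, Pi.sub_apply, neg_smul, one_smul]
    abel
  have c2 : (fun z => u z + w z) = v := by
    funext z
    simp only [hw_def]; ring
  rw [c1] at b1
  rw [c2] at b2
  simp only [Pi.sub_apply] at b1
  rw [a5] at b1
  rw [cost_eq hlam.le my hgd mu, cost_eq hlam.le my' hgd hv]
  refine ENNReal.ofReal_le_ofReal ?_
  have b3 := mul_le_mul_of_nonneg_left b2 (show 0 ≤ lam / 2 by positivity)
  have b4 : l2 (volQ Ω T) (wGrad Ω T y - gd) = l2 (volQ Ω T) fun z => wGrad Ω T y z - gd z := rfl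
  rw [b4] at b1
  linarith

/-- The control-to-gradient map is bounded and linear on `L²(Q)`. -/
lemma exists_controlToGrad (hd : 0 < d) (hΩ : IsOpen Ω) (hb : Bornology.IsBounded Ω) (hT : 0 < T)
    (hσm : AEStronglyMeasurable σ (volume.restrict Ω))
    (hσ : ∀ᵐ x ∂(volume.restrict Ω), |σ x| ≤ C) (hσ₀ : ∀ᵐ x ∂(volume.restrict Ω), σ₀ ≤ σ x)
    (hνm : AEStronglyMeasurable ν (volume.restrict Ω))
    (hν : ∀ᵐ x ∂(volume.restrict Ω), |ν x| ≤ C') (hν₀ : ∀ᵐ x ∂(volume.restrict Ω), ν₀ ≤ ν x)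
    (hσ₀p : 0 < σ₀) (hν₀p : 0 < ν₀) :
    ∃ S : Lp ℝ 2 (volQ Ω T) →L[ℝ] Lp (Sp d) 2 (volQ Ω T),
      ∀ (v y : Sp d × ℝ → ℝ) (hv : MemLp v 2 (volQ Ω T)) (hy : IsState Ω T σ ν v y),
        S (hv.toLp v) = (memLp_wGrad hy.1.1).toLp _ := by
  obtain ⟨CF, hCF⟩ := exists_isFriedrichsConstant hd hΩ hb T
  have hex : ∀ v : Lp ℝ 2 (volQ Ω T), ∃ y, IsState Ω T σ ν v y := fun v => by
    obtain ⟨y, -, hy, -⟩ :=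
      exists_regular_state hd hΩ hb hT hσm hσ hσ₀ hνm hν hν₀ hσ₀p hν₀p (Lp.memLp v)
    exact ⟨y, hy⟩
  choose Y hst using hex
  -- States are unique only almost everywhere, but their chosen gradients agree exactly, so the
  -- result is independent of the state and of the representative of the control.
  have huniq : ∀ (v : Lp ℝ 2 (volQ Ω T)) (v' y : Sp d × ℝ → ℝ), (v : Sp d × ℝ → ℝ) =ᵐ[volQ Ω T] v' →
      IsState Ω T σ ν v' y → wGrad Ω T (Y v) = wGrad Ω T y := fun v v' y h hy =>
    wGrad_congr ((hst v).unique hΩ hb hT hσm hσ hνm hν hν₀ hν₀p hCF (Lp.memLp v)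
      (hy.congr_control h.symm))
  let S₀ : Lp ℝ 2 (volQ Ω T) → Lp (Sp d) 2 (volQ Ω T) := fun v =>
    (memLp_wGrad (hst v).1.1).toLp _
  have hlin : ∀ (v v' : Lp ℝ 2 (volQ Ω T)) (c : ℝ), S₀ (v + c • v') = S₀ v + c • S₀ v' := by
    intro v v' c
    have e1 : (↑(v + c • v') : Sp d × ℝ → ℝ) =ᵐ[volQ Ω T] fun z => v z + c * v' z := by
      filter_upwards [Lp.coeFn_add v (c • v'), Lp.coeFn_smul c v'] with z h1 h2
      rw [h1, Pi.add_apply, h2, Pi.smul_apply, smul_eq_mul]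
    have e2 := huniq _ _ _ e1 ((hst v).add_mul hΩ hb hT hσm hσ hνm hν (Lp.memLp v) (Lp.memLp v')
      (hst v') c)
    change MemLp.toLp _ _ = MemLp.toLp _ _ + c • MemLp.toLp _ _
    rw [← MemLp.toLp_const_smul, ← MemLp.toLp_add]
    refine MemLp.toLp_congr _ _ ?_
    rw [e2]
    exact wGrad_add_mul hΩ hb (hst v).1.1 (hst v').1.1 c
  have hzero : S₀ 0 = 0 := by
    have := hlin 0 0 (-1)
    simpa using this
  let S : Lp ℝ 2 (volQ Ω T) →ₗ[ℝ] Lp (Sp d) 2 (volQ Ω T) :=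
    { toFun := S₀
      map_add' := fun v v' => by simpa using hlin v v' 1
      map_smul' := fun c v => by simpa [hzero] using hlin 0 v c }
  refine ⟨S.mkContinuous (CF / ν₀) fun v => ?_, fun v y hv hy => ?_⟩
  · change ‖(memLp_wGrad (hst v).1.1).toLp _‖ ≤ _
    rw [norm_toLp_eq_l2]
    have := (hst v).l2_wGrad_le hΩ hb hνm hν hν₀ hν₀p hCF (Lp.memLp v)
    exact this
  · refine MemLp.toLp_congr (memLp_wGrad (hst (hv.toLp v)).1.1) _ ?_
    rw [huniq (hv.toLp v) v y hv.coeFn_toLp hy]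

/-- Through the control-to-gradient operator the cost becomes a Tikhonov functional on `L²(Q)`. -/
lemma exists_isOptimal (hd : 0 < d) (hΩ : IsOpen Ω) (hb : Bornology.IsBounded Ω) (hT : 0 < T)
    (hσm : AEStronglyMeasurable σ (volume.restrict Ω))
    (hσ : ∀ᵐ x ∂(volume.restrict Ω), |σ x| ≤ C) (hσ₀ : ∀ᵐ x ∂(volume.restrict Ω), σ₀ ≤ σ x)
    (hνm : AEStronglyMeasurable ν (volume.restrict Ω))
    (hν : ∀ᵐ x ∂(volume.restrict Ω), |ν x| ≤ C') (hν₀ : ∀ᵐ x ∂(volume.restrict Ω), ν₀ ≤ ν x)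
    (hσ₀p : 0 < σ₀) (hν₀p : 0 < ν₀) (hlam : 0 < lam) (hgd : MemLp gd 2 (volQ Ω T)) :
    ∃ u y, IsOptimal Ω T σ ν lam gd u y := by
  obtain ⟨S, hS⟩ := exists_controlToGrad hd hΩ hb hT hσm hσ hσ₀ hνm hν hν₀ hσ₀p hν₀p
  obtain ⟨u, hu⟩ := exists_tikhonov_minimizer S (hgd.toLp gd) hlam
  have mu : MemLp u 2 (volQ Ω T) := Lp.memLp u
  obtain ⟨y, -, hy, -⟩ := exists_regular_state hd hΩ hb hT hσm hσ hσ₀ hνm hν hν₀ hσ₀p hν₀p mu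
  have hval : ∀ (v y : Sp d × ℝ → ℝ) (hv : MemLp v 2 (volQ Ω T)), IsState Ω T σ ν v y →
      cost Ω T lam gd y v = ENNReal.ofReal (1 / 2 * ‖S (hv.toLp v) - hgd.toLp gd‖ ^ 2
        + lam / 2 * ‖hv.toLp v‖ ^ 2) := by
    intro v y hv hy
    rw [cost_eq hlam.le (memLp_wGrad hy.1.1) hgd hv, hS v y hv hy, ← MemLp.toLp_sub,
      norm_toLp_eq_l2, norm_toLp_eq_l2]
    rfl
  refine ⟨u, y, mu, hy, fun v hv y' hy' => ?_⟩
  rw [hval u y mu hy, hval v y' hv hy', Lp.toLp_coeFn]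
  exact ENNReal.ofReal_le_ofReal (hu _)

end OptimalControl

/-! ### Regularity of all states and sharpness of the majorant. -/

section Sharpness

variable {d : ℕ} {Ω : Set (Sp d)} {T : ℝ} {y v : Sp d × ℝ → ℝ} {gd : Sp d × ℝ → Sp d}
  {σ ν : Sp d → ℝ} {C C' σ₀ ν₀ CF lam : ℝ}

/-- By uniqueness any state agrees almost everywhere with the regular one constructed above, and the
properties in question are insensitive to null sets. -/
lemma IsState.regular (hd : 0 < d) (hΩ : IsOpen Ω) (hb : Bornology.IsBounded Ω) (hT : 0 < T)
    (hσm : AEStronglyMeasurable σ (volume.restrict Ω))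
    (hσ : ∀ᵐ x ∂(volume.restrict Ω), |σ x| ≤ C) (hσ₀ : ∀ᵐ x ∂(volume.restrict Ω), σ₀ ≤ σ x)
    (hνm : AEStronglyMeasurable ν (volume.restrict Ω))
    (hν : ∀ᵐ x ∂(volume.restrict Ω), |ν x| ≤ C') (hν₀ : ∀ᵐ x ∂(volume.restrict Ω), ν₀ ≤ ν x)
    (hσ₀p : 0 < σ₀) (hν₀p : 0 < ν₀) (hv : MemLp v 2 (volQ Ω T)) (hy : IsState Ω T σ ν v y) :
    y ∈ H11ZeroPer Ω T ∧
      HasWeakDiv Ω T (fun z => ν z.1 • wGrad Ω T y z) (fun z => σ z.1 * wDt Ω T y z - v z) := by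
  obtain ⟨CF, hCF⟩ := exists_isFriedrichsConstant hd hΩ hb T
  obtain ⟨y', h1, h2, h3⟩ := exists_regular_state hd hΩ hb hT hσm hσ hσ₀ hνm hν hν₀ hσ₀p hν₀p hv
  have e := h2.unique hΩ hb hT hσm hσ hνm hν hν₀ hν₀p hCF hv hy
  rw [wGrad_congr e, wDt_congr e] at h3
  exact ⟨mem_H11ZeroPer_congr hΩ hb e h1, h3⟩

/-- The majorant is sharp at the state and its flux. -/
lemma tendsto_majorant (hΩ : IsOpen Ω) (hb : Bornology.IsBounded Ω)
    (hy : MemLp (wGrad Ω T y) 2 (volQ Ω T)) (hgd : MemLp gd 2 (volQ Ω T))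
    (hdiv : HasWeakDiv Ω T (fun z => ν z.1 • wGrad Ω T y z) (fun z => σ z.1 * wDt Ω T y z - v z))
    (β : ℝ) : Tendsto (fun α : ℝ => majorant Ω T σ ν σ₀ ν₀ CF lam gd α β y
      (fun z => ν z.1 • wGrad Ω T y z) v) (𝓝[>] 0) (𝓝 (cost Ω T lam gd y v)) := by
  have h2 : nrm Ω T (R2 Ω T ν y fun z => ν z.1 • wGrad Ω T y z) = 0 := by
    have : (R2 Ω T ν y fun z => ν z.1 • wGrad Ω T y z) = 0 := by
      funext z; simp [R2]
    rw [nrm, this, eLpNorm_zero]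
  have h1 : nrm Ω T (R1 Ω T σ y (fun z => ν z.1 • wGrad Ω T y z) v) = 0 := by
    have : R1 Ω T σ y (fun z => ν z.1 • wGrad Ω T y z) v =ᵐ[volQ Ω T] 0 := by
      filter_upwards [hdiv.wDiv_ae_eq hΩ hb] with z hz
      rw [R1, hz, Pi.zero_apply]
      ring
    rw [nrm, eLpNorm_congr_ae this, eLpNorm_zero]
  -- The factor `gam`, which blows up as `α → 0`, multiplies zero, so only `(1 + α)/2` still depends
  -- on `α`.
  simp only [majorant, h1, h2, cost, ne_eq, OfNat.ofNat_ne_zero, not_false_eq_true, zero_pow,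
    mul_zero, add_zero]
  refine Tendsto.add (ENNReal.Tendsto.mul_const (ENNReal.tendsto_ofReal ?_) (Or.inr ?_))
    tendsto_const_nhds
  · have : Continuous fun α : ℝ => (1 + α) / 2 := by fun_prop
    have h := this.tendsto 0
    rw [add_zero] at h
    exact h.mono_left nhdsWithin_le_nhds
  · exact ENNReal.pow_ne_top (hy.sub hgd).2.ne

end Sharpness

end TPOC

end

/-! ### The majorant theorem. -/

theorem mainTheorem8 (d : ℕ) (hd : d = 1 ∨ d = 2 ∨ d = 3)
    (Ω : Set (TPOC.Sp d)) (hΩ : TPOC.IsBoundedLipschitzDomain Ω)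
    (T : ℝ) (hT : 0 < T)
    (σ ν : TPOC.Sp d → ℝ)
    (hσm : AEStronglyMeasurable σ (volume.restrict Ω))
    (hνm : AEStronglyMeasurable ν (volume.restrict Ω))
    (σ₀ σ₁ ν₀ ν₁ : ℝ) (hσ₀ : 0 < σ₀) (hν₀ : 0 < ν₀)
    (hσ : ∀ᵐ x ∂(volume.restrict Ω), σ₀ ≤ σ x ∧ σ x ≤ σ₁)
    (hν : ∀ᵐ x ∂(volume.restrict Ω), ν₀ ≤ ν x ∧ ν x ≤ ν₁)
    (lam : ℝ) (hlam : 0 < lam)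
    (gd : TPOC.Sp d × ℝ → TPOC.Sp d) (hgd : MemLp gd 2 (TPOC.volQ Ω T)) :
    -- Friedrichs constants exist
    (∃ CF, TPOC.IsFriedrichsConstant Ω T CF) ∧
    -- every control has exactly one state
    (∀ v ∈ TPOC.L2Q Ω T, (∃ y, TPOC.IsState Ω T σ ν v y) ∧
      ∀ y y', TPOC.IsState Ω T σ ν v y → TPOC.IsState Ω T σ ν v y' →
        y =ᵐ[TPOC.volQ Ω T] y') ∧
    -- there is an optimal control, and the optimality system yields optimal controls
    (∃ u y, TPOC.IsOptimal Ω T σ ν lam gd u y) ∧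
    (∀ y p, TPOC.IsOptimalitySystemSolution Ω T σ ν lam gd y p →
      TPOC.IsOptimal Ω T σ ν lam gd (fun z => -(lam⁻¹ * p z)) y) ∧
    ∀ CF, TPOC.IsFriedrichsConstant Ω T CF →
      -- the majorant bounds the cost of every control
      (∀ v ∈ TPOC.L2Q Ω T, ∀ y, TPOC.IsState Ω T σ ν v y →
        ∀ α β : ℝ, 0 < α → 0 < β → ∀ η ∈ TPOC.H11ZeroPer Ω T, ∀ τ ∈ TPOC.Hdiv Ω T,
          TPOC.cost Ω T lam gd y v ≤ TPOC.majorant Ω T σ ν σ₀ ν₀ CF lam gd α β η τ v) ∧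
      ∀ u y, TPOC.IsOptimal Ω T σ ν lam gd u y →
        -- the infimum of the majorant is the optimal value
        IsGLB {m : ℝ≥0∞ | ∃ α β : ℝ, 0 < α ∧ 0 < β ∧ ∃ η ∈ TPOC.H11ZeroPer Ω T,
            ∃ τ ∈ TPOC.Hdiv Ω T, ∃ v ∈ TPOC.L2Q Ω T,
              m = TPOC.majorant Ω T σ ν σ₀ ν₀ CF lam gd α β η τ v}
          (TPOC.cost Ω T lam gd y u) ∧
        -- it is approached at the optimal control, its state and its flux, as `α → 0`
        y ∈ TPOC.H11ZeroPer Ω T ∧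
        (fun z => ν z.1 • TPOC.wGrad Ω T y z) ∈ TPOC.Hdiv Ω T ∧
        ∀ β : ℝ, 0 < β → Tendsto
          (fun α : ℝ => TPOC.majorant Ω T σ ν σ₀ ν₀ CF lam gd α β y
            (fun z => ν z.1 • TPOC.wGrad Ω T y z) u)
          (𝓝[>] 0) (𝓝 (TPOC.cost Ω T lam gd y u)) := by
  have hd' : 0 < d := by omega
  have hO := hΩ.isOpen
  have hb := hΩ.isBounded
  have hσb : ∀ᵐ x ∂(volume.restrict Ω), |σ x| ≤ σ₁ := hσ.mono fun x hx =>
    abs_le.2 ⟨by linarith [hx.1, hx.2], hx.2⟩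
  have hνb : ∀ᵐ x ∂(volume.restrict Ω), |ν x| ≤ ν₁ := hν.mono fun x hx =>
    abs_le.2 ⟨by linarith [hx.1, hx.2], hx.2⟩
  have hσl : ∀ᵐ x ∂(volume.restrict Ω), σ₀ ≤ σ x := hσ.mono fun x hx => hx.1
  have hνl : ∀ᵐ x ∂(volume.restrict Ω), ν₀ ≤ ν x := hν.mono fun x hx => hx.1
  obtain ⟨C, hC⟩ := TPOC.exists_isFriedrichsConstant hd' hO hb T
  have hex : ∀ v ∈ TPOC.L2Q Ω T, ∃ y, TPOC.IsState Ω T σ ν v y := fun v hv => by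
    obtain ⟨y, -, hy, -⟩ :=
      TPOC.exists_regular_state hd' hO hb hT hσm hσb hσl hνm hνb hνl hσ₀ hν₀ hv
    exact ⟨y, hy⟩
  refine ⟨⟨C, hC⟩, fun v hv => ⟨hex v hv, fun y y' hy hy' =>
      hy.unique hO hb hT hσm hσb hνm hνb hνl hν₀ hC hv hy'⟩,
    TPOC.exists_isOptimal hd' hO hb hT hσm hσb hσl hνm hνb hνl hσ₀ hν₀ hlam hgd,
    fun y p h => TPOC.isOptimal_of_optimalitySystem hO hb hT hσm hσb hνm hνb hlam hgd h,
    fun CF hCF => ?_⟩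
  have hmaj : ∀ v ∈ TPOC.L2Q Ω T, ∀ y, TPOC.IsState Ω T σ ν v y →
      ∀ α β : ℝ, 0 < α → 0 < β → ∀ η ∈ TPOC.H11ZeroPer Ω T, ∀ τ ∈ TPOC.Hdiv Ω T,
        TPOC.cost Ω T lam gd y v ≤ TPOC.majorant Ω T σ ν σ₀ ν₀ CF lam gd α β η τ v :=
    fun v hv y hy α β hα hβ η hη τ hτ => TPOC.cost_le_majorant hO hb hT hσm hσb hνm hνb hνl hν₀ hσ₀
      hlam.le hgd hCF hv hy hα hβ hη hτ
  refine ⟨hmaj, fun u y ⟨hu, hy, hopt⟩ => ?_⟩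
  obtain ⟨hreg, hdiv⟩ := hy.regular hd' hO hb hT hσm hσb hσl hνm hνb hνl hσ₀ hν₀ hu
  have my := TPOC.memLp_wGrad hreg.1
  have hflux : (fun z => ν z.1 • TPOC.wGrad Ω T y z) ∈ TPOC.Hdiv Ω T :=
    ⟨TPOC.memLp_coeff_smul hνm hνb my, _, hdiv⟩
  have hlim := fun β => TPOC.tendsto_majorant (σ₀ := σ₀) (ν₀ := ν₀) (CF := CF) (lam := lam)
    hO hb my hgd hdiv β
  refine ⟨⟨?_, fun b hbd => ?_⟩, hreg, hflux, fun β _ => hlim β⟩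
  -- The optimal value is at most the cost of `v`, which its own majorant bounds.
  · rintro m ⟨α, β, hα, hβ, η, hη, τ, hτ, v, hv, rfl⟩
    obtain ⟨y', hy'⟩ := hex v hv
    exact (hopt v hv y' hy').trans (hmaj v hv y' hy' α β hα hβ η hη τ hτ)
  -- A lower bound stays below the majorant along `α → 0`, hence below its limit, the optimal cost;
  -- `β = 1` is an arbitrary choice.
  · refine ge_of_tendsto (hlim 1) ?_
    filter_upwards [self_mem_nhdsWithin] with α hα
    exact hbd ⟨α, 1, hα, one_pos, y, hreg, _, hflux, u, hu, rfl⟩
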